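/- Let $k$ be a field and $n\ge 2$. Let $A_1,\dots,A_n$ be nonzero finite dimensional Frobenius $k$-algebras, and for $1\le i<j\le n$ let $B_{ij}$ be an $A_i$-$A_j$-bimodule (on which $k$ acts centrally) that is free of finite rank as a left $A_i$-module and as a right $A_j$-module, together with an isomorphism of $A_j$-$A_i$-bimodules $\mathrm{Hom}_{A_i}(B_{ij},A_i)\cong \mathrm{Hom}_{A_j}(B_{ij},A_j)$. Put $$A_{ij}=\bigoplus_{l\ge 0}\ \bigoplus_{i<k_1<\cdots<k_l<j} B_{ik_1}\otimes_{A_{k_1}}B_{k_1k_2}\otimes\cdots\otimes_{A_{k_l}}B_{k_lj},$$ and let $\Lambda$ be the Frobenius-type triangular matrix algebra with diagonal entries in $A_i$, $(i,j)$-entries in $A_{ij}$ for $i<j$, and multiplication given by concatenation of tensors. Assume that $\Lambda$ is connected: $\{1,\dots,n\}$ is not a disjoint union of two nonempty subsets with all $B_{ij}$ between them equal to zero. A representation $X$ of $\Lambda$ consists of left $A_i$-modules $X_i$ and $A_i$-linear maps $\varphi_{ij}:A_{ij}\otimes_{A_j}X_j\to X_i$ for $i<j$ that are compatible with the multiplication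 of $\Lambda$; representations are identified with left $\Lambda$-modules through $X\mapsto\bigoplus_i X_i$. Let $S_1(\Lambda)$ be the triangular matrix algebra formed in the same way from the vertices in the order $2<\cdots<n<1$, the algebras $A_i$, the bimodules $B_{ij}$ for $2\le i<j\le n$, and $B_{i1}=\mathrm{Hom}_{A_1}(B_{1i},A_1)$ for $2\le i\le n$. The reflection functor $F_1^+$ sends a representation $X$ of $\Lambda$ to the representation of $S_1(\Lambda)$ with modules $X_2,\dots,X_n$ and $X_1'=\ker\bigl(\bigoplus_{j=2}^n B_{1j}\otimes_{A_j} X_j\to X_1\bigr)$. Its structure maps are those of $X$ on $B_{ij}\otimes X_j$ for $2\le i<j\le n$, and on $B_{i1}\otimes_{A_1} X_1'$ the map $f\otimes (t_j)_j\mapsto \tilde f\cdot t_i\in X_i$, where $\tilde f\in\mathrm{Hom}_{A_i}(B_{1i},A_i)$ corresponds to $f\in\mathrm{Hom}_{A_1}(B_{1i},A_1)$ and $\tilde f\cdot(b\otimes x)=\tilde f(b)x$. On morphisms, $F_1^+$ is given by the given components and the induced map on kernels. Let $P_1=\Lambda e_1$, where $e_1$ is the unit of $A_1$, and let $T_1=\Lambda/P_1\oplus\tau^-(P_1)$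 be the generalized APR-tilting module, where $\tau^-=\mathrm{Tr}\,D$ is the inverse Auslander–Reiten translation, defined through minimal projective presentations. Theorem. The module $\tau^-(P_1)$ exists, and there is an isomorphism of $k$-algebras $S_1(\Lambda)\cong\mathrm{End}_\Lambda(T_1)$ (endomorphisms being multiplied so that $\mathrm{Hom}_\Lambda(T_1,X)$ is a left $\mathrm{End}_\Lambda(T_1)$-module, that is, $fg$ means first $f$, then $g$) such that, when $\mathrm{Hom}_\Lambda(T_1,X)$ is regarded as an $S_1(\Lambda)$-module through it, there is an isomorphism of functors $$F_1^+(-)\cong\mathrm{Hom}_\Lambda(T_1,-)$$ from representations of $\Lambda$ to representations of $S_1(\Lambda)$. The functor $F_1^+$ sends finitely generated representations to finitely generated ones, so that the isomorphism restricts to functors $\mathrm{rep}(\Lambda)\to\mathrm{rep}(S_1(\Lambda))$. -/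

import Mathlib

open CategoryTheory MulOpposite
open scoped TensorProduct DirectSum

universe u

noncomputable section

/-! ### Bimodules and tensor products over noncommutative rings -/

/-- An `R`-`S`-bimodule (the right action of `S` is an action of `Sᵐᵒᵖ`). -/
structure BiMod (R S : Type u) [Ring R] [Ring S] where
  carrier : Type u
  [grp : AddCommGroup carrier]
  [left : Module R carrier]
  [right : Module Sᵐᵒᵖ carrier]
  [comm : SMulCommClass R Sᵐᵒᵖ carrier]

namespace BiMod

instance {R S : Type u} [Ring R] [Ring S] : CoeSort (BiMod R S) (Type u) := ⟨BiMod.carrier⟩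

attribute [instance] BiMod.grp BiMod.left BiMod.right BiMod.comm

section Tensor

variable {R S : Type u} [Ring R] [Ring S] (M : BiMod R S)
variable (N : Type u) [AddCommGroup N] [Module S N]

/-- The relations `m s ⊗ n = m ⊗ s n`. They are stable under `R`, so that their `R`-span is the
subgroup that they generate. -/
def balRel : Submodule R (M ⊗[ℤ] N) :=
  Submodule.span R {t | ∃ (m : M) (s : S) (n : N), t = (op s • m) ⊗ₜ[ℤ] n - m ⊗ₜ[ℤ] (s • n)}

/-- The left `R`-module `M ⊗_S N`. -/
def Tens : Type u := (M ⊗[ℤ] N) ⧸ M.balRel N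

instance : AddCommGroup (M.Tens N) := inferInstanceAs (AddCommGroup ((M ⊗[ℤ] N) ⧸ M.balRel N))

instance : Module R (M.Tens N) := inferInstanceAs (Module R ((M ⊗[ℤ] N) ⧸ M.balRel N))

variable {M N}

/-- The elementary tensor `m ⊗ n` in `M ⊗_S N`. -/
def tmul (m : M) (n : N) : M.Tens N := (M.balRel N).mkQ (m ⊗ₜ[ℤ] n)

theorem add_tmul (m m' : M) (n : N) : tmul (m + m') n = tmul m n + tmul m' n := by
  simp only [tmul, TensorProduct.add_tmul, map_add]; rfl

theorem tmul_add (m : M) (n n' : N) : tmul m (n + n') = tmul m n + tmul m n' := by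
  simp only [tmul, TensorProduct.tmul_add, map_add]; rfl

theorem tmul_zero (m : M) : tmul m (0 : N) = 0 := by
  simp only [tmul, TensorProduct.tmul_zero, map_zero]; rfl

theorem smul_tmul (r : R) (m : M) (n : N) : tmul (r • m) n = r • tmul m n := by
  simp only [tmul, ← TensorProduct.smul_tmul', map_smul]; rfl

theorem tmul_bal (m : M) (s : S) (n : N) : tmul (op s • m) n = tmul m (s • n) := by
  refine (Submodule.Quotient.eq _).2 (Submodule.subset_span ⟨m, s, n, rfl⟩)

theorem tens_induction {p : M.Tens N → Prop} (h0 : p 0) (h1 : ∀ m n, p (tmul m n))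
    (h2 : ∀ x y, p x → p y → p (x + y)) (x : M.Tens N) : p x := by
  obtain ⟨y, rfl⟩ := Submodule.mkQ_surjective (M.balRel N) x
  induction y using TensorProduct.induction_on with
  | zero => exact (map_zero (M.balRel N).mkQ).symm ▸ h0
  | tmul m n => exact h1 m n
  | add a b ha hb => exact (map_add (M.balRel N).mkQ a b).symm ▸ h2 _ _ ha hb

/-- An `R`-linear, `S`-balanced pairing induces an `R`-linear map on `M ⊗_S N`. -/
def lift {Z : Type u} [AddCommGroup Z] [Module R Z] (f : M →ₗ[R] (N →+ Z))
    (hf : ∀ m (s : S) n, f (op s • m) n = f m (s • n)) : M.Tens N →ₗ[R] Z :=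
  (M.balRel N).liftQ
    { TensorProduct.liftAddHom (R := ℤ) f.toAddMonoidHom (fun z m n => by
        simp only [LinearMap.toAddMonoidHom_coe, map_zsmul]; rfl) with
      map_smul' := fun r t => by
        induction t using TensorProduct.induction_on with
        | zero => simp
        | tmul m n => simp [TensorProduct.smul_tmul']
        | add a b ha hb => simp_all [smul_add] }
    (by
      rw [balRel, Submodule.span_le]
      rintro _ ⟨m, s, n, rfl⟩
      simp [hf])

@[simp] theorem lift_tmul {Z : Type u} [AddCommGroup Z] [Module R Z] (f : M →ₗ[R] (N →+ Z))
    (hf : ∀ m (s : S) n, f (op s • m) n = f m (s • n)) (m : M) (n : N) :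
    lift f hf (tmul m n) = f m n := rfl

/-- The pairing that belongs to a linear map on `M ⊗_S N`. -/
def curry {Z : Type u} [AddCommGroup Z] [Module R Z] (g : M.Tens N →ₗ[R] Z) :
    M →ₗ[R] (N →+ Z) where
  toFun m :=
    { toFun := fun n => g (tmul m n)
      map_zero' := by rw [tmul_zero, map_zero]
      map_add' := fun n n' => by rw [tmul_add, map_add] }
  map_add' m m' := by ext n; simp [add_tmul]
  map_smul' r m := by ext n; simp [smul_tmul]

@[simp] theorem curry_apply {Z : Type u} [AddCommGroup Z] [Module R Z] (g : M.Tens N →ₗ[R] Z)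
    (m : M) (n : N) : curry g m n = g (tmul m n) := rfl

/-- An additive `S`-balanced pairing induces an additive map on `M ⊗_S N`. -/
def liftAdd {Z : Type u} [AddCommGroup Z] (f : M →+ N →+ Z)
    (hf : ∀ m (s : S) n, f (op s • m) n = f m (s • n)) : M.Tens N →+ Z :=
  QuotientAddGroup.lift (M.balRel N).toAddSubgroup
    (TensorProduct.liftAddHom (R := ℤ) f (fun z m n => by
      rw [map_zsmul, map_zsmul, AddMonoidHom.smul_apply]))
    (by
      intro x hx
      refine Submodule.closure_induction (p := fun x _ => TensorProduct.liftAddHom (R := ℤ) f _ x = 0)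
        (map_zero _) (fun x y _ _ hx hy => by rw [map_add, hx, hy, add_zero]) ?_ hx
      rintro r _ ⟨m, s, n, rfl⟩
      have e : r • op s • m = op s • r • m := smul_comm r (op s) m
      simp [smul_sub, TensorProduct.smul_tmul', e, hf])

@[simp] theorem liftAdd_tmul {Z : Type u} [AddCommGroup Z] (f : M →+ N →+ Z)
    (hf : ∀ m (s : S) n, f (op s • m) n = f m (s • n)) (m : M) (n : N) :
    liftAdd f hf (tmul m n) = f m n := rfl

variable (M) in
/-- `id ⊗ g`. -/
def tmap {N' : Type u} [AddCommGroup N'] [Module S N'] (g : N →ₗ[S] N') :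
    M.Tens N →ₗ[R] M.Tens N' :=
  lift
    { toFun := fun m => (curry (LinearMap.id : M.Tens N' →ₗ[R] M.Tens N') m).comp g.toAddMonoidHom
      map_add' := fun m m' => by ext n; simp
      map_smul' := fun r m => by ext n; simp }
    (fun m s n => by simp [tmul_bal])

@[simp] theorem tmap_tmul {N' : Type u} [AddCommGroup N'] [Module S N'] (g : N →ₗ[S] N')
    (m : M) (n : N) : M.tmap g (tmul m n) = tmul m (g n) := rfl

end Tensor

/-- The tensor product `M ⊗_S N` of an `R`-`S`-bimodule and an `S`-`T`-bimodule. -/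
def tensor {R S T : Type u} [Ring R] [Ring S] [Ring T] (M : BiMod R S) (N : BiMod S T) :
    BiMod R T :=
  letI act (t : Tᵐᵒᵖ) : N →ₗ[S] N :=
    { toFun := fun n => t • n
      map_add' := smul_add t
      map_smul' := fun s n => (smul_comm s t n).symm }
  letI mod : Module Tᵐᵒᵖ (M.Tens N) :=
    { smul := fun t x => M.tmap (act t) x
      one_smul := fun x => by
        change M.tmap (act 1) x = x
        induction x using tens_induction with
        | h0 => simp
        | h1 m n => simp [act]
        | h2 x y hx hy => rw [map_add, hx, hy]
      mul_smul := fun s t x => by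
        change M.tmap (act (s * t)) x = M.tmap (act s) (M.tmap (act t) x)
        induction x using tens_induction with
        | h0 => simp
        | h1 m n => simp [act, mul_smul]
        | h2 x y hx hy => rw [map_add, hx, hy, map_add, map_add]
      smul_zero := fun t => map_zero (M.tmap (act t))
      smul_add := fun t => map_add (M.tmap (act t))
      add_smul := fun s t x => by
        change M.tmap (act (s + t)) x = M.tmap (act s) x + M.tmap (act t) x
        induction x using tens_induction with
        | h0 => simp
        | h1 m n => simp [act, add_smul, tmul_add]
        | h2 x y hx hy => simp only [map_add, hx, hy]; abel
      zero_smul := fun x => by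
        change M.tmap (act 0) x = 0
        induction x using tens_induction with
        | h0 => simp
        | h1 m n => exact (by simpa [act] using map_zero (curry (LinearMap.id : M.Tens N →ₗ[R] M.Tens N) m))
        | h2 x y hx hy => rw [map_add, hx, hy, add_zero] }
  { carrier := M.Tens N
    comm := ⟨fun r t x => (map_smul (M.tmap (act t)) r x).symm⟩ }

theorem op_smul_tmul {R S T : Type u} [Ring R] [Ring S] [Ring T] (M : BiMod R S) (N : BiMod S T)
    (t : T) (m : M) (n : N) :
    @HSMul.hSMul Tᵐᵒᵖ (M.tensor N) (M.tensor N) _ (op t) (tmul m n) = tmul m (op t • n) := rfl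

/-- `Hom_R(M, R)` for an `R`-`S`-bimodule `M`, as an `S`-`R`-bimodule:
`(s f)(m) = f (m s)` and `(f r)(m) = f m * r`. -/
def leftDual {R S : Type u} [Ring R] [Ring S] (M : BiMod R S) : BiMod S R :=
  letI mod : Module S (M →ₗ[R] R) :=
    { smul := fun s f =>
        { toFun := fun m => f (op s • m)
          map_add' := fun m m' => by rw [smul_add, map_add]
          map_smul' := fun r m => by rw [← smul_comm r (op s) m, map_smul, RingHom.id_apply] }
      one_smul := fun f => LinearMap.ext fun m => congrArg f (one_smul Sᵐᵒᵖ m)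
      mul_smul := fun s t f => LinearMap.ext fun m => congrArg f (mul_smul (op t) (op s) m)
      smul_zero := fun s => rfl
      smul_add := fun s f g => rfl
      add_smul := fun s t f => LinearMap.ext fun m =>
        (congrArg f (add_smul (op s) (op t) m)).trans (map_add f _ _)
      zero_smul := fun f => LinearMap.ext fun m =>
        (congrArg f (zero_smul Sᵐᵒᵖ m)).trans (map_zero f) }
  { carrier := M →ₗ[R] R
    comm := ⟨fun s r f => rfl⟩ }

/-- `Hom_S(M, S)` (maps of right `S`-modules) for an `R`-`S`-bimodule `M`, as an
`S`-`R`-bimodule: `(s f)(m) = s * f m` and `(f r)(m) = f (r m)`. -/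
def rightDual {R S : Type u} [Ring R] [Ring S] (M : BiMod R S) : BiMod S R :=
  letI mod : Module Rᵐᵒᵖ (M →ₗ[Sᵐᵒᵖ] S) :=
    { smul := fun r f =>
        { toFun := fun m => f (r.unop • m)
          map_add' := fun m m' => by rw [smul_add, map_add]
          map_smul' := fun s m => by rw [smul_comm r.unop s m, map_smul, RingHom.id_apply] }
      one_smul := fun f => LinearMap.ext fun m => congrArg f (one_smul R m)
      mul_smul := fun s t f => LinearMap.ext fun m => congrArg f (mul_smul t.unop s.unop m)
      smul_zero := fun s => rfl
      smul_add := fun s f g => rfl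
      add_smul := fun s t f => LinearMap.ext fun m =>
        (congrArg f (add_smul s.unop t.unop m)).trans (map_add f _ _)
      zero_smul := fun f => LinearMap.ext fun m =>
        (congrArg f (zero_smul R m)).trans (map_zero f) }
  { carrier := M →ₗ[Sᵐᵒᵖ] S
    comm := ⟨fun s r f => rfl⟩ }

/-- The evaluation `Hom_S(M, S) × (M ⊗_S N) → N`, `(g, m ⊗ n) ↦ g(m) n`. -/
def eval {R S : Type u} [Ring R] [Ring S] (M : BiMod R S) (N : Type u) [AddCommGroup N]
    [Module S N] : M.rightDual →ₗ[S] (M.Tens N →+ N) where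
  toFun g :=
    letI g' : M →ₗ[Sᵐᵒᵖ] S := g
    liftAdd
      { toFun := fun m => DistribSMul.toAddMonoidHom N (g' m)
        map_zero' := by ext n; simp
        map_add' := fun m m' => by ext n; simp [add_smul] }
      (fun m s n => by
        have e : g' (op s • m) = g' m * s := map_smul g' (op s) m
        simp [e, mul_smul])
  map_add' g g' := by
    ext t
    induction t using tens_induction with
    | h0 => simp
    | h1 m n => exact add_smul (M := N) _ _ n
    | h2 x y hx hy => rw [map_add, map_add, hx, hy]
  map_smul' s g := by
    ext t
    induction t using tens_induction with
    | h0 => simp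
    | h1 m n => exact mul_smul s _ n
    | h2 x y hx hy => rw [map_add, map_add, hx, hy]

theorem eval_right {R S : Type u} [Ring R] [Ring S] (M : BiMod R S) (N : Type u) [AddCommGroup N]
    [Module S N] (r : R) (g : M.rightDual) (t : M.Tens N) :
    M.eval N (op r • g) t = M.eval N g (r • t) := by
  induction t using tens_induction with
  | h0 => simp
  | h1 m n => rw [← smul_tmul]; rfl
  | h2 x y hx hy => rw [map_add, smul_add, map_add, hx, hy]

theorem eval_tmap {R S : Type u} [Ring R] [Ring S] (M : BiMod R S) {N N' : Type u}
    [AddCommGroup N] [Module S N] [AddCommGroup N'] [Module S N'] (f : N →ₗ[S] N')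
    (g : M.rightDual) (t : M.Tens N) :
    M.eval N' g (M.tmap f t) = f (M.eval N g t) := by
  induction t using tens_induction with
  | h0 => simp
  | h1 m n => exact (map_smul f _ n).symm
  | h2 x y hx hy => simp only [map_add, hx, hy]

/-- The zero bimodule. -/
def zero (R S : Type u) [Ring R] [Ring S] : BiMod R S where
  carrier := PUnit
  comm := ⟨fun _ _ _ => rfl⟩

/-- Isomorphisms of bimodules. -/
structure Iso {R S : Type u} [Ring R] [Ring S] (M N : BiMod R S) where
  toEquiv : M ≃ₗ[R] N
  map_right : ∀ (s : S) (m : M), toEquiv (op s • m) = op s • toEquiv m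

end BiMod

/-! ### Frobenius-type triangular matrix algebras -/

/-- Algebras `A i` and `k`-central bimodules `B i j`, indexed by a linearly ordered set of
vertices. Only the `B i j` with `i < j` are ever used. -/
structure Species (k : Type u) [Field k] (ι : Type) [LinearOrder ι] where
  A : ι → Type u
  [ring : ∀ i, Ring (A i)]
  [alg : ∀ i, Algebra k (A i)]
  B : ∀ i j, BiMod (A i) (A j)
  central : ∀ i j (r : k) (b : B i j),
    algebraMap k (A i) r • b = op (algebraMap k (A j) r) • b

namespace Species

attribute [instance] Species.ring Species.alg

variable {k : Type u} [Field k] {ι : Type} [LinearOrder ι]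

/-- `i < k₁ < ⋯ < k_l < j` for the list `[k₁, …, k_l]`. -/
def Incr (j : ι) : List ι → ι → Prop
  | [], i => i < j
  | a :: c, i => i < a ∧ Incr j c a

theorem Incr.lt {j : ι} : ∀ {c : List ι} {i : ι}, Incr j c i → i < j
  | [], _, h => h
  | _ :: _, _, h => h.1.trans (Incr.lt h.2)

theorem Incr.cons {j i a : ι} {c : List ι} (h : i < a) (h' : Incr j c a) : Incr j (a :: c) i :=
  ⟨h, h'⟩

theorem Incr.nil {j i : ι} (h : i < j) : Incr j [] i := h

variable (S : Species k ι)

/-- `B_{i k₁} ⊗ B_{k₁ k₂} ⊗ ⋯ ⊗ B_{k_l j}` for the list `[k₁, …, k_l]`. -/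
def chainTensor (j : ι) : List ι → ∀ i, BiMod (S.A i) (S.A j)
  | [], i => S.B i j
  | a :: c, i => (S.B i a).tensor (chainTensor j c a)

/-- The element `b ⊗ t` of `B_{ia} ⊗ (B_{a k₁} ⊗ ⋯ ⊗ B_{k_l j})`. -/
def chainMk {i j a : ι} {c : List ι} (b : S.B i a) (t : S.chainTensor j c a) :
    S.chainTensor j (a :: c) i :=
  (BiMod.tmul b t : (S.B i a).Tens (S.chainTensor j c a))

theorem chain_induction {i j a : ι} {c : List ι} {p : S.chainTensor j (a :: c) i → Prop}
    (h0 : p 0) (h1 : ∀ b t, p (S.chainMk b t)) (h2 : ∀ x y, p x → p y → p (x + y))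
    (x : S.chainTensor j (a :: c) i) : p x :=
  BiMod.tens_induction (M := S.B i a) (N := S.chainTensor j c a) h0 h1 h2 x

theorem op_smul_chainMk {i j a : ι} {c : List ι} (s : S.A j) (b : S.B i a)
    (t : S.chainTensor j c a) : op s • S.chainMk b t = S.chainMk b (op s • t) := rfl

/-- `b ↦ (t ↦ b ⊗ t)`. -/
def chainMk₂ {i j a : ι} {c : List ι} :
    S.B i a →ₗ[S.A i] (S.chainTensor j c a →+ S.chainTensor j (a :: c) i) :=
  BiMod.curry (LinearMap.id : (S.B i a).Tens (S.chainTensor j c a) →ₗ[S.A i] _)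

theorem chainMk₂_apply {i j a : ι} {c : List ι} (b : S.B i a) (t : S.chainTensor j c a) :
    S.chainMk₂ b t = S.chainMk b t := rfl

/-- The bimodule `A_{ij}`: the direct sum of `B_{i k₁} ⊗ B_{k₁ k₂} ⊗ ⋯ ⊗ B_{k_l j}` over all
`l ≥ 0` and all `i < k₁ < ⋯ < k_l < j`. It is zero unless `i < j`. -/
def entry (i j : ι) : BiMod (S.A i) (S.A j) where
  carrier := ⨁ c : {c : List ι // Incr j c i}, S.chainTensor j c.1 i
  comm := ⟨fun r s x => by
    ext c
    simp only [DirectSum.smul_apply]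
    exact smul_comm r s _⟩

/-- The inclusion of the summand of `A_{ij}` that belongs to a chain. -/
def incl {i j : ι} (c : List ι) (h : Incr j c i) : S.chainTensor j c i →ₗ[S.A i] S.entry i j :=
  DirectSum.lof (S.A i) {c : List ι // Incr j c i} (fun c => S.chainTensor j c.1 i) ⟨c, h⟩

theorem incl_right {i j : ι} (c : List ι) (h : Incr j c i) (a : S.A j)
    (t : S.chainTensor j c i) : S.incl c h (op a • t) = op a • S.incl c h t :=
  map_smul (DirectSum.lof (S.A j)ᵐᵒᵖ {c : List ι // Incr j c i}
    (fun c => S.chainTensor j c.1 i) ⟨c, h⟩) (op a) t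

/-- The inclusion `B_{ij} ⊆ A_{ij}`. -/
def inclB {i j : ι} (h : i < j) : S.B i j →ₗ[S.A i] S.entry i j := S.incl [] (Incr.nil h)

theorem inclB_right {i j : ι} (h : i < j) (a : S.A j) (b : S.B i j) :
    S.inclB h (op a • b) = op a • S.inclB h b :=
  S.incl_right [] (Incr.nil h) a b

theorem entry_induction {i j : ι} {p : S.entry i j → Prop} (h0 : p 0)
    (h1 : ∀ c h t, p (S.incl c h t)) (h2 : ∀ x y, p x → p y → p (x + y)) (x : S.entry i j) : p x :=
  DirectSum.induction_on x h0 (fun c t => h1 c.1 c.2 t) h2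

/-- A family of modules `X i` with structure maps `B_{ij} ⊗ X_j → X_i` for `i < j`. -/
structure PreRep where
  X : ∀ i, ModuleCat.{u} (S.A i)
  β : ∀ i j, i < j → ((S.B i j).Tens (X j) →ₗ[S.A i] X i)

namespace PreRep

variable {S} (Y : S.PreRep)

/-- The pairing `B_{i k₁} ⊗ ⋯ ⊗ B_{k_l j} × Y_j → Y_i` that iterates the structure maps. -/
def act {j : ι} : ∀ (c : List ι) (i : ι), Incr j c i →
    (S.chainTensor j c i →ₗ[S.A i] (Y.X j →+ Y.X i))
  | [], i, h => BiMod.curry (Y.β i j h)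
  | a :: c, i, h =>
    BiMod.lift (M := S.B i a) (N := S.chainTensor j c a)
      { toFun := fun b =>
          (AddMonoidHom.compHom (BiMod.curry (Y.β i a h.1) b)).comp
            (act c a h.2).toAddMonoidHom
        map_add' := fun b b' => by
          ext t x
          simp
        map_smul' := fun r b => by
          ext t x
          simp }
      (fun b s t => by
        ext x
        simp [BiMod.tmul_bal])

theorem act_nil {i j : ι} (h : Incr j [] i) (b : S.B i j) (x : Y.X j) :
    Y.act [] i h b x = Y.β i j h (BiMod.tmul b x) := rfl

theorem act_cons {i j a : ι} {c : List ι} (h : Incr j (a :: c) i) (b : S.B i a)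
    (t : S.chainTensor j c a) (x : Y.X j) :
    Y.act (a :: c) i h (S.chainMk b t) x =
      Y.β i a h.1 (BiMod.tmul b (Y.act c a h.2 t x)) := rfl

theorem act_bal {j : ι} (s : S.A j) (x : Y.X j) : ∀ (c : List ι) (i : ι) (h : Incr j c i)
    (t : S.chainTensor j c i), Y.act c i h (op s • t) x = Y.act c i h t (s • x)
  | [], i, h, b => congrArg (Y.β i j h) (BiMod.tmul_bal (M := S.B i j) b s x)
  | a :: c, i, h, t => by
    induction t using S.chain_induction with
    | h0 => simp
    | h1 b t => rw [op_smul_chainMk, act_cons, act_cons, act_bal s x c a h.2 t]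
    | h2 t t' ht ht' => simp only [smul_add, map_add, AddMonoidHom.add_apply, ht, ht']

/-- The pairing `A_{ij} × Y_j → Y_i` that extends the structure maps. -/
def ext₂ (i j : ι) : S.entry i j →ₗ[S.A i] (Y.X j →+ Y.X i) :=
  DirectSum.toModule (S.A i) {c : List ι // Incr j c i} (Y.X j →+ Y.X i)
    (fun c => Y.act c.1 i c.2)

theorem ext₂_incl {i j : ι} (c : List ι) (h : Incr j c i) (t : S.chainTensor j c i) :
    Y.ext₂ i j (S.incl c h t) = Y.act c i h t :=
  DirectSum.toModule_lof (S.A i) (φ := fun c : {c : List ι // Incr j c i} => Y.act c.1 i c.2)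
    ⟨c, h⟩ t

theorem ext₂_bal {i j : ι} (p : S.entry i j) (s : S.A j) (x : Y.X j) :
    Y.ext₂ i j (op s • p) x = Y.ext₂ i j p (s • x) := by
  induction p using S.entry_induction with
  | h0 => simp
  | h1 c h t => rw [← incl_right, ext₂_incl, ext₂_incl, act_bal]
  | h2 p q hp hq => rw [smul_add, map_add, map_add, AddMonoidHom.add_apply,
      AddMonoidHom.add_apply, hp, hq]

/-- The map `A_{ij} ⊗ Y_j → Y_i` that extends the structure maps. -/
def ext (i j : ι) : (S.entry i j).Tens (Y.X j) →ₗ[S.A i] Y.X i :=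
  BiMod.lift (Y.ext₂ i j) (fun p s x => Y.ext₂_bal p s x)

/-- Maps that are compatible with the structure maps are compatible with their extensions. -/
theorem ext₂_map {Y Y' : S.PreRep} (f : ∀ i, Y.X i →+ Y'.X i)
    (hf : ∀ i j h b x, f i (Y.β i j h (BiMod.tmul b x)) = Y'.β i j h (BiMod.tmul b (f j x)))
    (i j : ι) (p : S.entry i j) (x : Y.X j) :
    f i (Y.ext₂ i j p x) = Y'.ext₂ i j p (f j x) := by
  have key : ∀ (c : List ι) (i : ι) (h : Incr j c i) (t : S.chainTensor j c i),
      f i (Y.act c i h t x) = Y'.act c i h t (f j x) := by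
    intro c
    induction c with
    | nil => intro i h b; exact hf i j h b x
    | cons a c ih =>
      intro i h t
      induction t using S.chain_induction with
      | h0 => simp
      | h1 b t => rw [act_cons, act_cons, hf, ih]
      | h2 t t' ht ht' => simp only [map_add, AddMonoidHom.add_apply, ht, ht']
  induction p using S.entry_induction with
  | h0 => simp
  | h1 c h t => rw [ext₂_incl, ext₂_incl, key]
  | h2 p q hp hq => simp [hp, hq]

end PreRep

/-- `p ↦ b ⊗ p` from `A_{jq}` to `A_{iq}`. -/
def pcons (q : ι) {i j : ι} (h : i < j) (b : S.B i j) : S.entry j q →+ S.entry i q :=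
  DirectSum.toAddMonoid (fun c : {c : List ι // Incr q c j} =>
    (S.incl (j :: c.1) (Incr.cons h c.2)).toAddMonoidHom.comp (S.chainMk₂ b))

theorem pcons_incl {q i j : ι} (h : i < j) (b : S.B i j) (c : List ι) (h' : Incr q c j)
    (t : S.chainTensor q c j) :
    S.pcons q h b (S.incl c h' t) = S.incl (j :: c) (Incr.cons h h') (S.chainMk b t) :=
  DirectSum.toAddMonoid_of (fun c : {c : List ι // Incr q c j} =>
    (S.incl (j :: c.1) (Incr.cons h c.2)).toAddMonoidHom.comp (S.chainMk₂ b)) ⟨c, h'⟩ t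

/-- The map `B_{ij} ⊗ A_{jq} → A_{iq}` that is the inclusion on each direct summand. -/
def cons (q i j : ι) (h : i < j) : (S.B i j).Tens (S.entry j q) →ₗ[S.A i] S.entry i q :=
  BiMod.lift
    { toFun := fun b => S.pcons q h b
      map_add' := fun b b' => by
        ext p
        rw [AddMonoidHom.add_apply]
        induction p using S.entry_induction with
        | h0 => simp
        | h1 c h' t => simp only [pcons_incl, ← chainMk₂_apply, map_add, AddMonoidHom.add_apply]
        | h2 p q hp hq => simp only [map_add, hp, hq]; abel
      map_smul' := fun r b => by
        ext p
        rw [RingHom.id_apply, AddMonoidHom.smul_apply]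
        induction p using S.entry_induction with
        | h0 => simp
        | h1 c h' t => simp only [pcons_incl, ← chainMk₂_apply, map_smul, AddMonoidHom.smul_apply]
        | h2 p q hp hq => simp only [map_add, hp, hq, smul_add] }
    (fun b s p => by
      change S.pcons q h (op s • b) p = S.pcons q h b (s • p)
      induction p using S.entry_induction with
      | h0 => simp
      | h1 c h' t =>
        rw [← map_smul, pcons_incl, pcons_incl]
        exact congrArg _ (BiMod.tmul_bal (M := S.B i j) (N := S.chainTensor q c j) b s t)
      | h2 p q hp hq => simp only [map_add, hp, hq, smul_add])

theorem cons_incl {q i j : ι} (h : i < j) (b : S.B i j) (c : List ι) (h' : Incr q c j)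
    (t : S.chainTensor q c j) :
    S.cons q i j h (BiMod.tmul b (S.incl c h' t)) = S.incl (j :: c) (Incr.cons h h') (S.chainMk b t) :=
  S.pcons_incl h b c h' t

/-- The family `A_{iq}`, for fixed `q`, with the structure maps `B_{ij} ⊗ A_{jq} → A_{iq}`. -/
def col (q : ι) : S.PreRep where
  X i := ModuleCat.of (S.A i) (S.entry i q)
  β i j h := S.cons q i j h

/-- The map `μ_{ijq} : A_{ij} ⊗ A_{jq} → A_{iq}`, the natural inclusion: it concatenates the
elements `b₁ ⊗ ⋯ ⊗ b_l` and `b'₁ ⊗ ⋯ ⊗ b'_m` to `b₁ ⊗ ⋯ ⊗ b_l ⊗ b'₁ ⊗ ⋯ ⊗ b'_m`. -/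
def mu (i j q : ι) : S.entry i j →ₗ[S.A i] (S.entry j q →+ S.entry i q) := (S.col q).ext₂ i j


theorem mu_bal {i j q : ι} (p : S.entry i j) (s : S.A j) (p' : S.entry j q) :
    S.mu i j q (op s • p) p' = S.mu i j q p (s • p') :=
  (S.col q).ext₂_bal p s p'

/-- Iterating the structure maps is compatible with concatenation. -/
theorem ext₂_mu (Y : S.PreRep) (i j q : ι) (p : S.entry i j) (p' : S.entry j q) (y : Y.X q) :
    Y.ext₂ i q (S.mu i j q p p') y = Y.ext₂ i j p (Y.ext₂ j q p' y) := by
  refine PreRep.ext₂_map (Y := S.col q) (Y' := Y)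
    (fun i => (AddMonoidHom.eval y).comp (Y.ext₂ i q).toAddMonoidHom) ?_ i j p p'
  intro i j h b x
  change Y.ext₂ i q (S.cons q i j h (BiMod.tmul b x)) y = Y.β i j h (BiMod.tmul b (Y.ext₂ j q x y))
  change S.entry j q at x
  induction x using S.entry_induction with
  | h0 =>
    have e1 := (BiMod.curry (S.cons q i j h) b).map_zero
    have e2 := (BiMod.curry (Y.β i j h) b).map_zero
    simp only [BiMod.curry_apply] at e1 e2
    simp [e1, e2]
  | h1 c h' t => rw [cons_incl, PreRep.ext₂_incl, PreRep.ext₂_incl, PreRep.act_cons]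
  | h2 p q hp hq =>
    simp only [BiMod.tmul_add, map_add, AddMonoidHom.add_apply, hp, hq]

theorem mu_assoc {i j q r : ι} (x : S.entry i j) (y : S.entry j q) (z : S.entry q r) :
    S.mu i q r (S.mu i j q x y) z = S.mu i j r x (S.mu j q r y z) :=
  S.ext₂_mu (S.col r) i j q x y z

theorem mu_right {i j q : ι} (x : S.entry i j) (y : S.entry j q) (a : S.A q) :
    S.mu i j q x (op a • y) = op a • S.mu i j q x y := by
  refine (PreRep.ext₂_map (Y := S.col q) (Y' := S.col q)
    (fun i => DistribSMul.toAddMonoidHom (S.entry i q) (op a)) ?_ i j x y).symm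
  intro i j h b x
  change S.entry j q at x
  change op a • S.cons q i j h (BiMod.tmul b x) = S.cons q i j h (BiMod.tmul b (op a • x))
  induction x using S.entry_induction with
  | h0 =>
    have e1 := (BiMod.curry (S.cons q i j h) b).map_zero
    simp only [BiMod.curry_apply] at e1
    simp [e1]
  | h1 c h' t => rw [cons_incl, ← incl_right, ← incl_right, cons_incl, op_smul_chainMk]
  | h2 p q hp hq =>
    simp only [BiMod.tmul_add, map_add, smul_add, hp, hq]

theorem entry_central {i j : ι} (r : k) (p : S.entry i j) :
    algebraMap k (S.A i) r • p = op (algebraMap k (S.A j) r) • p := by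
  have key : ∀ (c : List ι) (i : ι) (t : S.chainTensor j c i),
      algebraMap k (S.A i) r • t = op (algebraMap k (S.A j) r) • t := by
    intro c
    induction c with
    | nil => intro i b; exact S.central i j r b
    | cons a c ih =>
      intro i t
      induction t using S.chain_induction with
      | h0 => simp
      | h1 b t =>
        rw [op_smul_chainMk, ← ih, ← chainMk₂_apply, ← AddMonoidHom.smul_apply, ← map_smul,
          S.central i a r b]
        exact BiMod.tmul_bal (M := S.B i a) (N := S.chainTensor j c a) b _ t
      | h2 t t' ht ht' => simp only [smul_add, ht, ht']
  induction p using S.entry_induction with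
  | h0 => simp
  | h1 c h t => rw [← incl_right, ← map_smul, key]
  | h2 p q hp hq => simp only [smul_add, hp, hq]

theorem entry_eq_zero {i j : ι} (h : ¬ i < j) (p : S.entry i j) : p = 0 := by
  induction p using S.entry_induction with
  | h0 => rfl
  | h1 c h' t => exact absurd h'.lt h
  | h2 p q hp hq => rw [hp, hq, add_zero]

/-- The triangular matrix algebra `Λ`: matrices with diagonal entries in `A i` and with
`(i, j)`-entry in `A_{ij}` (which is zero unless `i < j`) off the diagonal. -/
@[ext]
structure Alg where
  diag : ∀ i, S.A i
  off : ∀ i j, S.entry i j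

namespace Alg

variable {S}

instance : Zero S.Alg := ⟨⟨0, 0⟩⟩
instance : One S.Alg := ⟨⟨1, 0⟩⟩
instance : Add S.Alg := ⟨fun x y => ⟨x.diag + y.diag, x.off + y.off⟩⟩
instance : Neg S.Alg := ⟨fun x => ⟨-x.diag, -x.off⟩⟩

@[simp] theorem zero_diag (i : ι) : (0 : S.Alg).diag i = 0 := rfl
@[simp] theorem zero_off (i j : ι) : (0 : S.Alg).off i j = 0 := rfl
@[simp] theorem one_diag (i : ι) : (1 : S.Alg).diag i = 1 := rfl
@[simp] theorem one_off (i j : ι) : (1 : S.Alg).off i j = 0 := rfl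
@[simp] theorem add_diag (x y : S.Alg) (i : ι) : (x + y).diag i = x.diag i + y.diag i := rfl
@[simp] theorem add_off (x y : S.Alg) (i j : ι) : (x + y).off i j = x.off i j + y.off i j := rfl
@[simp] theorem neg_diag (x : S.Alg) (i : ι) : (-x).diag i = -x.diag i := rfl
@[simp] theorem neg_off (x : S.Alg) (i j : ι) : (-x).off i j = -x.off i j := rfl

theorem ext' {x y : S.Alg} (h : ∀ i, x.diag i = y.diag i) (h' : ∀ i j, x.off i j = y.off i j) :
    x = y :=
  Alg.ext (funext h) (funext fun i => funext (h' i))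

instance : SMul k S.Alg := ⟨fun r x =>
  ⟨fun i => r • x.diag i, fun i j => algebraMap k (S.A i) r • x.off i j⟩⟩

@[simp] theorem smul_diag (r : k) (x : S.Alg) (i : ι) : (r • x).diag i = r • x.diag i := rfl
@[simp] theorem smul_off (r : k) (x : S.Alg) (i j : ι) :
    (r • x).off i j = algebraMap k (S.A i) r • x.off i j := rfl

variable [Fintype ι]

/-- Matrix multiplication; the summand for `l` vanishes unless `i < l < j`. -/
instance : Mul S.Alg := ⟨fun x y =>
  ⟨fun i => x.diag i * y.diag i,
    fun i j => x.diag i • y.off i j + op (y.diag j) • x.off i j +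
      ∑ l, S.mu i l j (x.off i l) (y.off l j)⟩⟩

@[simp] theorem mul_diag (x y : S.Alg) (i : ι) : (x * y).diag i = x.diag i * y.diag i := rfl
@[simp] theorem mul_off (x y : S.Alg) (i j : ι) : (x * y).off i j =
    x.diag i • y.off i j + op (y.diag j) • x.off i j +
      ∑ l, S.mu i l j (x.off i l) (y.off l j) := rfl

instance : Ring S.Alg where
  add_assoc x y z := ext' (by simp [add_assoc]) (by simp [add_assoc])
  zero_add x := ext' (by simp) (by simp)
  add_zero x := ext' (by simp) (by simp)
  add_comm x y := ext' (by simp [add_comm]) (by simp [add_comm])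
  neg_add_cancel x := ext' (by simp) (by simp)
  nsmul := nsmulRec
  zsmul := zsmulRec
  left_distrib x y z := ext' (by simp [mul_add]) (fun i j => by
    simp only [mul_off, add_off, add_diag, smul_add, MulOpposite.op_add, add_smul, map_add,
      Finset.sum_add_distrib]
    abel)
  right_distrib x y z := ext' (by simp [add_mul]) (fun i j => by
    simp only [mul_off, add_off, add_diag, smul_add, add_smul, map_add,
      AddMonoidHom.add_apply, Finset.sum_add_distrib]
    abel)
  zero_mul x := ext' (by simp) (by simp)
  mul_zero x := ext' (by simp) (by simp)
  one_mul x := ext' (by simp) (by simp)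
  mul_one x := ext' (by simp) (by simp)
  mul_assoc x y z := ext' (by simp [mul_assoc]) (fun i j => by
    simp only [mul_off, mul_diag, smul_add, op_mul, mul_smul, map_add, AddMonoidHom.add_apply,
      Finset.smul_sum, map_sum, AddMonoidHom.finsetSum_apply, Finset.sum_add_distrib, map_smul,
      AddMonoidHom.smul_apply, mu_right, mu_bal, mu_assoc]
    rw [smul_comm (x.diag i) (op (z.diag j)) (y.off i j), Finset.sum_comm]
    abel)

instance : Algebra k S.Alg where
  algebraMap :=
    { toFun := fun r => ⟨fun i => algebraMap k (S.A i) r, 0⟩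
      map_zero' := ext' (by simp) (by simp)
      map_one' := ext' (by simp) (by simp)
      map_add' := fun r s => ext' (by simp) (by simp)
      map_mul' := fun r s => ext' (by simp) (by simp) }
  commutes' r x := ext' (fun i => Algebra.commutes r (x.diag i)) (fun i j => by
    simp [S.entry_central r (x.off i j)])
  smul_def' r x := ext' (fun i => Algebra.smul_def r (x.diag i)) (fun i j => by
    simp)

end Alg

/-! ### Representations -/

/-- A representation `X` of `Λ`: modules `X i` and maps `φ_{ij} : A_{ij} ⊗ X_j → X_i` of left
`A i`-modules with `φ_{iq} ∘ (μ_{ijq} ⊗ id) = φ_{ij} ∘ (id ⊗ φ_{jq})`. -/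
structure Rep where
  X : ∀ i, ModuleCat.{u} (S.A i)
  φ : ∀ i j, (S.entry i j).Tens (X j) →ₗ[S.A i] X i
  comp : ∀ i j q (p : S.entry i j) (p' : S.entry j q) (x : X q),
    φ i q (BiMod.tmul (S.mu i j q p p') x) = φ i j (BiMod.tmul p (φ j q (BiMod.tmul p' x)))

namespace Rep

variable {S}

/-- Morphisms of representations: `f_i φ_{ij} = φ_{ij} (id ⊗ f_j)`. -/
@[ext]
structure Hom (X Y : S.Rep) where
  f : ∀ i, X.X i →ₗ[S.A i] Y.X i
  comm : ∀ i j (t : (S.entry i j).Tens (X.X j)), f i (X.φ i j t) = Y.φ i j ((S.entry i j).tmap (f j) t)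

theorem tmap_id {R R' : Type u} [Ring R] [Ring R'] (M : BiMod R R') {N : Type u}
    [AddCommGroup N] [Module R' N] (t : M.Tens N) : M.tmap LinearMap.id t = t := by
  induction t using BiMod.tens_induction with
  | h0 => simp
  | h1 m n => simp
  | h2 x y hx hy => rw [map_add, hx, hy]

theorem tmap_comp {R R' : Type u} [Ring R] [Ring R'] (M : BiMod R R') {N N' N'' : Type u}
    [AddCommGroup N] [Module R' N] [AddCommGroup N'] [Module R' N'] [AddCommGroup N'']
    [Module R' N''] (g : N' →ₗ[R'] N'') (f : N →ₗ[R'] N') (t : M.Tens N) :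
    M.tmap (g ∘ₗ f) t = M.tmap g (M.tmap f t) := by
  induction t using BiMod.tens_induction with
  | h0 => simp
  | h1 m n => simp
  | h2 x y hx hy => simp only [map_add, hx, hy]

instance : Category S.Rep where
  Hom X Y := Hom X Y
  id X := ⟨fun i => LinearMap.id, fun i j t => by rw [tmap_id]; rfl⟩
  comp F G := ⟨fun i => G.f i ∘ₗ F.f i, fun i j t => by
    rw [tmap_comp, LinearMap.comp_apply, F.comm, G.comm]⟩

@[simp] theorem id_f (X : S.Rep) (i : ι) : Hom.f (𝟙 X) i = LinearMap.id := rfl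
@[simp] theorem comp_f {X Y Z : S.Rep} (F : X ⟶ Y) (G : Y ⟶ Z) (i : ι) :
    Hom.f (F ≫ G) i = Hom.f G i ∘ₗ Hom.f F i := rfl

theorem hom_ext {X Y : S.Rep} {F G : X ⟶ Y} (h : ∀ i, Hom.f F i = Hom.f G i) : F = G :=
  Hom.ext (funext h)

/-- The direct sum of the modules `X i`, the `Λ`-module that belongs to `X`. -/
def Total (X : S.Rep) : Type u := ∀ i, X.X i

instance (X : S.Rep) : AddCommGroup X.Total := inferInstanceAs (AddCommGroup (∀ i, X.X i))

theorem total_add_apply (X : S.Rep) (x y : X.Total) (i : ι) : (x + y) i = x i + y i := rfl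

theorem total_zero_apply (X : S.Rep) (i : ι) : (0 : X.Total) i = 0 := rfl

variable [Fintype ι]

/-- The action of matrices on column vectors. -/
instance (X : S.Rep) : SMul S.Alg X.Total := ⟨fun a x i =>
  a.diag i • x i + ∑ j, X.φ i j (BiMod.tmul (a.off i j) (x j))⟩

theorem smul_apply (X : S.Rep) (a : S.Alg) (x : X.Total) (i : ι) :
    (a • x) i = a.diag i • x i + ∑ j, X.φ i j (BiMod.tmul (a.off i j) (x j)) := rfl

instance (X : S.Rep) : Module S.Alg X.Total where
  one_smul x := funext fun i => by
    simp only [smul_apply, ← BiMod.curry_apply]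
    simp
  mul_smul a b x := funext fun i => by
    simp only [smul_apply, ← BiMod.curry_apply, Alg.mul_diag, Alg.mul_off, map_add, map_sum,
      map_smul, mul_smul, smul_add, AddMonoidHom.add_apply, AddMonoidHom.smul_apply,
      AddMonoidHom.finsetSum_apply, Finset.sum_add_distrib, Finset.smul_sum]
    simp only [BiMod.curry_apply, X.comp, BiMod.tmul_bal]
    rw [Finset.sum_comm]
    abel
  smul_zero a := funext fun i => by
    simp only [smul_apply, total_zero_apply, BiMod.tmul_zero]
    simp
  zero_smul x := funext fun i => by
    simp only [smul_apply, ← BiMod.curry_apply, total_zero_apply]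
    simp
  smul_add a x y := funext fun i => by
    simp only [smul_apply, ← BiMod.curry_apply, total_add_apply, map_add, smul_add,
      Finset.sum_add_distrib]
    abel
  add_smul a b x := funext fun i => by
    simp only [smul_apply, ← BiMod.curry_apply, total_add_apply, Alg.add_diag, Alg.add_off,
      map_add, add_smul, AddMonoidHom.add_apply, Finset.sum_add_distrib]
    abel

end Rep

/-- The identification of representations of `Λ` with left `Λ`-modules, `X ↦ ⨁ X_i`. -/
def toModule [Fintype ι] : S.Rep ⥤ ModuleCat.{u} S.Alg where
  obj X := ModuleCat.of S.Alg X.Total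
  map {X Y} F := ModuleCat.ofHom
    { toFun := fun (x : X.Total) => (fun i => Rep.Hom.f F i (x i) : Y.Total)
      map_add' := fun x y => funext fun i => map_add (Rep.Hom.f F i) (x i) (y i)
      map_smul' := fun a x => funext fun i => by
        simp only [Rep.smul_apply, RingHom.id_apply, map_add, map_sum, map_smul, Rep.Hom.comm,
          BiMod.tmap_tmul]
        rfl }
  map_id X := rfl
  map_comp F G := rfl

/-- The restriction `B_{ij} ⊗ X_j → X_i` of the structure map `φ_{ij}` of a representation. -/
def Rep.φB {S : Species k ι} (X : S.Rep) {i j : ι} (h : i < j) :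
    (S.B i j).Tens (X.X j) →ₗ[S.A i] X.X i :=
  BiMod.lift ((BiMod.curry (X.φ i j)).comp (S.inclB h)) (fun b s x => by
    simp only [LinearMap.comp_apply, BiMod.curry_apply, inclB_right, BiMod.tmul_bal])

theorem Rep.φB_tmul {S : Species k ι} (X : S.Rep) {i j : ι} (h : i < j) (b : S.B i j)
    (x : X.X j) : X.φB h (BiMod.tmul b x) = X.φ i j (BiMod.tmul (S.inclB h b) x) := rfl

theorem Rep.φB_map {S : Species k ι} {X Y : S.Rep} (F : X ⟶ Y) {i j : ι} (h : i < j)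
    (t : (S.B i j).Tens (X.X j)) :
    Rep.Hom.f F i (X.φB h t) = Y.φB h ((S.B i j).tmap (Rep.Hom.f F j) t) := by
  induction t using BiMod.tens_induction with
  | h0 => simp
  | h1 b x => exact Rep.Hom.comm F i j (BiMod.tmul (S.inclB h b) x)
  | h2 x y hx hy => simp only [map_add, hx, hy]

/-- The representation whose structure maps extend given maps `B_{ij} ⊗ Y_j → Y_i`. -/
def PreRep.toRep {S : Species k ι} (Y : S.PreRep) : S.Rep where
  X := Y.X
  φ := Y.ext
  comp i j q p p' x := S.ext₂_mu Y i j q p p' x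

/-- Morphisms into such representations. -/
def PreRep.toRepHom {S : Species k ι} {Y Y' : S.PreRep} (f : ∀ i, Y.X i →ₗ[S.A i] Y'.X i)
    (hf : ∀ i j h b x, f i (Y.β i j h (BiMod.tmul b x)) = Y'.β i j h (BiMod.tmul b (f j x))) :
    Y.toRep ⟶ Y'.toRep :=
  Rep.Hom.mk (X := Y.toRep) (Y := Y'.toRep) f (fun i j t => by
    change f i (Y.ext i j t) = Y'.ext i j ((S.entry i j).tmap (f j) t)
    change (S.entry i j).Tens (Y.X j) at t
    induction t using BiMod.tens_induction with
    | h0 => simp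
    | h1 p x => exact PreRep.ext₂_map (fun i => (f i).toAddMonoidHom) hf i j p x
    | h2 x y hx hy => simp only [map_add, hx, hy])

/-! ### The reflection `S_1` -/

/-- The underlying bijection `2, …, n, 1 ↦ 2, …, n, 1` of the orders `2 < ⋯ < n < 1` (written
as `WithTop ι`) and `1 < 2 < ⋯ < n` (written as `WithBot ι`), for `ι = {2 < ⋯ < n}`. -/
def toBot {ι : Type} : WithTop ι → WithBot ι
  | ⊤ => ⊥
  | (i : ι) => (i : WithBot ι)

section Reflect

variable {ι : Type} [LinearOrder ι] (S : Species k (WithBot ι))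

/-- The bimodules of `S_1(Λ)`: `B_{ij}` for `2 ≤ i, j ≤ n` and `B_{i1} = Hom_{A_1}(B_{1i}, A_1)`. -/
def reflectB : ∀ i j : WithTop ι, BiMod (S.A (toBot i)) (S.A (toBot j))
  | (i : ι), (j : ι) => S.B i j
  | (i : ι), ⊤ => (S.B ⊥ i).leftDual
  | ⊤, _ => BiMod.zero _ _

/-- The data of `S_1(Λ)`. The first vertex `⊥` of `Λ` becomes the last vertex `⊤`. -/
def reflect : Species k (WithTop ι) where
  A i := S.A (toBot i)
  B := S.reflectB
  central
    | (i : ι), (j : ι), r, b => S.central i j r b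
    | (i : ι), ⊤, r, (f : S.B ⊥ i →ₗ[S.A ⊥] S.A ⊥) => LinearMap.ext fun m =>
      show f (op (algebraMap k (S.A i) r) • m) = f m * algebraMap k (S.A ⊥) r by
        rw [← S.central, map_smul, smul_eq_mul, Algebra.commutes]
    | ⊤, _, r, b => rfl

end Reflect

/-- A finite dimensional algebra is Frobenius if it is nonzero and has a linear form `t` for
which the bilinear form `(a, b) ↦ t (a b)` is nondegenerate. -/
def _root_.IsFrobeniusAlgebra (k A : Type u) [Field k] [Ring A] [Algebra k A] : Prop :=
  Nontrivial A ∧ Module.Finite k A ∧ ∃ t : A →ₗ[k] k,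
    (∀ a, (∀ b, t (a * b) = 0) → a = 0) ∧ (∀ b, (∀ a, t (a * b) = 0) → b = 0)

/-- The data define a Frobenius-type triangular matrix algebra. The isomorphism
`Hom_{A_i}(B_{ij}, A_i) ≅ Hom_{A_j}(B_{ij}, A_j)` is part of the structure. -/
structure FrobeniusType (S : Species k ι) where
  frobenius : ∀ i, IsFrobeniusAlgebra k (S.A i)
  free_left : ∀ i j, i < j → Module.Free (S.A i) (S.B i j)
  finite_left : ∀ i j, i < j → Module.Finite (S.A i) (S.B i j)
  free_right : ∀ i j, i < j → Module.Free (S.A j)ᵐᵒᵖ (S.B i j)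
  finite_right : ∀ i j, i < j → Module.Finite (S.A j)ᵐᵒᵖ (S.B i j)
  dualIso : ∀ i j, i < j → BiMod.Iso (S.B i j).leftDual (S.B i j).rightDual

/-- `Λ` is connected: the vertices cannot be divided into two nonempty sets with no nonzero
`B_{ij}` between them. -/
def IsConnected (S : Species k ι) : Prop :=
  ∀ V : Set ι, V.Nonempty → Vᶜ.Nonempty →
    ∃ i j, i < j ∧ (i ∈ V ∧ j ∉ V ∨ i ∉ V ∧ j ∈ V) ∧ Nontrivial (S.B i j)

/-! ### The reflection functor -/

section ReflectionFunctor

variable {ι : Type} [LinearOrder ι] [Fintype ι] {S : Species k (WithBot ι)}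

/-- The map `X_{1,in} : ⨁_{j ≥ 2} B_{1j} ⊗ X_j → X_1`. -/
def Rep.inMap (X : S.Rep) :
    (∀ j : ι, (S.B ⊥ j).Tens (X.X j)) →ₗ[S.A ⊥] X.X ⊥ :=
  ∑ j : ι, (X.φB (WithBot.bot_lt_coe j)).comp (LinearMap.proj j)

theorem Rep.inMap_apply (X : S.Rep) (t : ∀ j : ι, (S.B ⊥ j).Tens (X.X j)) :
    X.inMap t = ∑ j : ι, X.φB (WithBot.bot_lt_coe j) (t j) := by
  simp only [Rep.inMap, LinearMap.sum_apply, LinearMap.comp_apply, LinearMap.proj_apply]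

/-- The map on the kernels of `X_{1,in}` that is induced by a morphism. -/
def Rep.kerMap {X Y : S.Rep} (F : X ⟶ Y) :
    LinearMap.ker X.inMap →ₗ[S.A ⊥] LinearMap.ker Y.inMap :=
  LinearMap.restrict
    (LinearMap.pi fun j : ι => ((S.B ⊥ j).tmap (Rep.Hom.f F j)).comp (LinearMap.proj j))
    (by
      intro t ht
      rw [LinearMap.mem_ker, Rep.inMap_apply] at ht ⊢
      have key := congrArg (Rep.Hom.f F ⊥) ht
      rw [map_zero] at key
      refine Eq.trans ?_ ((map_sum (Rep.Hom.f F ⊥) _ _).symm.trans key)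
      exact Finset.sum_congr rfl fun j _ => (Rep.φB_map F (WithBot.bot_lt_coe j) (t j)).symm)

/-- The modules of `F_1^+(X)`: `X_2, …, X_n` and `ker X_{1,in}`. -/
def reflectX (X : S.Rep) : ∀ i : WithTop ι, ModuleCat.{u} (S.reflect.A i)
  | (i : ι) => X.X i
  | ⊤ => ModuleCat.of (S.A ⊥) (LinearMap.ker X.inMap)

/-- The structure maps of `F_1^+(X)`: those of `X` for `2 ≤ i < j ≤ n`, and the map
`B_{i1} ⊗ ker X_{1,in} → X_i` that belongs to the projection
`ker X_{1,in} → B_{1i} ⊗ X_i`; it sends `f ⊗ (∑ b ⊗ x)` to `∑ f(b) x`, where `f` in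
`Hom_{A_1}(B_{1i}, A_1)` is read as an element of `Hom_{A_i}(B_{1i}, A_i)`. -/
def FrobeniusType.reflectβ (hS : S.FrobeniusType) (X : S.Rep) : ∀ i j : WithTop ι, i < j →
    ((S.reflect.B i j).Tens (reflectX X j) →ₗ[S.reflect.A i] reflectX X i)
  | (i : ι), (j : ι), h =>
    X.φB (WithBot.coe_lt_coe.2 (WithTop.coe_lt_coe.1 h))
  | (i : ι), ⊤, _ =>
    BiMod.lift (M := (S.B ⊥ i).leftDual) (N := LinearMap.ker X.inMap) (Z := X.X i)
      { toFun := fun f =>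
          ((S.B ⊥ i).eval (X.X i)
            ((hS.dualIso ⊥ i (WithBot.bot_lt_coe i)).toEquiv f)).comp
          ((LinearMap.proj i).comp (LinearMap.ker X.inMap).subtype).toAddMonoidHom
        map_add' := fun f g => by ext m; simp
        map_smul' := fun s f => by ext m; simp }
      (fun f r m => by
        simp [BiMod.Iso.map_right, BiMod.eval_right])
  | ⊤, _, h => absurd h not_top_lt

/-- `F_1^+(X)`. -/
def FrobeniusType.reflectObj (hS : S.FrobeniusType) (X : S.Rep) : S.reflect.Rep :=
  PreRep.toRep ⟨reflectX X, hS.reflectβ X⟩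

/-- The components of `F_1^+(f)`. -/
def reflectMap {X Y : S.Rep} (F : X ⟶ Y) :
    ∀ i : WithTop ι, reflectX X i →ₗ[S.reflect.A i] reflectX Y i
  | (i : ι) => Rep.Hom.f F i
  | ⊤ => Rep.kerMap F

/-- The reflection functor `F_1^+`. -/
def FrobeniusType.reflectionFunctor (hS : S.FrobeniusType) : S.Rep ⥤ S.reflect.Rep where
  obj := hS.reflectObj
  map {X Y} F := PreRep.toRepHom (Y := ⟨reflectX X, hS.reflectβ X⟩)
    (Y' := ⟨reflectX Y, hS.reflectβ Y⟩) (reflectMap F) (by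
      intro i j h b x
      match i, j, h, b, x with
      | (i : ι), (j : ι), h, b, x =>
        exact Rep.φB_map F (WithBot.coe_lt_coe.2 (WithTop.coe_lt_coe.1 h)) (BiMod.tmul b x)
      | (i : ι), ⊤, h, b, x => exact (BiMod.eval_tmap _ (Rep.Hom.f F i) _ _).symm
      | ⊤, _, h, _, _ => exact absurd h not_top_lt)
  map_id X := Rep.hom_ext fun i => by
    match i with
    | (i : ι) => rfl
    | ⊤ => exact LinearMap.ext fun m => Subtype.ext (funext fun j => Rep.tmap_id _ (m.1 j))
  map_comp {X Y Z} F G := Rep.hom_ext fun i => by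
    match i with
    | (i : ι) => rfl
    | ⊤ => exact LinearMap.ext fun m => Subtype.ext (funext fun j =>
        Rep.tmap_comp _ (Rep.Hom.f G j) (Rep.Hom.f F j) (m.1 j))

end ReflectionFunctor

end Species

/-! ### The inverse Auslander-Reiten translation -/

section Tau

variable (k R : Type u) [Field k] [Ring R] [Algebra k R]

/-- The right `R`-module `D M = Hom_k(M, k)`, with `(f r)(m) = f (r m)`. -/
def KDual (M : Type u) [AddCommGroup M] [Module k M] : Type u := M →ₗ[k] k

variable (M : Type u) [AddCommGroup M] [Module k M] [Module R M] [IsScalarTower k R M]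

instance : AddCommGroup (KDual k M) := inferInstanceAs (AddCommGroup (M →ₗ[k] k))

instance : Module Rᵐᵒᵖ (KDual k M) where
  smul r f := (f : M →ₗ[k] k) ∘ₗ Algebra.lsmul k k M r.unop
  one_smul f := by
    let g : M →ₗ[k] k := f
    exact LinearMap.ext fun m => congrArg g (one_smul R m)
  mul_smul r s f := by
    let g : M →ₗ[k] k := f
    exact LinearMap.ext fun m => congrArg g (mul_smul s.unop r.unop m)
  smul_zero r := rfl
  smul_add r f g := rfl
  add_smul r s f := by
    let g : M →ₗ[k] k := f
    refine LinearMap.ext fun m => ?_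
    change g ((r.unop + s.unop) • m) = g (r.unop • m) + g (s.unop • m)
    rw [add_smul, map_add]
  zero_smul f := by
    let g : M →ₗ[k] k := f
    refine LinearMap.ext fun m => ?_
    change g ((0 : R) • m) = 0
    rw [zero_smul, map_zero]

/-- A submodule `K` is superfluous if `U + K` is proper for every proper submodule `U`. -/
def Submodule.Superfluous {R' Q : Type u} [Ring R'] [AddCommGroup Q] [Module R' Q]
    (K : Submodule R' Q) : Prop :=
  ∀ U : Submodule R' Q, U ⊔ K = ⊤ → U = ⊤

/-- The map `Hom(Q₀, R) → Hom(Q₁, R)` of left `R`-modules, `f ↦ f ∘ d`, for a map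
`d : Q₁ → Q₀` of right `R`-modules. -/
def homDual {Q₁ Q₀ : ModuleCat.{u} Rᵐᵒᵖ} (d : Q₁ →ₗ[Rᵐᵒᵖ] Q₀) :
    (Q₀ →ₗ[Rᵐᵒᵖ] R) →ₗ[R] (Q₁ →ₗ[Rᵐᵒᵖ] R) where
  toFun f := f ∘ₗ d
  map_add' _ _ := rfl
  map_smul' _ _ := rfl

/-- `N` is (isomorphic to) `τ⁻(M) = Tr D M`: for a minimal projective presentation
`Q₁ → Q₀ → D M → 0` of the right module `D M`, `N` is the cokernel of
`Hom(Q₀, R) → Hom(Q₁, R)`. -/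
def IsTauInv (N : ModuleCat.{u} R) : Prop :=
  ∃ (Q₁ Q₀ : ModuleCat.{u} Rᵐᵒᵖ) (d : Q₁ →ₗ[Rᵐᵒᵖ] Q₀) (p : Q₀ →ₗ[Rᵐᵒᵖ] KDual k M),
    Module.Projective Rᵐᵒᵖ Q₁ ∧ Module.Projective Rᵐᵒᵖ Q₀ ∧
    Function.Surjective p ∧ LinearMap.range d = LinearMap.ker p ∧
    (LinearMap.ker p).Superfluous ∧ (LinearMap.ker d).Superfluous ∧
    Nonempty (N ≃ₗ[R] ((Q₁ →ₗ[Rᵐᵒᵖ] R) ⧸ LinearMap.range (homDual R d)))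

end Tau

namespace Species

variable {k : Type u} [Field k] {ι : Type} [LinearOrder ι] [Fintype ι] (S : Species k ι)

/-- The idempotent `e_i` of `Λ`, the unit of `A i`. -/
def e (i : ι) : S.Alg := ⟨Pi.single i 1, 0⟩

/-- The projective `Λ`-module `P_i = Λ e_i`. -/
def proj (i : ι) : Submodule S.Alg S.Alg := Ideal.span {S.e i}

/-- The generalized APR-tilting module `T_1 = Λ/P_1 ⊕ τ⁻(P_1)`, where `N` is `τ⁻(P_1)`. -/
def aprTilting {ι : Type} [LinearOrder ι] [Fintype ι] (S : Species k (WithBot ι))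
    (N : ModuleCat.{u} S.Alg) : ModuleCat.{u} S.Alg :=
  ModuleCat.of S.Alg ((S.Alg ⧸ S.proj ⊥) × N)

end Species

end

/-!
The vertex `1` of `Λ` is `⊥`, the other vertices form `ι`, and `e_i` is the unit of `A_i`.

The reflection functor has a left adjoint `F_1^-`, which keeps the modules `Y_2, …, Y_n` and puts at
the vertex `1` the cokernel of the map `Y_1 → ⨁_j B_{1j} ⊗ Y_j` that corresponds to the structure
maps `Hom_{A_1}(B_{1j}, A_1) ⊗ Y_1 → Y_j`; the dual bases of the free right modules `B_{1j}` give
this correspondence. Hence `F_1^+`, as a functor to abelian groups, is represented by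
`Z = F_1^-(S_1(Λ))`, with the image `u` of the unit matrix as its universal element
(`FrobeniusType.exists_map_reprElt`, `FrobeniusType.hom_reprObj_ext`). The unit
`S_1(Λ) → F_1^+(Z)`, `s ↦ s u`, is bijective (`FrobeniusType.smul_reprElt_bijective`): the only
thing to check is that `A_1 → ⨁_j B_{1j} ⊗ Hom_{A_1}(B_{1j}, A_1)` is injective, and this holds
because `Λ` is connected, so that some `B_{1j}` is a nonzero free `A_1`-module.

The tilting module `T_1` represents the same functor (`FrobeniusType.tiltEquiv`). Homomorphisms
`Λ/P_1 → X` are families of elements of `X_2, …, X_n`. As `A_1` is Frobenius, the right module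
`D P_1` is isomorphic to `A_1`, so that `e_1 Λ` is its projective cover, with kernel
`rad = ⨁_j A_{1j}`. Splitting off the first factor of a tensor shows that `rad` is
`⨁_j B_{1j} ⊗ e_j Λ`, which is projective because `B_{1j}` is free over `A_j`. Hence
`rad → e_1 Λ` is a minimal projective presentation, and `τ⁻(P_1)` is the cokernel of
`Hom(e_1 Λ, Λ) → Hom(rad, Λ)` (`FrobeniusType.isTauInv`); minimal presentations are unique, so
every choice of `τ⁻(P_1)` is isomorphic to this one (`IsTauInv.nonempty_equiv`). A homomorphism from
this cokernel to `X` is an element of `⨁_j B_{1j} ⊗ X_j` that is mapped to zero in `X_1`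
(`FrobeniusType.range_homDual_le_ker_iff`).

By the Yoneda lemma `T_1` is isomorphic to `Z`, and an element `s` of `S_1(Λ)` corresponds to the
endomorphism of `T_1` that belongs to `s u`. This is the isomorphism `S_1(Λ) ≅ End(T_1)`, and
`F_1^+ ≅ Hom(T_1, -)` is linear over it by construction (`exists_algEquiv_end_of_representable`).
-/

noncomputable section

/-! ### Representable functors and endomorphism rings -/

/-- An additive bijection that commutes with scalars is an isomorphism of modules. -/
def ModuleCat.isoOfAddEquiv {R : Type u} [Ring R] {P Q : ModuleCat.{u} R} (e : P ≃+ Q)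
    (he : ∀ (r : R) (x : P), e (r • x) = r • e x) : P ≅ Q :=
  LinearEquiv.toModuleIso { e with map_smul' := he }

open scoped ModuleCat in
/-- Let `V : C ⥤ Mod R` be full and essentially surjective and let `T` be an `R`-module such that
`Hom(T, V -)` is naturally the underlying group of a functor `Φ` to `R'`-modules. If `Φ` is also represented by an
object `Z` of `C` with a universal element `u` that is a basis of the `R'`-module `Φ(Z)`, then `R'`
is the opposite endomorphism ring of `T`, and `Φ` is `Hom(T, V -)` as a functor to `R'`-modules. -/
theorem exists_algEquiv_end_of_representable {k R R' : Type u} [Field k] [Ring R] [Algebra k R]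
    [Ring R'] [Algebra k R'] {C : Type*} [Category C] (V : C ⥤ ModuleCat.{u} R) [V.Full]
    [V.EssSurj] (Φ : C ⥤ ModuleCat.{u} R') (T : ModuleCat.{u} R)
    (ψ : ∀ X, (T ⟶ V.obj X) ≃+ Φ.obj X)
    (nat : ∀ {X Y : C} (f : T ⟶ V.obj X) (g : X ⟶ Y), ψ Y (f ≫ V.map g) = Φ.map g (ψ X f))
    (hk : ∀ (X : C) (r : k) (f : T ⟶ V.obj X), ψ X (r • f) = algebraMap k R' r • ψ X f)
    (Z : C) (u : Φ.obj Z) (hu : Function.Bijective fun s : R' => s • u)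
    (univ : ∀ {X : C} (z : Φ.obj X), ∃ h : Z ⟶ X, Φ.map h u = z)
    (uniq : ∀ {X : C} (h h' : Z ⟶ X), Φ.map h u = Φ.map h' u → h = h') :
    ∃ σ : R' ≃ₐ[k] (End T)ᵐᵒᵖ,
      Nonempty (Φ ≅ V ⋙ preadditiveCoyonedaObj T ⋙
        ModuleCat.restrictScalars (σ : R' →+* (End T)ᵐᵒᵖ)) := by
  -- By Yoneda, `T` is isomorphic to `V Z`, by the isomorphism `α` that belongs to `u`.
  obtain ⟨α, hα⟩ : ∃ α : T ≅ V.obj Z, ψ Z α.hom = u := by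
    let W := V.objPreimage T
    let β : V.obj W ≅ T := V.objObjPreimageIso T
    obtain ⟨a, ha⟩ := univ (ψ W β.inv)
    obtain ⟨b, hb⟩ := V.map_surjective (β.hom ≫ (ψ Z).symm u)
    have h1 : ψ Z (β.inv ≫ V.map b) = u := by simp [hb]
    have h2 : Φ.map b (ψ W β.inv) = u := by rw [← nat, h1]
    refine ⟨⟨β.inv ≫ V.map b, V.map a ≫ β.hom, ?_, ?_⟩, h1⟩
    · have e : β.inv ≫ V.map b ≫ V.map a = β.inv := by
        apply (ψ W).injective
        rw [← V.map_comp, nat, Φ.map_comp, ModuleCat.comp_apply, h2, ha]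
      rw [Category.assoc, reassoc_of% e, β.inv_hom_id]
    · have e : a ≫ b = 𝟙 Z := by
        apply uniq
        rw [Φ.map_comp, ModuleCat.comp_apply, ha, h2, Φ.map_id, ModuleCat.id_apply]
      rw [Category.assoc, β.hom_inv_id_assoc, ← V.map_comp, e, V.map_id]
  let s₀ : R' ≃ (T ⟶ T) :=
    (Equiv.ofBijective _ hu).trans ((ψ Z).symm.toEquiv.trans
      ⟨fun f => f ≫ α.inv, fun f => f ≫ α.hom, fun f => by simp, fun f => by simp⟩)
  have hs₀ (s : R') : ψ Z (s₀ s ≫ α.hom) = s • u := by simp [s₀]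
  have key {X : C} (s : R') (f : T ⟶ V.obj X) : ψ X (s₀ s ≫ f) = s • ψ X f := by
    obtain ⟨g, hg⟩ := V.map_surjective (α.inv ≫ f)
    have e : f = α.hom ≫ V.map g := by simp [hg]
    rw [e, ← Category.assoc, nat, nat, hs₀, hα, map_smul]
  have ext (f g : T ⟶ T) (h : ψ Z (f ≫ α.hom) = ψ Z (g ≫ α.hom)) : f = g := by
    simpa using (ψ Z).injective h
  let σ : R' ≃ₐ[k] (End T)ᵐᵒᵖ :=
    AlgEquiv.ofRingEquiv (f := 
      { toEquiv := s₀.trans (opEquiv (α := End T))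
        map_mul' := fun s t => congrArg op (ext _ _ (by
          change ψ Z (s₀ (s * t) ≫ α.hom) = ψ Z ((s₀ s ≫ s₀ t) ≫ α.hom)
          rw [Category.assoc, key, key, key, mul_smul]))
        map_add' := fun s t => congrArg op (ext _ _ (by
          change ψ Z (s₀ (s + t) ≫ α.hom) = ψ Z ((s₀ s + s₀ t) ≫ α.hom)
          rw [Preadditive.add_comp, (ψ Z).map_add, key, key, key, add_smul])) })
      (fun r => congrArg op (ext _ _ (by
          change ψ Z (s₀ (algebraMap k R' r) ≫ α.hom) = ψ Z ((r • 𝟙 T) ≫ α.hom)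
          rw [key, Linear.smul_comp, hk, Category.id_comp])))
  refine ⟨σ, ⟨NatIso.ofComponents (fun X => ModuleCat.isoOfAddEquiv
    (Q := (V ⋙ preadditiveCoyonedaObj T ⋙
      ModuleCat.restrictScalars (σ : R' →+* (End T)ᵐᵒᵖ)).obj X) (ψ X).symm ?_) ?_⟩⟩
  · intro s x
    apply (ψ X).injective
    refine ((ψ X).apply_symm_apply _).trans ?_
    change _ = ψ X (s₀ s ≫ (ψ X).symm x)
    rw [key]
    simp
  · intro X Y g
    refine ModuleCat.hom_ext (LinearMap.ext fun x => ?_)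
    change (ψ Y).symm (Φ.map g x) = (ψ X).symm x ≫ V.map g
    apply (ψ Y).injective
    rw [nat]; simp

namespace Species

variable {k : Type u} [Field k] {ι : Type} [LinearOrder ι] {S : Species k ι}

/-! ### The structure maps of a representation -/

theorem mu_inclB (q : ι) {i j : ι} (h : i < j) (b : S.B i j) (p : S.entry j q) :
    S.mu i j q (S.inclB h b) p = S.cons q i j h (BiMod.tmul b p) := by
  exact DFunLike.congr_fun ((S.col q).ext₂_incl [] (Incr.nil h) b) p

/-- The structure maps `φ_{ij}` of a representation are determined by their restrictions to the
bimodules `B_{ij}`. -/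
theorem Rep.φ_tmul_eq_ext₂ (X : S.Rep) (i j : ι) (p : S.entry i j) (x : X.X j) :
    X.φ i j (BiMod.tmul p x) =
      (PreRep.mk (S := S) X.X fun _ _ h => X.φB h).ext₂ i j p x := by
  have key : ∀ (c : List ι) (i : ι) (h : Incr j c i) (t : S.chainTensor j c i),
      X.φ i j (BiMod.tmul (S.incl c h t) x) =
        (PreRep.mk (S := S) X.X fun _ _ h => X.φB h).act c i h t x := by
    intro c
    induction c with
    | nil => intro i h b; rfl
    | cons a c ih =>
      intro i h t
      rw [← BiMod.curry_apply]
      induction t using S.chain_induction with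
      | h0 => simp
      | h1 b t =>
        rw [PreRep.act_cons, ← ih a h.2 t, Rep.φB_tmul, ← X.comp, BiMod.curry_apply]
        rw [mu_inclB, cons_incl]
      | h2 t t' ht ht' => simp only [map_add, AddMonoidHom.add_apply, ht, ht']
  rw [← BiMod.curry_apply]
  induction p using S.entry_induction with
  | h0 => simp
  | h1 c h t => rw [PreRep.ext₂_incl, ← key, BiMod.curry_apply]
  | h2 p q hp hq => simp only [map_add, AddMonoidHom.add_apply, hp, hq]

/-! ### Matrix units -/

namespace Alg

/-- The matrix with the only entry `a` at the place `(i, i)`. -/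
def diagUnit (i : ι) (a : S.A i) : S.Alg := ⟨Pi.single i a, 0⟩

/-- The matrix with the only off-diagonal entry `p` at the place `(i, j)`. -/
def offUnit (i j : ι) (p : S.entry i j) : S.Alg := ⟨0, Pi.single i (Pi.single j p)⟩

theorem diagUnit_diag (i : ι) (a : S.A i) (l : ι) :
    (diagUnit i a).diag l = (Pi.single i a : ∀ i, S.A i) l := rfl

@[simp] theorem diagUnit_off (i : ι) (a : S.A i) (l q : ι) : (diagUnit i a).off l q = 0 := rfl

@[simp] theorem offUnit_diag (i j : ι) (p : S.entry i j) (l : ι) : (offUnit i j p).diag l = 0 := rfl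

theorem offUnit_off (i j : ι) (p : S.entry i j) (l q : ι) :
    (offUnit i j p).off l q =
      (Pi.single i (Pi.single j p : ∀ q, S.entry i q) : ∀ l q, S.entry l q) l q := rfl

@[simp] theorem offUnit_off_same (i j : ι) (p : S.entry i j) : (offUnit i j p).off i j = p := by
  simp [offUnit_off]

theorem offUnit_off_of_ne {i j : ι} (p : S.entry i j) {l q : ι} (h : ¬ (l = i ∧ q = j)) :
    (offUnit i j p).off l q = 0 := by
  rw [offUnit_off]
  by_cases hl : l = i
  · subst hl
    rw [Pi.single_eq_same, Pi.single_eq_of_ne (fun hq => h ⟨rfl, hq⟩)]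
  · rw [Pi.single_eq_of_ne hl]; rfl

theorem diagUnit_add (i : ι) (a b : S.A i) :
    diagUnit i (a + b) = diagUnit i a + diagUnit i b :=
  ext' (fun l => by simp [diagUnit_diag, Pi.single_add]) (fun l q => by simp)

@[simp] theorem diagUnit_zero (i : ι) : diagUnit i (0 : S.A i) = 0 :=
  ext' (fun l => by simp [diagUnit_diag]) (fun l q => by simp)

theorem offUnit_add (i j : ι) (p q : S.entry i j) :
    offUnit i j (p + q) = offUnit i j p + offUnit i j q :=
  ext' (fun l => by simp) (fun l q => by simp [offUnit_off, Pi.single_add])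

variable [Fintype ι]

theorem diagUnit_mul_diagUnit (i : ι) (a b : S.A i) :
    diagUnit i a * diagUnit i b = diagUnit i (a * b) :=
  ext' (fun l => by simp [diagUnit_diag, Pi.single_mul]) (fun l q => by simp)

theorem diagUnit_mul_diagUnit_of_ne {i j : ι} (h : i ≠ j) (a : S.A i) (b : S.A j) :
    diagUnit i a * diagUnit j b = 0 :=
  ext' (fun l => by
    rw [mul_diag, diagUnit_diag, diagUnit_diag, zero_diag]
    by_cases hl : l = i
    · subst hl; rw [Pi.single_eq_of_ne h, mul_zero]
    · rw [Pi.single_eq_of_ne hl, zero_mul]) (fun l q => by simp)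

theorem diagUnit_mul_offUnit (i j : ι) (a : S.A i) (p : S.entry i j) :
    diagUnit i a * offUnit i j p = offUnit i j (a • p) :=
  ext' (fun l => by simp) (fun l q => by
    simp only [mul_off, diagUnit_off, offUnit_diag, diagUnit_diag, op_zero, zero_smul, map_zero,
      AddMonoidHom.zero_apply, Finset.sum_const_zero, add_zero]
    by_cases h : l = i ∧ q = j
    · obtain ⟨rfl, rfl⟩ := h; simp
    · rw [offUnit_off_of_ne p h, offUnit_off_of_ne _ h, smul_zero])

theorem offUnit_mul_diagUnit (i j : ι) (p : S.entry i j) (a : S.A j) :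
    offUnit i j p * diagUnit j a = offUnit i j (op a • p) :=
  ext' (fun l => by simp) (fun l q => by
    simp only [mul_off, diagUnit_off, offUnit_diag, diagUnit_diag, zero_smul, map_zero,
      Finset.sum_const_zero, add_zero, zero_add]
    by_cases h : l = i ∧ q = j
    · obtain ⟨rfl, rfl⟩ := h; simp
    · rw [offUnit_off_of_ne p h, offUnit_off_of_ne _ h, smul_zero])

theorem offUnit_mul_offUnit (i j q : ι) (p : S.entry i j) (p' : S.entry j q) :
    offUnit i j p * offUnit j q p' = offUnit i q (S.mu i j q p p') :=
  ext' (fun l => by simp) (fun l r => by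
    simp only [mul_off, offUnit_diag, op_zero, zero_smul, add_zero, zero_add]
    rw [Finset.sum_eq_single j]
    · by_cases h : l = i ∧ r = q
      · obtain ⟨rfl, rfl⟩ := h; simp
      · rw [offUnit_off_of_ne _ h]
        by_cases hl : l = i
        · rw [offUnit_off_of_ne p' (fun hr => h ⟨hl, hr.2⟩), map_zero]
        · rw [offUnit_off_of_ne p (fun hr => hl hr.1), map_zero, AddMonoidHom.zero_apply]
    · intro m _ hm
      rw [offUnit_off_of_ne p (fun h => hm h.2), map_zero, AddMonoidHom.zero_apply]
    · simp)

theorem sum_e : ∑ i, S.e i = 1 := by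
  have hd : ∀ s : Finset ι, (∑ i ∈ s, S.e i) = ⟨∑ i ∈ s, Pi.single i 1, 0⟩ := by
    intro s
    induction s using Finset.induction_on with
    | empty => rfl
    | insert a s ha ih =>
      rw [Finset.sum_insert ha, Finset.sum_insert ha, ih]
      exact ext' (fun l => rfl) (fun l q => zero_add _)
  rw [hd]
  exact ext' (fun l => by simp [Finset.sum_apply, Finset.sum_pi_single]) (fun l q => rfl)

theorem sum_units (x : S.Alg) :
    x = ∑ i, diagUnit i (x.diag i) + ∑ i, ∑ j, offUnit i j (x.off i j) := by
  let d (l : ι) : S.Alg →+ S.A l := ⟨⟨fun x => x.diag l, rfl⟩, fun _ _ => rfl⟩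
  let o (l q : ι) : S.Alg →+ S.entry l q := ⟨⟨fun x => x.off l q, rfl⟩, fun _ _ => rfl⟩
  refine ext' (fun l => ?_) (fun l q => ?_)
  · have hd (y : S.Alg) : y.diag l = d l y := rfl
    rw [hd (_ + _)]
    simp only [map_add, map_sum]
    change x.diag l = ∑ i, (diagUnit i (x.diag i)).diag l + ∑ i, ∑ j, 0
    simp [diagUnit_diag, Finset.sum_pi_single]
  · have ho (y : S.Alg) : y.off l q = o l q y := rfl
    rw [ho (_ + _)]
    simp only [map_add, map_sum]
    change x.off l q = ∑ i, 0 + ∑ i, ∑ j, (offUnit i j (x.off i j)).off l q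
    rw [Finset.sum_const_zero, zero_add, Finset.sum_eq_single l, Finset.sum_eq_single q,
      offUnit_off_same]
    · exact fun m _ hm => offUnit_off_of_ne _ fun h => hm h.2.symm
    · simp
    · exact fun m _ hm => Finset.sum_eq_zero fun _ _ => offUnit_off_of_ne _ fun h => hm h.1.symm
    · simp

theorem induction {p : S.Alg → Prop} (hd : ∀ i a, p (diagUnit i a))
    (ho : ∀ i j x, p (offUnit i j x)) (h0 : p 0) (h2 : ∀ x y, p x → p y → p (x + y))
    (x : S.Alg) : p x := by
  rw [sum_units x]
  exact h2 _ _ (Finset.sum_induction _ p h2 h0 fun i _ => hd i _)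
    (Finset.sum_induction _ p h2 h0 fun i _ =>
      Finset.sum_induction _ p h2 h0 fun j _ => ho i j _)

end Alg

/-! ### Representations and modules -/

namespace Rep

/-- The vector in `⨁ X_i` with the only entry `x` at the vertex `i`. -/
def single (X : S.Rep) (i : ι) (x : X.X i) : X.Total := (Pi.single i x : ∀ i, X.X i)

@[simp] theorem single_same (X : S.Rep) (i : ι) (x : X.X i) : X.single i x i = x :=
  Pi.single_eq_same (M := fun i => X.X i) i x

theorem single_of_ne (X : S.Rep) {i j : ι} (h : j ≠ i) (x : X.X i) : X.single i x j = 0 :=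
  Pi.single_eq_of_ne (M := fun i => X.X i) h x

theorem single_add (X : S.Rep) (i : ι) (x y : X.X i) :
    X.single i (x + y) = X.single i x + X.single i y :=
  Pi.single_add (f := fun i => X.X i) i x y

@[simp] theorem single_zero (X : S.Rep) (i : ι) : X.single i 0 = 0 :=
  Pi.single_zero (M := fun i => X.X i) i

variable [Fintype ι]

theorem diagUnit_smul (X : S.Rep) (i : ι) (a : S.A i) (x : X.Total) :
    Alg.diagUnit i a • x = X.single i (a • x i) := funext fun l => by
  rw [smul_apply]
  simp only [Alg.diagUnit_off, Alg.diagUnit_diag, ← BiMod.curry_apply]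
  simp only [map_zero, AddMonoidHom.zero_apply, Finset.sum_const_zero, add_zero]
  by_cases h : l = i
  · subst h; simp
  · rw [single_of_ne _ h, Pi.single_eq_of_ne h, zero_smul]

theorem offUnit_smul (X : S.Rep) (i j : ι) (p : S.entry i j) (x : X.Total) :
    Alg.offUnit i j p • x = X.single i (X.φ i j (BiMod.tmul p (x j))) := funext fun l => by
  rw [smul_apply]
  simp only [Alg.offUnit_diag, ← BiMod.curry_apply]
  rw [zero_smul, zero_add, Finset.sum_eq_single j]
  · by_cases h : l = i
    · subst h; simp
    · rw [single_of_ne _ h, Alg.offUnit_off_of_ne p (fun hr => h hr.1), map_zero,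
        AddMonoidHom.zero_apply]
  · intro m _ hm
    rw [Alg.offUnit_off_of_ne p (fun h => hm h.2), map_zero, AddMonoidHom.zero_apply]
  · simp

theorem e_smul (X : S.Rep) (i : ι) (x : X.Total) : S.e i • x = X.single i (x i) :=
  (diagUnit_smul X i 1 x).trans (by rw [one_smul])

/-- The morphism of representations that belongs to a linear map `⨁ X_i → ⨁ Y_i`. -/
def homOfLinearMap {X Y : S.Rep} (f : X.Total →ₗ[S.Alg] Y.Total) : X ⟶ Y :=
  Hom.mk (X := X) (Y := Y)
    (fun i =>
      { toFun := fun x => f (X.single i x) i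
        map_add' := fun x y => by rw [single_add, map_add, total_add_apply]
        map_smul' := fun a x => by
          have e : X.single i (a • x) = Alg.diagUnit i a • X.single i x := by
            rw [diagUnit_smul, single_same]
          rw [e, map_smul, diagUnit_smul, single_same, RingHom.id_apply] })
    (fun i j t => by
      induction t using BiMod.tens_induction with
      | h0 => simp [total_zero_apply]
      | h1 p x =>
        have e : X.single i (X.φ i j (BiMod.tmul p x)) = Alg.offUnit i j p • X.single j x := by
          rw [offUnit_smul, single_same]
        change f (X.single i _) i = Y.φ i j (BiMod.tmul p (f (X.single j x) j))
        rw [e, map_smul, offUnit_smul, single_same]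
      | h2 x y hx hy => simp only [map_add, hx, hy])

end Rep

variable [Fintype ι]

instance : S.toModule.Full where
  map_surjective {X Y} f := by
    let g : X.Total →ₗ[S.Alg] Y.Total := f.hom
    refine ⟨Rep.homOfLinearMap g, ModuleCat.hom_ext (LinearMap.ext fun x => ?_)⟩
    change (fun i => g (X.single i (x i)) i) = g x
    refine funext fun i => ?_
    have e (x : X.Total) : g (X.single i (x i)) = Y.single i (g x i) := by
      rw [← Rep.e_smul, map_smul, Rep.e_smul]
    exact (congrArg (fun y : Y.Total => y i) (e x)).trans (Y.single_same i _)

section Corner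

variable (M : Type u) [AddCommGroup M] [Module S.Alg M]

/-- The subgroup `e_i M` of a `Λ`-module `M`. -/
def corner (i : ι) : AddSubgroup M where
  carrier := {m | S.e i • m = m}
  zero_mem' := smul_zero _
  add_mem' {a b} ha hb := by
    change S.e i • a = a at ha
    change S.e i • b = b at hb
    change S.e i • (a + b) = a + b
    rw [smul_add, ha, hb]
  neg_mem' {a} ha := by
    change S.e i • a = a at ha
    change S.e i • (-a) = -a
    rw [smul_neg, ha]

variable {M}

theorem corner_smul {i : ι} (m : corner (S := S) M i) : S.e i • (m : M) = m := m.2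

theorem diagUnit_smul_mem {i : ι} (a : S.A i) (m : M) :
    Alg.diagUnit i a • m ∈ corner (S := S) M i := by
  change Alg.diagUnit i 1 • Alg.diagUnit i a • m = _
  rw [← mul_smul, Alg.diagUnit_mul_diagUnit, one_mul]

theorem offUnit_smul_mem {i j : ι} (p : S.entry i j) (m : M) :
    Alg.offUnit i j p • m ∈ corner (S := S) M i := by
  change Alg.diagUnit i 1 • Alg.offUnit i j p • m = _
  rw [← mul_smul, Alg.diagUnit_mul_offUnit, one_smul]

instance (i : ι) : Module (S.A i) (corner (S := S) M i) where
  smul a m := ⟨Alg.diagUnit i a • (m : M), diagUnit_smul_mem a _⟩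
  one_smul m := Subtype.ext (corner_smul m)
  mul_smul a b m := Subtype.ext (by
    change Alg.diagUnit i (a * b) • (m : M) = Alg.diagUnit i a • Alg.diagUnit i b • (m : M)
    rw [← mul_smul, Alg.diagUnit_mul_diagUnit])
  smul_zero a := Subtype.ext (smul_zero _)
  smul_add a m n := Subtype.ext (smul_add _ _ _)
  add_smul a b m := Subtype.ext (by
    change Alg.diagUnit i (a + b) • (m : M) = Alg.diagUnit i a • (m : M) + Alg.diagUnit i b • (m : M)
    rw [Alg.diagUnit_add, add_smul])
  zero_smul m := Subtype.ext (by
    change Alg.diagUnit i 0 • (m : M) = 0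
    rw [Alg.diagUnit_zero, zero_smul])

variable (M) in
/-- The pairing `A_{ij} × e_j M → e_i M`. -/
def cornerAct (i j : ι) :
    S.entry i j →ₗ[S.A i] (corner (S := S) M j →+ corner (S := S) M i) where
  toFun p :=
    { toFun := fun m => ⟨Alg.offUnit i j p • (m : M), offUnit_smul_mem p _⟩
      map_zero' := Subtype.ext (smul_zero _)
      map_add' := fun m n => Subtype.ext (smul_add _ _ _) }
  map_add' p q := AddMonoidHom.ext fun m => Subtype.ext (by
    change Alg.offUnit i j (p + q) • (m : M) = Alg.offUnit i j p • (m : M) + Alg.offUnit i j q • (m : M)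
    rw [Alg.offUnit_add, add_smul])
  map_smul' a p := AddMonoidHom.ext fun m => Subtype.ext (by
    change Alg.offUnit i j (a • p) • (m : M) = Alg.diagUnit i a • Alg.offUnit i j p • (m : M)
    rw [← mul_smul, Alg.diagUnit_mul_offUnit])

variable (S M) in
/-- The representation with the modules `e_i M` that belongs to a `Λ`-module `M`. -/
def ofModule : S.Rep where
  X i := ModuleCat.of (S.A i) (corner (S := S) M i)
  φ i j := BiMod.lift (cornerAct M i j) (fun p s m => Subtype.ext (by
    change Alg.offUnit i j (op s • p) • (m : M) = Alg.offUnit i j p • Alg.diagUnit j s • (m : M)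
    rw [← mul_smul, Alg.offUnit_mul_diagUnit]))
  comp i j q p p' m := Subtype.ext (by
    change Alg.offUnit i q (S.mu i j q p p') • (m : corner (S := S) M q).1 =
      Alg.offUnit i j p • Alg.offUnit j q p' • (m : corner (S := S) M q).1
    rw [← mul_smul, Alg.offUnit_mul_offUnit])

theorem diagUnit_smul_corner_of_ne {i j : ι} (h : i ≠ j) (a : S.A i)
    (m : corner (S := S) M j) : Alg.diagUnit i a • (m : M) = 0 := by
  rw [← corner_smul m, ← mul_smul]
  exact (congrArg (· • (m : M)) (Alg.diagUnit_mul_diagUnit_of_ne h a 1)).trans (zero_smul _ _)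

theorem offUnit_smul_corner_of_ne {i j l : ι} (h : j ≠ l) (p : S.entry i j)
    (m : corner (S := S) M l) : Alg.offUnit i j p • (m : M) = 0 := by
  have e : Alg.offUnit i j p = Alg.offUnit i j p * Alg.diagUnit j 1 := by
    rw [Alg.offUnit_mul_diagUnit, op_one, one_smul]
  rw [e, mul_smul, diagUnit_smul_corner_of_ne h, smul_zero]

variable (S M) in
/-- The inclusion of `e_i M` in `M`. -/
def cornerVal (i : ι) : (ofModule S M).X i →+ M := (corner (S := S) M i).subtype

theorem diagUnit_smul_cornerVal (i : ι) (a : S.A i) (m : (ofModule S M).X i) :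
    Alg.diagUnit i a • cornerVal S M i m = cornerVal S M i (a • m) := rfl

theorem offUnit_smul_cornerVal (i j : ι) (p : S.entry i j) (m : (ofModule S M).X j) :
    Alg.offUnit i j p • cornerVal S M j m =
      cornerVal S M i ((ofModule S M).φ i j (BiMod.tmul p m)) := rfl

variable (S M) in
/-- A `Λ`-module `M` is the direct sum of the `e_i M`. -/
def ofModuleEquiv : (ofModule S M).Total ≃+ M where
  toFun x := ∑ i, cornerVal S M i (x i)
  invFun m := (fun i => ⟨S.e i • m, diagUnit_smul_mem 1 m⟩ : ∀ i, corner (S := S) M i)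
  left_inv x := funext fun i => Subtype.ext (by
    change S.e i • ∑ j, cornerVal S M j (x j) = cornerVal S M i (x i)
    rw [Finset.smul_sum, Finset.sum_eq_single i]
    · exact corner_smul (S := S) (M := M) (x i)
    · exact fun j _ h => diagUnit_smul_corner_of_ne (M := M) h.symm 1 (x j)
    · simp)
  right_inv m := by
    change ∑ i, S.e i • m = m
    rw [← Finset.sum_smul, Alg.sum_e, one_smul]
  map_add' x y := by
    simp only [Rep.total_add_apply, map_add, Finset.sum_add_distrib]

theorem ofModuleEquiv_apply (x : (ofModule S M).Total) :
    ofModuleEquiv S M x = ∑ i, cornerVal S M i (x i) := rfl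

theorem ofModuleEquiv_single (i : ι) (m : (ofModule S M).X i) :
    ofModuleEquiv S M ((ofModule S M).single i m) = cornerVal S M i m := by
  rw [ofModuleEquiv_apply, Finset.sum_eq_single i, Rep.single_same]
  · exact fun j _ h => by rw [Rep.single_of_ne _ h, map_zero]
  · simp

theorem ofModuleEquiv_smul (a : S.Alg) (x : (ofModule S M).Total) :
    ofModuleEquiv S M (a • x) = a • ofModuleEquiv S M x := by
  induction a using Alg.induction with
  | hd i a =>
    rw [Rep.diagUnit_smul, ofModuleEquiv_apply x, Finset.smul_sum, Finset.sum_eq_single i,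
      ofModuleEquiv_single, diagUnit_smul_cornerVal]
    · exact fun j _ h => diagUnit_smul_corner_of_ne (M := M) h.symm a (x j)
    · simp
  | ho i j p =>
    rw [Rep.offUnit_smul, ofModuleEquiv_apply x, Finset.smul_sum, Finset.sum_eq_single j,
      ofModuleEquiv_single, offUnit_smul_cornerVal]
    · exact fun l _ h => offUnit_smul_corner_of_ne (M := M) h.symm p (x l)
    · simp
  | h0 => simp
  | h2 a b ha hb => rw [add_smul, map_add, ha, hb, add_smul]

end Corner

instance : S.toModule.EssSurj where
  mem_essImage M := ⟨ofModule S M, ⟨ModuleCat.isoOfAddEquiv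
    (P := S.toModule.obj (ofModule S M)) (ofModuleEquiv S M) ofModuleEquiv_smul⟩⟩

end Species

namespace Species

variable {k : Type u} [Field k] {ι : Type} [LinearOrder ι] {S : Species k ι}

/-! ### The regular representation -/

/-- A morphism from the representation that extends given maps `B_{ij} ⊗ Y_j → Y_i` has to be
compatible with these maps only. -/
def PreRep.homMk {Y : S.PreRep} {Z : S.Rep} (f : ∀ i, Y.X i →ₗ[S.A i] Z.X i)
    (hf : ∀ i j h b x, f i (Y.β i j h (BiMod.tmul b x)) = Z.φB h (BiMod.tmul b (f j x))) :
    Y.toRep ⟶ Z :=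
  Rep.Hom.mk (X := Y.toRep) (Y := Z) f (fun i j t => by
    change f i (Y.ext i j t) = Z.φ i j ((S.entry i j).tmap (f j) t)
    change (S.entry i j).Tens (Y.X j) at t
    induction t using BiMod.tens_induction with
    | h0 => simp
    | h1 p x =>
      rw [BiMod.tmap_tmul, Rep.φ_tmul_eq_ext₂]
      exact PreRep.ext₂_map (Y' := ⟨Z.X, fun _ _ h => Z.φB h⟩)
        (fun i => (f i).toAddMonoidHom) hf i j p x
    | h2 x y hx hy => simp only [map_add, hx, hy])

theorem PreRep.toRep_φB_tmul (Y : S.PreRep) {i j : ι} (h : i < j) (b : S.B i j) (x : Y.X j) :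
    Rep.φB Y.toRep h (BiMod.tmul b x) = Y.β i j h (BiMod.tmul b x) :=
  DFunLike.congr_fun (Y.ext₂_incl [] (Incr.nil h) b) x

variable (S) in
/-- The row `e_i Λ = A_i ⊕ ⨁_q A_{iq}`. -/
abbrev Row (i : ι) : Type u := S.A i × ∀ q, S.entry i q

/-- The row with the only entry `p`, in the column `q`. -/
def rowSingle (i q : ι) : S.entry i q →ₗ[S.A i] ∀ q, S.entry i q :=
  LinearMap.single (S.A i) (fun q => S.entry i q) q

@[simp] theorem rowSingle_same (i q : ι) (p : S.entry i q) : rowSingle i q p q = p :=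
  Pi.single_eq_same (M := fun q => S.entry i q) q p

theorem rowSingle_of_ne (i : ι) {q l : ι} (h : l ≠ q) (p : S.entry i q) :
    rowSingle i q p l = 0 :=
  Pi.single_eq_of_ne (M := fun q => S.entry i q) h p

/-- The multiplication `B_{ij} × e_j Λ → e_i Λ`, which takes values off the diagonal. -/
def rowMul {i j : ι} (h : i < j) : S.B i j →ₗ[S.A i] (S.Row j →+ ∀ q, S.entry i q) where
  toFun b :=
    { toFun := fun x => rowSingle i j (S.inclB h (op x.1 • b)) +
        fun q => BiMod.curry (S.cons q i j h) b (x.2 q)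
      map_zero' := by
        funext q
        simp only [Prod.fst_zero, Prod.snd_zero, MulOpposite.op_zero, zero_smul, map_zero,
          Pi.add_apply, Pi.zero_apply, add_zero]
      map_add' := fun x y => by
        funext q
        simp only [Prod.fst_add, Prod.snd_add, MulOpposite.op_add, add_smul, map_add,
          Pi.add_apply]
        abel }
  map_add' b b' := by
    ext x q
    simp only [AddMonoidHom.add_apply, AddMonoidHom.coe_mk, ZeroHom.coe_mk,
      smul_add, map_add, Pi.add_apply]
    abel
  map_smul' a b := by
    ext x q
    simp only [AddMonoidHom.smul_apply, AddMonoidHom.coe_mk, ZeroHom.coe_mk,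
      ← smul_comm a _ b, map_smul, Pi.add_apply, Pi.smul_apply, smul_add,
      RingHom.id_apply]

theorem rowMul_apply {i j : ι} (h : i < j) (b : S.B i j) (x : S.Row j) (q : ι) :
    rowMul h b x q = rowSingle i j (S.inclB h (op x.1 • b)) q +
      S.cons q i j h (BiMod.tmul b (x.2 q)) := rfl

variable (S) in
/-- The regular representation: at the vertex `i` it has the row `e_i Λ`. -/
def row : S.PreRep where
  X i := ModuleCat.of (S.A i) (S.Row i)
  β i j h := BiMod.lift
    { toFun := fun b => (AddMonoidHom.inr (S.A i) (∀ q, S.entry i q)).comp (rowMul h b)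
      map_add' := fun b b' => by rw [map_add, AddMonoidHom.comp_add]
      map_smul' := fun a b => by
        ext x : 1
        rw [map_smul]
        exact (Prod.ext (smul_zero a) rfl :
          a • ((0 : S.A i), rowMul h b x) = (0, a • rowMul h b x)).symm }
    (fun b s x => by
      refine congrArg (Prod.mk (0 : S.A i)) (funext fun q => ?_)
      have e : op x.1 • op s • b = op (s * x.1) • b := by rw [MulOpposite.op_mul, mul_smul]
      rw [rowMul_apply, rowMul_apply, e, BiMod.tmul_bal]
      rfl)

/-- The row with diagonal entry `0` and the given entries off the diagonal. -/
def rowInr (i : ι) : (∀ q, S.entry i q) →+ S.row.X i :=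
  AddMonoidHom.inr (S.A i) (∀ q, S.entry i q)

/-- The `i`-th row of the unit matrix. -/
def rowUnit (i : ι) : S.row.X i := ((1, 0) : S.Row i)

theorem row_β_tmul {i j : ι} (h : i < j) (b : S.B i j) (x : S.row.X j) :
    S.row.β i j h (BiMod.tmul b x) = rowInr i (rowMul h b x) := rfl

variable (S) in
/-- The unit matrix, as an element of the regular representation. -/
def rowOne : S.row.toRep.Total := fun i => rowUnit i

theorem row_ext₂_rowUnit (i j : ι) (p : S.entry i j) :
    S.row.ext₂ i j p (rowUnit j) = rowInr i (rowSingle i j p) := by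
  have key : ∀ (c : List ι) (i : ι) (h : Incr j c i) (t : S.chainTensor j c i),
      S.row.act c i h t (rowUnit j) = rowInr i (rowSingle i j (S.incl c h t)) := by
    intro c
    induction c with
    | nil =>
      intro i (h : i < j) (b : S.B i j)
      refine congrArg (rowInr i) (funext fun q => ?_ :
        rowMul h b ((1, 0) : S.Row j) = rowSingle i j (S.inclB h b))
      change rowSingle i j (S.inclB h (op 1 • b)) q + BiMod.curry (S.cons q i j h) b 0 = _
      rw [map_zero, add_zero, MulOpposite.op_one, one_smul]
    | cons a c ih =>
      intro i h t
      induction t using S.chain_induction with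
      | h0 => simp
      | h1 b t =>
        rw [PreRep.act_cons, ih, row_β_tmul]
        refine congrArg (rowInr i) (funext fun q => ?_)
        change rowSingle i a (S.inclB h.1 (op 0 • b)) q +
          S.cons q i a h.1 (BiMod.tmul b (rowSingle a j (S.incl c h.2 t) q)) = _
        rw [MulOpposite.op_zero, zero_smul, map_zero, map_zero, Pi.zero_apply, zero_add]
        by_cases hq : q = j
        · subst hq
          rw [rowSingle_same, rowSingle_same, cons_incl]
        · rw [rowSingle_of_ne _ hq, rowSingle_of_ne _ hq, ← BiMod.curry_apply, map_zero]
      | h2 t t' ht ht' => simp only [map_add, AddMonoidHom.add_apply, ht, ht']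
  induction p using S.entry_induction with
  | h0 => simp
  | h1 c h t => rw [PreRep.ext₂_incl, key]
  | h2 p q hp hq => simp only [map_add, AddMonoidHom.add_apply, hp, hq]

variable [Fintype ι]

theorem sum_rowSingle (i : ι) (p : ∀ q, S.entry i q) : ∑ q, rowSingle i q (p q) = p :=
  Finset.univ_sum_single (M := fun q => S.entry i q) p

theorem smul_rowOne_apply (s : S.Alg) (i : ι) :
    (s • S.rowOne) i = ((s.diag i, s.off i) : S.Row i) := by
  have e (j : ι) : S.row.toRep.φ i j (BiMod.tmul (s.off i j) (S.rowOne j)) =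
      rowInr i (rowSingle i j (s.off i j)) := row_ext₂_rowUnit i j _
  rw [Rep.smul_apply, Finset.sum_congr rfl fun j _ => e j]
  refine (congrArg (s.diag i • (rowUnit i : S.row.X i) + ·)
    (map_sum (rowInr i) (fun j => rowSingle i j (s.off i j)) _).symm).trans ?_
  rw [sum_rowSingle]
  change s.diag i • ((1, 0) : S.Row i) + ((0, s.off i) : S.Row i) = _
  ext1 <;> simp

theorem smul_rowOne_bijective : Function.Bijective fun s : S.Alg => s • S.rowOne := by
  constructor
  · intro s s' h
    have h' (i : ι) : ((s.diag i, s.off i) : S.Row i) = (s'.diag i, s'.off i) := by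
      rw [← smul_rowOne_apply, ← smul_rowOne_apply]
      exact congrFun h i
    exact Alg.ext' (fun i => congrArg Prod.fst (h' i))
      (fun i j => congrFun (congrArg Prod.snd (h' i)) j)
  · intro x
    let x' : ∀ i, S.Row i := x
    exact ⟨⟨fun i => (x' i).1, fun i => (x' i).2⟩, funext fun i => smul_rowOne_apply _ i⟩

/-- The components `(a, p) ↦ a z_i + ∑_q p_q z_q` of the morphism from the regular representation
that sends the unit matrix to `z`. -/
def rowHomAux (Z : S.Rep) (z : Z.Total) (i : ι) : S.Row i →ₗ[S.A i] Z.X i where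
  toFun x := x.1 • z i + ∑ q, BiMod.curry (Z.φ i q) (x.2 q) (z q)
  map_add' x y := by
    simp only [Prod.fst_add, Prod.snd_add, Pi.add_apply, add_smul, map_add,
      AddMonoidHom.add_apply, Finset.sum_add_distrib]
    abel
  map_smul' a x := by
    simp only [Prod.smul_fst, Prod.smul_snd, Pi.smul_apply, smul_assoc, map_smul, smul_add,
      AddMonoidHom.smul_apply, Finset.smul_sum, RingHom.id_apply]

/-- The map `rowHomAux` as a map on the modules of the regular representation. -/
def rowHomApp (Z : S.Rep) (z : Z.Total) (i : ι) : S.row.X i →ₗ[S.A i] Z.X i := rowHomAux Z z i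

theorem rowHomApp_apply (Z : S.Rep) (z : Z.Total) (i : ι) (x : S.Row i) :
    rowHomApp Z z i x = x.1 • z i + ∑ q, BiMod.curry (Z.φ i q) (x.2 q) (z q) := rfl

theorem rowHomApp_rowUnit (Z : S.Rep) (z : Z.Total) (i : ι) :
    rowHomApp Z z i (rowUnit i) = z i := by
  refine (rowHomApp_apply Z z i _).trans ?_
  simp [rowUnit]

theorem rowHomApp_β (Z : S.Rep) (z : Z.Total) {i j : ι} (h : i < j) (b : S.B i j)
    (x : S.row.X j) :
    rowHomApp Z z i (S.row.β i j h (BiMod.tmul b x)) =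
      Z.φB h (BiMod.tmul b (rowHomApp Z z j x)) := by
  let x' : S.Row j := x
  have e1 : rowHomApp Z z i (S.row.β i j h (BiMod.tmul b x)) =
      (0 : S.A i) • z i + ∑ q, BiMod.curry (Z.φ i q) (rowMul h b x' q) (z q) := rfl
  have e2 : Z.φB h (BiMod.tmul b (rowHomApp Z z j x)) = BiMod.curry (Z.φB h) b
    (x'.1 • z j + ∑ q, BiMod.curry (Z.φ j q) (x'.2 q) (z q)) := rfl
  have e3 (q : ι) : BiMod.curry (Z.φ i q) (S.cons q i j h (BiMod.tmul b (x'.2 q))) (z q) =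
      BiMod.curry (Z.φB h) b (BiMod.curry (Z.φ j q) (x'.2 q) (z q)) := by
    rw [← mu_inclB]
    exact Z.comp i j q _ _ _
  rw [e1, e2, zero_smul, zero_add, map_add, map_sum]
  simp only [rowMul_apply, map_add, AddMonoidHom.add_apply, Finset.sum_add_distrib, e3]
  congr 1
  rw [Finset.sum_eq_single j, rowSingle_same, BiMod.curry_apply, BiMod.curry_apply,
    Rep.φB_tmul, inclB_right, BiMod.tmul_bal]
  · intro q _ hq
    rw [rowSingle_of_ne _ hq, map_zero, AddMonoidHom.zero_apply]
  · simp

end Species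

/-! ### Dual bases of bimodules -/

namespace BiMod

variable {R S : Type u} [Ring R] [Ring S] {M : BiMod R S} {N : Type u} [AddCommGroup N] [Module S N]

theorem hom_ext {Z : Type u} [AddCommGroup Z] [Module R Z] {f g : M.Tens N →ₗ[R] Z}
    (h : ∀ m n, f (tmul m n) = g (tmul m n)) : f = g := by
  ext t
  induction t using tens_induction with
  | h0 => simp
  | h1 m n => exact h m n
  | h2 x y hx hy => rw [map_add, map_add, hx, hy]

/-- An element of `Hom_S(M, S)`, as a linear map. -/
def rightDual.toLin (g : M.rightDual) : M →ₗ[Sᵐᵒᵖ] S := g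

theorem rightDual.ext {g g' : M.rightDual} (h : ∀ m, toLin g m = toLin g' m) : g = g' :=
  DFunLike.ext (F := M →ₗ[Sᵐᵒᵖ] S) g g' h

@[simp] theorem eval_tmul (g : M.rightDual) (m : M) (n : N) :
    M.eval N g (tmul m n) = rightDual.toLin g m • n := rfl

variable (M) in
/-- A finite dual basis of the right `S`-module `M`: elements `b_i` of `M` and `b_i^*` of
`Hom_S(M, S)` with `m = ∑ b_i b_i^*(m)`. -/
structure DualBasis where
  n : ℕ
  b : Fin n → M
  d : Fin n → M.rightDual
  sum_eq : ∀ m, ∑ i, op (rightDual.toLin (d i) m) • b i = m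

theorem DualBasis.nonempty (h : Module.Free Sᵐᵒᵖ M) (h' : Module.Finite Sᵐᵒᵖ M) :
    Nonempty M.DualBasis := by
  let c := Module.Free.chooseBasis Sᵐᵒᵖ M
  let e := Fintype.equivFin (Module.Free.ChooseBasisIndex Sᵐᵒᵖ M)
  refine ⟨_, fun i => c (e.symm i), fun i =>
    ({ toFun := fun m => unop (c.repr m (e.symm i))
       map_add' := fun m m' => by simp
       map_smul' := fun s m => by simp } : M →ₗ[Sᵐᵒᵖ] S), fun m => ?_⟩
  refine (Equiv.sum_comp e.symm fun i => c.repr m i • c i).trans (c.sum_repr m)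

namespace DualBasis

variable (D : M.DualBasis)

theorem sum_tmul_eval (t : M.Tens N) : ∑ i, tmul (D.b i) (M.eval N (D.d i) t) = t := by
  induction t using tens_induction with
  | h0 => simp [tmul_zero]
  | h1 m n =>
    simp only [eval_tmul, ← tmul_bal]
    have e := map_sum ((AddMonoidHom.eval n).comp
      (curry (LinearMap.id : M.Tens N →ₗ[R] M.Tens N)).toAddMonoidHom)
      (fun i => op (rightDual.toLin (D.d i) m) • D.b i) Finset.univ
    rw [D.sum_eq] at e
    exact e.symm
  | h2 x y hx hy => simp only [map_add, tmul_add, Finset.sum_add_distrib, hx, hy]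

theorem ext_eval (D : M.DualBasis) {t t' : M.Tens N} (h : ∀ g, M.eval N g t = M.eval N g t') : t = t' := by
  rw [← D.sum_tmul_eval t, ← D.sum_tmul_eval t']
  simp only [h]

theorem sum_smul (g : M.rightDual) : ∑ i, rightDual.toLin g (D.b i) • D.d i = g := by
  refine rightDual.ext fun m => ?_
  have e : ∀ s : Finset (Fin D.n), rightDual.toLin (∑ i ∈ s, rightDual.toLin g (D.b i) • D.d i) m
      = ∑ i ∈ s, rightDual.toLin g (D.b i) * rightDual.toLin (D.d i) m := by
    intro s
    exact map_sum (M := M.rightDual) (⟨⟨fun f => rightDual.toLin f m, rfl⟩, fun _ _ => rfl⟩ : M.rightDual →+ S) _ s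
  refine (e _).trans ?_
  conv_rhs => rw [← D.sum_eq m, map_sum]
  exact Finset.sum_congr rfl fun i _ => (map_smul (rightDual.toLin g) _ _).symm

variable {P : Type u} [AddCommGroup P] [Module R P] (φ : Iso M.leftDual M.rightDual)
  (β : M.leftDual.Tens P →ₗ[S] N)

theorem eval_sum (g : M.rightDual) (y : P) :
    M.eval N g (∑ i, tmul (D.b i) (β (tmul (φ.toEquiv.symm (D.d i)) y))) =
      β (tmul (φ.toEquiv.symm g) y) := by
  rw [map_sum]
  simp only [eval_tmul, ← curry_apply]
  conv_rhs => rw [← D.sum_smul g, map_sum, map_sum, AddMonoidHom.finsetSum_apply]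
  simp only [map_smul, AddMonoidHom.smul_apply]

/-- The map `P → M ⊗_S N`, `y ↦ ∑ b_i ⊗ β (b_i^* ⊗ y)`, that corresponds to the map
`β : Hom_R(M, R) ⊗_R P → N`. -/
def coev : P →ₗ[R] M.Tens N where
  toFun y := ∑ i, tmul (D.b i) (β (tmul (φ.toEquiv.symm (D.d i)) y))
  map_add' y y' := by
    simp only [tmul_add, map_add, Finset.sum_add_distrib]
  map_smul' r y := D.ext_eval fun g => by
    have e : φ.toEquiv.symm (op r • g) = op r • φ.toEquiv.symm g := by
      rw [LinearEquiv.symm_apply_eq, φ.map_right, LinearEquiv.apply_symm_apply]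
    rw [RingHom.id_apply, ← eval_right, eval_sum, eval_sum, e, tmul_bal]

theorem eval_coev (g : M.rightDual) (y : P) :
    M.eval N g (D.coev φ β y) = β (tmul (φ.toEquiv.symm g) y) :=
  D.eval_sum φ β g y

end DualBasis

end BiMod

namespace Species

variable {k : Type u} [Field k] {ι : Type} [LinearOrder ι] {S : Species k (WithBot ι)}

/-! ### The left adjoint of the reflection functor -/

namespace FrobeniusType

/-- A dual basis of the right `A_j`-module `B_{1j}`. -/
def dualBasis (hS : S.FrobeniusType) (j : ι) : (S.B ⊥ j).DualBasis :=
  (BiMod.DualBasis.nonempty (hS.free_right ⊥ j (WithBot.bot_lt_coe j))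
    (hS.finite_right ⊥ j (WithBot.bot_lt_coe j))).some

end FrobeniusType

section Reverse

variable (Y : S.reflect.PreRep)

/-- The module of `Y` at the vertex `1`, as a module over `A_1`. -/
def topMod : ModuleCat.{u} (S.A ⊥) := Y.X ⊤

/-- The module of `Y` at a vertex `j ≥ 2`, as a module over `A_j`. -/
def coeMod (j : ι) : ModuleCat.{u} (S.A j) := Y.X j

/-- The structure map `B_{ij} ⊗ Y_j → Y_i` for `2 ≤ i < j`. -/
def coeβ {i j : ι} (h : i < j) : (S.B i j).Tens (coeMod Y j) →ₗ[S.A i] coeMod Y i :=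
  Y.β i j (WithTop.coe_lt_coe.2 h)

/-- The structure map `Hom_{A_1}(B_{1j}, A_1) ⊗ Y_1 → Y_j`. -/
def topβ (j : ι) : (S.B ⊥ j).leftDual.Tens (topMod Y) →ₗ[S.A j] coeMod Y j :=
  Y.β j ⊤ (WithTop.coe_lt_top j)

variable (hS : S.FrobeniusType)

/-- The map `Y_1 → ⨁_j B_{1j} ⊗ Y_j` that corresponds to the maps
`Hom_{A_1}(B_{1j}, A_1) ⊗ Y_1 → Y_j`. -/
def FrobeniusType.outMap : topMod Y →ₗ[S.A ⊥] ∀ j : ι, (S.B ⊥ j).Tens (coeMod Y j) :=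
  LinearMap.pi fun j : ι => (hS.dualBasis j).coev (hS.dualIso ⊥ j (WithBot.bot_lt_coe j)) (topβ Y j)

theorem FrobeniusType.eval_outMap (y : topMod Y) (j : ι) (g : (S.B ⊥ j).rightDual) :
    (S.B ⊥ j).eval (coeMod Y j) g (hS.outMap Y y j) =
      topβ Y j (BiMod.tmul ((hS.dualIso ⊥ j (WithBot.bot_lt_coe j)).toEquiv.symm g) y) :=
  (hS.dualBasis j).eval_coev _ _ g y

/-- The modules of `F_1^-(Y)`: `Y_2, …, Y_n` and the cokernel of `Y_1 → ⨁_j B_{1j} ⊗ Y_j`. -/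
def FrobeniusType.coreflectX : ∀ i : WithBot ι, ModuleCat.{u} (S.A i)
  | ⊥ => ModuleCat.of (S.A ⊥)
      ((∀ j : ι, (S.B ⊥ j).Tens (coeMod Y j)) ⧸ LinearMap.range (hS.outMap Y))
  | (j : ι) => coeMod Y j

/-- The structure maps of `F_1^-(Y)`. -/
def FrobeniusType.coreflectβ : ∀ i j : WithBot ι, i < j →
    ((S.B i j).Tens (hS.coreflectX Y j) →ₗ[S.A i] hS.coreflectX Y i)
  | (i : ι), (j : ι), h => coeβ Y (WithBot.coe_lt_coe.1 h)
  | ⊥, (j : ι), _ => (LinearMap.range (hS.outMap Y)).mkQ.comp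
      (LinearMap.single (S.A ⊥) (fun j : ι => (S.B ⊥ j).Tens (coeMod Y j)) j)
  | _, ⊥, h => absurd h not_lt_bot

/-- The left adjoint `F_1^-` of the reflection functor, on objects. -/
def FrobeniusType.coreflect : S.PreRep := ⟨hS.coreflectX Y, hS.coreflectβ Y⟩

variable [Fintype ι]

theorem FrobeniusType.inMap_coreflect :
    Rep.inMap (hS.coreflect Y).toRep = (LinearMap.range (hS.outMap Y)).mkQ := by
  have e (j : ι) : Rep.φB (hS.coreflect Y).toRep (WithBot.bot_lt_coe j) =
      hS.coreflectβ Y ⊥ j (WithBot.bot_lt_coe j) :=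
    BiMod.hom_ext fun b x => PreRep.toRep_φB_tmul (hS.coreflect Y) (WithBot.bot_lt_coe j) b x
  refine LinearMap.ext fun t => ?_
  let t' : ∀ j : ι, (S.B ⊥ j).Tens (coeMod Y j) := t
  refine (Rep.inMap_apply _ t).trans ?_
  simp only [e]
  refine (map_sum (LinearMap.range (hS.outMap Y)).mkQ (fun j => Pi.single j (t' j)) _).symm.trans ?_
  exact congrArg _ (Finset.univ_sum_single t')

/-- The unit `Y → F_1^+ F_1^- Y`: it is the identity at the vertices `2, …, n`. -/
def FrobeniusType.unitApp : ∀ i : WithTop ι,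
    Y.X i →ₗ[S.reflect.A i] reflectX (hS.coreflect Y).toRep i
  | (i : ι) => (LinearMap.id : coeMod Y i →ₗ[S.A i] coeMod Y i)
  | ⊤ => (LinearMap.codRestrict (LinearMap.ker (Rep.inMap (hS.coreflect Y).toRep)) (hS.outMap Y)
      (fun y => by
        rw [hS.inMap_coreflect Y]
        exact (Submodule.Quotient.mk_eq_zero (LinearMap.range (hS.outMap Y))).2 ⟨y, rfl⟩) :
      topMod Y →ₗ[S.A ⊥] LinearMap.ker (Rep.inMap (hS.coreflect Y).toRep))

/-- The unit `Y → F_1^+ F_1^- Y`. -/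
def FrobeniusType.unit : Y.toRep ⟶ hS.reflectionFunctor.obj (hS.coreflect Y).toRep :=
  PreRep.toRepHom (Y' := ⟨reflectX _, hS.reflectβ (hS.coreflect Y).toRep⟩) (hS.unitApp Y) (by
    intro i j h b x
    match i, j, h, b, x with
    | (i : ι), (j : ι), h, b, x =>
      exact (PreRep.toRep_φB_tmul (hS.coreflect Y)
        (WithBot.coe_lt_coe.2 (WithTop.coe_lt_coe.1 h)) b x).symm
    | (i : ι), ⊤, h, f, y =>
      refine Eq.trans ?_ (hS.eval_outMap Y y i
        ((hS.dualIso ⊥ i (WithBot.bot_lt_coe i)).toEquiv f)).symm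
      exact congrArg (fun f' => topβ Y i (BiMod.tmul f' y))
        ((hS.dualIso ⊥ i (WithBot.bot_lt_coe i)).toEquiv.symm_apply_apply f).symm
    | ⊤, _, h, _, _ => exact absurd h not_top_lt)

theorem FrobeniusType.unitApp_bijective (hY : Function.Injective (hS.outMap Y)) :
    ∀ i : WithTop ι, Function.Bijective (hS.unitApp Y i)
  | (i : ι) => Function.bijective_id
  | ⊤ => by
    refine ⟨fun y y' h => hY (congrArg Subtype.val h), fun t => ?_⟩
    have ht : (LinearMap.range (hS.outMap Y)).mkQ t.1 = 0 := by
      rw [← hS.inMap_coreflect Y]; exact t.2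
    obtain ⟨y, hy⟩ := (Submodule.Quotient.mk_eq_zero _).1 ht
    exact ⟨y, Subtype.ext hy⟩

section Transpose

variable {Y} {Z : S.Rep} (g : ∀ i : WithTop ι, Y.X i →ₗ[S.reflect.A i] reflectX Z i)

/-- The component of `g : Y → F_1^+ Z` at a vertex `j ≥ 2`, as a map of `A_j`-modules. -/
def coeHom (j : ι) : coeMod Y j →ₗ[S.A j] Z.X j := g j

/-- The component of a morphism `g : Y → F_1^+ Z` at the vertex `1` is determined by the other
components. -/
theorem FrobeniusType.tmap_outMap (hg : ∀ i j h b x, g i (Y.β i j h (BiMod.tmul b x)) =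
    hS.reflectβ Z i j h (BiMod.tmul b (g j x))) (y : topMod Y) (j : ι) :
    (S.B ⊥ j).tmap (coeHom g j) (hS.outMap Y y j) =
      (show LinearMap.ker Z.inMap from g ⊤ y).1 j := by
  refine (hS.dualBasis j).ext_eval fun f => ?_
  rw [BiMod.eval_tmap, hS.eval_outMap]
  refine (hg j ⊤ (WithTop.coe_lt_top j)
    ((hS.dualIso ⊥ j (WithBot.bot_lt_coe j)).toEquiv.symm f) y).trans ?_
  change (S.B ⊥ j).eval (Z.X j) ((hS.dualIso ⊥ j (WithBot.bot_lt_coe j)).toEquiv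
    ((hS.dualIso ⊥ j (WithBot.bot_lt_coe j)).toEquiv.symm f)) _ = _
  rw [LinearEquiv.apply_symm_apply]
  rfl

variable (hg : ∀ i j h b x, g i (Y.β i j h (BiMod.tmul b x)) =
    hS.reflectβ Z i j h (BiMod.tmul b (g j x)))

/-- The components of the morphism `F_1^- Y → Z` that belongs to a morphism `Y → F_1^+ Z`. -/
def FrobeniusType.transposeApp : ∀ i : WithBot ι, hS.coreflectX Y i →ₗ[S.A i] Z.X i
  | (j : ι) => coeHom g j
  | ⊥ => (LinearMap.range (hS.outMap Y)).liftQ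
      (Z.inMap.comp (LinearMap.pi fun j : ι => ((S.B ⊥ j).tmap (coeHom g j)).comp (LinearMap.proj j)))
      (by
        rintro _ ⟨y, rfl⟩
        rw [LinearMap.mem_ker, LinearMap.comp_apply]
        have e : (LinearMap.pi fun j : ι =>
            ((S.B ⊥ j).tmap (coeHom g j)).comp (LinearMap.proj j)) (hS.outMap Y y) =
            (show LinearMap.ker Z.inMap from g ⊤ y).1 :=
          funext fun j => hS.tmap_outMap g hg y j
        rw [e]
        exact (show LinearMap.ker Z.inMap from g ⊤ y).2)

/-- The morphism `F_1^- Y → Z` that belongs to a morphism `Y → F_1^+ Z`. -/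
def FrobeniusType.transpose : (hS.coreflect Y).toRep ⟶ Z :=
  PreRep.homMk (Y := hS.coreflect Y) (hS.transposeApp g hg) (by
    intro i j h b x
    match i, j, h, b, x with
    | (i : ι), (j : ι), h, b, x =>
      exact hg i j (WithTop.coe_lt_coe.2 (WithBot.coe_lt_coe.1 h)) b x
    | ⊥, (j : ι), h, b, x =>
      change Z.inMap (fun l => (S.B ⊥ l).tmap (coeHom g l)
        ((Pi.single j (BiMod.tmul b x) : ∀ j : ι, (S.B ⊥ j).Tens (coeMod Y j)) l)) = _
      rw [Rep.inMap_apply, Finset.sum_eq_single j]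
      · rw [Pi.single_eq_same]; rfl
      · intro l _ hl
        rw [Pi.single_eq_of_ne hl, map_zero, map_zero]
      · simp
    | _, ⊥, h, _, _ => exact absurd h not_lt_bot)

theorem FrobeniusType.map_transpose_unitApp : ∀ (i : WithTop ι) (y : Y.X i),
    Rep.Hom.f (hS.reflectionFunctor.map (hS.transpose g hg)) i (hS.unitApp Y i y) = g i y
  | (i : ι), _ => rfl
  | ⊤, y => Subtype.ext (funext fun j => hS.tmap_outMap g hg y j)

end Transpose

end Reverse

end Species

namespace Species

variable {k : Type u} [Field k] {ι : Type} [LinearOrder ι] {S : Species k (WithBot ι)}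

/-! ### The representing object of the reflection functor -/

theorem inclB_injective {ι : Type} [LinearOrder ι] (S : Species k ι) {i j : ι} (h : i < j) :
    Function.Injective (S.inclB h) :=
  DirectSum.of_injective (β := fun c : {c : List ι // Incr j c i} => S.chainTensor j c.1 i)
    ⟨[], Incr.nil h⟩

theorem op_smul_eq_zero_of_rowMul {ι : Type} [LinearOrder ι] {S : Species k ι} {i j : ι}
    (h : i < j) (b : S.B i j) {x : S.Row j} (hx : x.2 = 0) (h0 : rowMul h b x = 0) :
    op x.1 • b = 0 := by
  have e := congrFun h0 j
  rw [rowMul_apply, hx, Pi.zero_apply, ← BiMod.curry_apply, map_zero, add_zero,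
    rowSingle_same] at e
  exact S.inclB_injective h (e.trans (map_zero _).symm)

/-- As `Λ` is connected, some `B_{1j}` is nonzero. -/
theorem IsConnected.exists_nontrivial [Nonempty ι] (h : S.IsConnected) :
    ∃ j : ι, Nontrivial (S.B ⊥ j) := by
  obtain ⟨j₀⟩ := ‹Nonempty ι›
  obtain ⟨i, j, hij, h1 | h1, h2⟩ := h {⊥} ⟨⊥, rfl⟩ ⟨(j₀ : WithBot ι), WithBot.coe_ne_bot⟩
  · obtain ⟨rfl, hj⟩ := h1
    obtain ⟨j', rfl⟩ := WithBot.ne_bot_iff_exists.1 hj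
    exact ⟨j', h2⟩
  · obtain ⟨-, rfl⟩ := h1
    exact absurd hij not_lt_bot

variable (hS : S.FrobeniusType)

/-- The map `A_1 → ⨁_j B_{1j} ⊗ Hom_{A_1}(B_{1j}, A_1) ⊆ ⨁_j B_{1j} ⊗ e_j S_1(Λ)` is injective,
because some `B_{1j}` is nonzero and free over `A_1`. -/
theorem FrobeniusType.outMap_row_injective (h : ∃ j : ι, Nontrivial (S.B ⊥ j)) :
    Function.Injective (hS.outMap S.reflect.row) := by
  obtain ⟨j, hj⟩ := h
  rw [← LinearMap.ker_eq_bot, LinearMap.ker_eq_bot']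
  intro y hy
  let y' : S.reflect.Row ⊤ := y
  have hy2 : y'.2 = 0 := funext fun q => S.reflect.entry_eq_zero not_top_lt _
  have key (f : (S.B ⊥ j).leftDual) :
      @HSMul.hSMul (S.A ⊥)ᵐᵒᵖ (S.B ⊥ j).leftDual _ _ (op (show S.A ⊥ from y'.1)) f = 0 := by
    have e := hS.eval_outMap S.reflect.row y j
      ((hS.dualIso ⊥ j (WithBot.bot_lt_coe j)).toEquiv f)
    rw [hy, LinearEquiv.symm_apply_apply] at e
    have e0 : (0 : S.reflect.Row j) = ((0 : S.reflect.A j),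
        rowMul (S := S.reflect) (WithTop.coe_lt_top j) f y') :=
      ((map_zero _).symm.trans e)
    exact op_smul_eq_zero_of_rowMul (S := S.reflect) (WithTop.coe_lt_top j) f hy2
      (congrArg Prod.snd e0).symm
  have := hS.free_left ⊥ j (WithBot.bot_lt_coe j)
  let c := Module.Free.chooseBasis (S.A ⊥) (S.B ⊥ j)
  obtain ⟨s⟩ := c.index_nonempty
  have e := DFunLike.congr_fun (F := S.B ⊥ j →ₗ[S.A ⊥] S.A ⊥) (key (c.coord s)) (c s)
  have e1 : c.coord s (c s) * (show S.A ⊥ from y'.1) = 0 := e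
  have e2 : c.coord s (c s) = 1 := by simp
  rw [e2] at e1
  have hy1 : (show S.A ⊥ from y'.1) = 0 := (one_mul (M := S.A ⊥) _).symm.trans e1
  exact (Prod.ext hy1 hy2 : y' = 0)

variable [Fintype ι]

/-- The representation `F_1^-(S_1(Λ))` of `Λ`, which represents `F_1^+`. -/
def FrobeniusType.reprObj : S.Rep := (hS.coreflect S.reflect.row).toRep

/-- The universal element of `F_1^+(F_1^-(S_1(Λ)))`. -/
def FrobeniusType.reprElt : (hS.reflectionFunctor.obj hS.reprObj).Total :=
  fun i => hS.unitApp S.reflect.row i (rowUnit i)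

theorem FrobeniusType.smul_reprElt_bijective (h : ∃ j : ι, Nontrivial (S.B ⊥ j)) :
    Function.Bijective fun s : S.reflect.Alg => s • hS.reprElt := by
  have e (s : S.reflect.Alg) : s • hS.reprElt =
      (S.reflect.toModule.map (hS.unit S.reflect.row)) (s • S.reflect.rowOne) :=
    (map_smul (S.reflect.toModule.map (hS.unit S.reflect.row)).hom s S.reflect.rowOne).symm
  simp only [e]
  refine Function.Bijective.comp (g := S.reflect.toModule.map (hS.unit S.reflect.row)) ?_
    smul_rowOne_bijective
  have hb := hS.unitApp_bijective _ (hS.outMap_row_injective h)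
  exact ⟨fun x y h => funext fun i => (hb i).1 (congrFun h i),
    fun y => ⟨fun i => ((hb i).2 (y i)).choose, funext fun i => ((hb i).2 (y i)).choose_spec⟩⟩

theorem FrobeniusType.exists_map_reprElt {X : S.Rep}
    (z : (hS.reflectionFunctor.obj X).Total) :
    ∃ h : hS.reprObj ⟶ X,
      (hS.reflectionFunctor ⋙ S.reflect.toModule).map h hS.reprElt = z := by
  refine ⟨hS.transpose (Y := S.reflect.row) (Z := X)
    (rowHomApp (hS.reflectionFunctor.obj X) z) ?_, ?_⟩
  · intro i j h b x
    refine (rowHomApp_β (hS.reflectionFunctor.obj X) z h b x).trans ?_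
    exact PreRep.toRep_φB_tmul ⟨reflectX X, hS.reflectβ X⟩ h b _
  · refine funext fun i => (hS.map_transpose_unitApp _ _ i (rowUnit i)).trans ?_
    exact rowHomApp_rowUnit _ z i

theorem FrobeniusType.hom_reprObj_ext (hne : ∃ j : ι, Nontrivial (S.B ⊥ j)) {X : S.Rep}
    (h h' : hS.reprObj ⟶ X)
    (e : (hS.reflectionFunctor ⋙ S.reflect.toModule).map h hS.reprElt =
      (hS.reflectionFunctor ⋙ S.reflect.toModule).map h' hS.reprElt) : h = h' := by
  have key : ((hS.reflectionFunctor ⋙ S.reflect.toModule).map h).hom =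
      ((hS.reflectionFunctor ⋙ S.reflect.toModule).map h').hom := by
    refine LinearMap.ext fun x => ?_
    obtain ⟨s, rfl⟩ := (hS.smul_reprElt_bijective hne).2 x
    exact (map_smul ((hS.reflectionFunctor ⋙ S.reflect.toModule).map h).hom s _).trans
      ((congrArg (s • ·) e).trans
      (map_smul ((hS.reflectionFunctor ⋙ S.reflect.toModule).map h').hom s _).symm)
  have hcoe (j : ι) : Rep.Hom.f h j = Rep.Hom.f h' j := by
    refine LinearMap.ext fun x => ?_
    have e1 := congrFun (DFunLike.congr_fun key
      (Rep.single (hS.reflectionFunctor.obj hS.reprObj) (j : WithTop ι) x)) (j : WithTop ι)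
    have e2 (h : hS.reprObj ⟶ X) :
        (show ((hS.reflectionFunctor.obj X).Total) from
          ((hS.reflectionFunctor ⋙ S.reflect.toModule).map h).hom
          (Rep.single (hS.reflectionFunctor.obj hS.reprObj) (j : WithTop ι) x)) (j : WithTop ι)
          = Rep.Hom.f h j x :=
      congrArg (Rep.Hom.f h j) (Rep.single_same (hS.reflectionFunctor.obj hS.reprObj) _ x)
    exact (e2 h).symm.trans (e1.trans (e2 h'))
  refine Rep.hom_ext fun i => ?_
  match i with
  | (j : ι) => exact hcoe j
  | ⊥ =>
    refine LinearMap.ext fun x => ?_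
    obtain ⟨t, rfl⟩ : ∃ t, hS.reprObj.inMap t = x := by
      unfold reprObj
      rw [hS.inMap_coreflect]
      exact Submodule.mkQ_surjective _ x
    rw [Rep.inMap_apply, map_sum, map_sum]
    simp only [Rep.φB_map, hcoe]

end Species

/-! ### Uniqueness of the inverse Auslander-Reiten translate -/

/-- Projective covers are unique up to isomorphism. -/
theorem exists_linearEquiv_of_superfluous {R Q Q' M : Type u} [Ring R] [AddCommGroup Q]
    [Module R Q] [AddCommGroup Q'] [Module R Q'] [AddCommGroup M] [Module R M]
    (hQ : Module.Projective R Q) (hQ' : Module.Projective R Q') {p : Q →ₗ[R] M} {p' : Q' →ₗ[R] M}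
    (hp : Function.Surjective p) (hp' : Function.Surjective p')
    (hk : (LinearMap.ker p).Superfluous) (hk' : (LinearMap.ker p').Superfluous) :
    ∃ e : Q ≃ₗ[R] Q', ∀ x, p' (e x) = p x := by
  obtain ⟨f, hf⟩ := Module.projective_lifting_property p' p hp'
  have hf' (x) : p' (f x) = p x := DFunLike.congr_fun hf x
  have hfs : Function.Surjective f := by
    refine LinearMap.range_eq_top.1 (hk' _ (eq_top_iff.2 fun y _ => ?_))
    obtain ⟨x, hx⟩ := hp (p' y)
    refine Submodule.mem_sup.2 ⟨f x, ⟨x, rfl⟩, y - f x, ?_, add_sub_cancel _ _⟩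
    rw [LinearMap.mem_ker, map_sub, hf', hx, sub_self]
  obtain ⟨s, hs⟩ := Module.projective_lifting_property f LinearMap.id hfs
  have hs' (y) : f (s y) = y := DFunLike.congr_fun hs y
  have hss : Function.Surjective s := by
    refine LinearMap.range_eq_top.1 (hk _ (eq_top_iff.2 fun x _ => ?_))
    refine Submodule.mem_sup.2 ⟨s (f x), ⟨f x, rfl⟩, x - s (f x), ?_, add_sub_cancel _ _⟩
    rw [LinearMap.mem_ker, map_sub, ← hf' (s (f x)), hs', hf', sub_self]
  refine ⟨LinearEquiv.ofBijective f ⟨fun x y h => ?_, hfs⟩, hf'⟩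
  obtain ⟨x, rfl⟩ := hss x
  obtain ⟨y, rfl⟩ := hss y
  rw [hs', hs'] at h
  rw [h]

/-- Minimal projective presentations are unique up to isomorphism, and so is `τ⁻(M)`. -/
theorem IsTauInv.nonempty_equiv {k R : Type u} [Field k] [Ring R] [Algebra k R] {M : Type u}
    [AddCommGroup M] [Module k M] [Module R M] [IsScalarTower k R M] {N N' : ModuleCat.{u} R}
    (h : IsTauInv k R M N) (h' : IsTauInv k R M N') : Nonempty (N ≃ₗ[R] N') := by
  obtain ⟨Q₁, Q₀, d, p, hQ₁, hQ₀, hp, hd, hkp, hkd, ⟨eN⟩⟩ := h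
  obtain ⟨Q₁', Q₀', d', p', hQ₁', hQ₀', hp', hd', hkp', hkd', ⟨eN'⟩⟩ := h'
  obtain ⟨e₀, he₀⟩ := exists_linearEquiv_of_superfluous hQ₀ hQ₀' hp hp' hkp hkp'
  have hmem (x : Q₁) : e₀ (d x) ∈ LinearMap.range d' := by
    have hx : d x ∈ LinearMap.ker p := hd ▸ ⟨x, rfl⟩
    rw [hd', LinearMap.mem_ker, he₀]
    exact hx
  let q : Q₁ →ₗ[Rᵐᵒᵖ] LinearMap.range d' :=
    LinearMap.codRestrict _ (e₀.toLinearMap.comp d) hmem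
  have hq : Function.Surjective q := by
    rintro ⟨y, hy⟩
    have hy' : e₀.symm y ∈ LinearMap.range d := by
      rw [hd, LinearMap.mem_ker, ← he₀, e₀.apply_symm_apply]
      exact (hd' ▸ hy : y ∈ LinearMap.ker p')
    obtain ⟨x, hx⟩ := hy'
    exact ⟨x, Subtype.ext (by simp [q, hx])⟩
  have hkq : LinearMap.ker q = LinearMap.ker d := by
    ext x
    simp [q]
  have hkq' : LinearMap.ker d'.rangeRestrict = LinearMap.ker d' := LinearMap.ker_rangeRestrict d'
  obtain ⟨e₁, he₁⟩ := exists_linearEquiv_of_superfluous hQ₁ hQ₁' hq d'.surjective_rangeRestrict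
    (hkq.symm ▸ hkd) (hkq'.symm ▸ hkd')
  have he (x : Q₁) : d' (e₁ x) = e₀ (d x) := congrArg Subtype.val (he₁ x)
  let E : (Q₁' →ₗ[Rᵐᵒᵖ] R) ≃ₗ[R] (Q₁ →ₗ[Rᵐᵒᵖ] R) :=
    { toFun := fun f => f ∘ₗ e₁.toLinearMap
      invFun := fun f => f ∘ₗ e₁.symm.toLinearMap
      left_inv := fun f => by ext; simp
      right_inv := fun f => by ext; simp
      map_add' := fun _ _ => rfl
      map_smul' := fun _ _ => rfl }
  refine ⟨eN.trans (LinearEquiv.trans (Submodule.Quotient.equiv _ _ E ?_).symm eN'.symm)⟩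
  ext f
  constructor
  · rintro ⟨_, ⟨g, rfl⟩, rfl⟩
    exact ⟨g ∘ₗ e₀.toLinearMap, LinearMap.ext fun x => congrArg g (he x).symm⟩
  · rintro ⟨g, rfl⟩
    refine ⟨_, ⟨g ∘ₗ e₀.symm.toLinearMap, rfl⟩, LinearMap.ext fun x => ?_⟩
    change g (e₀.symm (d' (e₁ x))) = g (d x)
    rw [he, e₀.symm_apply_apply]

namespace Species

variable {k : Type u} [Field k] {ι : Type} [LinearOrder ι] [Fintype ι]

/-! ### Splitting off the first factor of a tensor -/

section General

variable {ι : Type} [LinearOrder ι] [Fintype ι] {S : Species k ι}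

variable (S) in
/-- The right module `e_i Λ`, as a left `A_i`-module. -/
abbrev RegCorner (i : ι) : Type u := corner (S := S) S.Alg i

theorem e_mul_coe {i : ι} (x : S.RegCorner i) : S.e i * (x : S.Alg) = x := x.2

theorem diagUnit_mul_offUnit_of_ne {i j q : ι} (h : j ≠ i) (a : S.A j) (p : S.entry i q) :
    Alg.diagUnit j a * Alg.offUnit i q p = 0 := by
  have e : Alg.offUnit i q p = Alg.diagUnit i 1 * Alg.offUnit i q p := by
    rw [Alg.diagUnit_mul_offUnit, one_smul]
  rw [e, ← mul_assoc, Alg.diagUnit_mul_diagUnit_of_ne h, zero_mul]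

theorem e_mul (j : ι) (x : S.Alg) :
    S.e j * x = Alg.diagUnit j (x.diag j) + ∑ q, Alg.offUnit j q (x.off j q) := by
  conv_lhs => rw [Alg.sum_units x]
  rw [mul_add, Finset.mul_sum, Finset.mul_sum, Finset.sum_eq_single j, Finset.sum_eq_single j]
  · change Alg.diagUnit j 1 * _ + Alg.diagUnit j 1 * _ = _
    rw [Alg.diagUnit_mul_diagUnit, one_mul, Finset.mul_sum]
    simp only [Alg.diagUnit_mul_offUnit, one_smul]
  · intro i _ hi
    rw [Finset.mul_sum]
    exact Finset.sum_eq_zero fun q _ => diagUnit_mul_offUnit_of_ne hi.symm 1 _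
  · simp
  · exact fun i _ hi => Alg.diagUnit_mul_diagUnit_of_ne hi.symm 1 _
  · simp

/-- The inclusion of `A_{jq}` in `e_j Λ`. -/
def offCorner (j q : ι) : S.entry j q →ₗ[S.A j] S.RegCorner j where
  toFun p := ⟨Alg.offUnit j q p, by
    change Alg.diagUnit j 1 * Alg.offUnit j q p = _
    rw [Alg.diagUnit_mul_offUnit, one_smul]⟩
  map_add' p p' := Subtype.ext (Alg.offUnit_add j q p p')
  map_smul' a p := Subtype.ext (Alg.diagUnit_mul_offUnit j q a p).symm

/-- The inclusion of `A_j` in `e_j Λ`. -/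
def diagCorner (j : ι) : S.A j →ₗ[S.A j] S.RegCorner j where
  toFun a := ⟨Alg.diagUnit j a, by
    change Alg.diagUnit j 1 * Alg.diagUnit j a = _
    rw [Alg.diagUnit_mul_diagUnit, one_mul]⟩
  map_add' p p' := Subtype.ext (Alg.diagUnit_add j p p')
  map_smul' a p := Subtype.ext (Alg.diagUnit_mul_diagUnit j a p).symm

theorem regCorner_eq {j : ι} (x : S.RegCorner j) :
    x = diagCorner j ((x : S.Alg).diag j) + ∑ q, offCorner j q ((x : S.Alg).off j q) := by
  refine Subtype.ext ?_
  rw [AddSubgroup.coe_add, AddSubgroup.val_finsetSum]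
  exact (e_mul_coe x).symm.trans (e_mul j _)

/-- Right multiplication with `y` on `e_j Λ`. -/
def mulRightCorner (j : ι) (y : S.Alg) : S.RegCorner j →ₗ[S.A j] S.RegCorner j where
  toFun x := ⟨x * y, by
    change S.e j * (x * y) = _
    rw [← mul_assoc, e_mul_coe]⟩
  map_add' p p' := Subtype.ext (add_mul _ _ _)
  map_smul' a p := Subtype.ext (mul_assoc _ _ _)

end General

variable {S : Species k (WithBot ι)}

/-- The inclusion of the `j`-th summand. -/
def tensSingle (j : ι) : (S.B ⊥ j).Tens (S.RegCorner j) →ₗ[S.A ⊥]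
    ∀ j : ι, (S.B ⊥ j).Tens (S.RegCorner j) :=
  LinearMap.single (S.A ⊥) (fun j : ι => (S.B ⊥ j).Tens (S.RegCorner j)) j

/-- The map `B_{1j} → ⨁_j B_{1j} ⊗ e_j Λ`, `b ↦ b ⊗ e_j`. -/
def tensUnit (j : ι) : S.B ⊥ j →ₗ[S.A ⊥] ∀ j : ι, (S.B ⊥ j).Tens (S.RegCorner j) where
  toFun b := tensSingle j (BiMod.tmul b (diagCorner (j : WithBot ι) 1))
  map_add' b b' := by rw [BiMod.add_tmul, map_add]
  map_smul' a b := by rw [BiMod.smul_tmul, map_smul, RingHom.id_apply]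

/-- The map `B_{1a} ⊗ T → ⨁_j B_{1j} ⊗ e_j Λ`, where `T` is the tensor product that belongs to a
chain from `a` to `q`. -/
def tensCons (q : WithBot ι) (a : ι) (c : List (WithBot ι)) (h : Incr q c a) :
    S.chainTensor q ((a : WithBot ι) :: c) ⊥ →ₗ[S.A ⊥]
      ∀ j : ι, (S.B ⊥ j).Tens (S.RegCorner j) :=
  (tensSingle a).comp ((S.B ⊥ a).tmap ((offCorner (a : WithBot ι) q).comp (S.incl c h)))

/-- The map `tensUnit` for all vertices; the value at the vertex `⊥` is not used. -/
def unitSplit : ∀ q : WithBot ι, S.B ⊥ q →ₗ[S.A ⊥] ∀ j : ι, (S.B ⊥ j).Tens (S.RegCorner j)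
  | ⊥ => 0
  | (j : ι) => tensUnit j

/-- The map to `⨁_j B_{1j} ⊗ e_j Λ` that splits off the first factor of a tensor. -/
def chainSplit (q : WithBot ι) : ∀ c : List (WithBot ι), Incr q c ⊥ →
    (S.chainTensor q c ⊥ →ₗ[S.A ⊥] ∀ j : ι, (S.B ⊥ j).Tens (S.RegCorner j))
  | [], _ => unitSplit q
  | ⊥ :: _, _ => 0
  | (a : ι) :: c, h => tensCons q a c h.2

/-- The map `A_{1q} → ⨁_j B_{1j} ⊗ e_j Λ` that splits off the first factor. -/
def entrySplit (q : WithBot ι) :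
    S.entry ⊥ q →ₗ[S.A ⊥] ∀ j : ι, (S.B ⊥ j).Tens (S.RegCorner j) :=
  DirectSum.toModule (S.A ⊥) {c : List (WithBot ι) // Incr q c ⊥} _
    (fun c => chainSplit q c.1 c.2)

theorem entrySplit_incl (q : WithBot ι) (c : List (WithBot ι)) (h : Incr q c ⊥)
    (t : S.chainTensor q c ⊥) : entrySplit q (S.incl c h t) = chainSplit q c h t :=
  DirectSum.toModule_lof (S.A ⊥)
    (φ := fun c : {c : List (WithBot ι) // Incr q c ⊥} => chainSplit q c.1 c.2) ⟨c, h⟩ t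

variable (S) in
/-- The multiplication `⨁_j B_{1j} ⊗ e_j Λ → e_1 Λ`. -/
def splitMul : (∀ j : ι, (S.B ⊥ j).Tens (S.RegCorner j)) →ₗ[S.A ⊥] S.RegCorner ⊥ :=
  Rep.inMap (ofModule S S.Alg)

/-- The element of `e_1 Λ` that belongs to an element of `B_{1j}`. -/
def genElt (j : ι) (b : S.B ⊥ j) : S.Alg :=
  Alg.offUnit ⊥ j (S.inclB (WithBot.bot_lt_coe j) b)

theorem coe_splitMul_tensSingle (j : ι) (b : S.B ⊥ j) (x : S.RegCorner j) :
    (splitMul S (tensSingle j (BiMod.tmul b x)) : S.Alg) = genElt j b * x := by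
  have e : splitMul S (tensSingle j (BiMod.tmul b x)) =
      Rep.φB (ofModule S S.Alg) (WithBot.bot_lt_coe j) (BiMod.tmul b x) := by
    refine (Rep.inMap_apply _ _).trans ?_
    rw [Finset.sum_eq_single j]
    · exact congrArg _ (Pi.single_eq_same (M := fun j : ι => (S.B ⊥ j).Tens (S.RegCorner j)) j _)
    · intro l _ hl
      exact (congrArg _ (Pi.single_eq_of_ne
        (M := fun j : ι => (S.B ⊥ j).Tens (S.RegCorner j)) hl _)).trans (map_zero _)
    · simp
  rw [e]
  rfl

theorem splitMul_entrySplit (q : WithBot ι) (p : S.entry ⊥ q) :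
    (splitMul S (entrySplit q p) : S.Alg) = Alg.offUnit ⊥ q p := by
  have hnil : ∀ (q : WithBot ι) (h : (⊥ : WithBot ι) < q) (b : S.B ⊥ q),
      splitMul S (unitSplit q b) = offCorner ⊥ q (S.inclB h b)
    | ⊥, h, _ => absurd h (lt_irrefl _)
    | (j : ι), h, b => Subtype.ext (by
      change (splitMul S (tensSingle j (BiMod.tmul b (diagCorner (j : WithBot ι) 1))) : S.Alg) = _
      rw [coe_splitMul_tensSingle]
      change Alg.offUnit ⊥ (j : WithBot ι) _ * Alg.diagUnit (j : WithBot ι) 1 = _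
      rw [Alg.offUnit_mul_diagUnit, MulOpposite.op_one, one_smul]
      rfl)
  have key : ∀ (q : WithBot ι) (c : List (WithBot ι)) (h : Incr q c ⊥) (t : S.chainTensor q c ⊥),
      splitMul S (chainSplit q c h t) = offCorner ⊥ q (S.incl c h t)
    | q, [], h, b => hnil q h b
    | _, ⊥ :: _, h, _ => absurd h.1 (lt_irrefl _)
    | q, (a : ι) :: c, h, t => by
      induction t using S.chain_induction with
      | h0 => simp
      | h1 b t =>
        refine Subtype.ext ?_
        change (splitMul S (tensSingle a (BiMod.tmul b
          (offCorner (a : WithBot ι) q (S.incl c h.2 t)))) : S.Alg) = _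
        rw [coe_splitMul_tensSingle]
        change Alg.offUnit ⊥ (a : WithBot ι) _ * Alg.offUnit (a : WithBot ι) q _ = Alg.offUnit ⊥ q _
        rw [Alg.offUnit_mul_offUnit, mu_inclB, cons_incl]
      | h2 x y hx hy => simp only [map_add, hx, hy]
  have key' : splitMul S (entrySplit q p) = offCorner ⊥ q p := by
    induction p using S.entry_induction with
    | h0 => simp
    | h1 c h t => rw [entrySplit_incl, key]
    | h2 x y hx hy => simp only [map_add, hx, hy]
  rw [key']
  rfl

theorem entrySplit_inclB (j : ι) (b : S.B ⊥ j) :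
    entrySplit (j : WithBot ι) (S.inclB (WithBot.bot_lt_coe j) b) =
      tensSingle j (BiMod.tmul b (diagCorner (j : WithBot ι) 1)) :=
  entrySplit_incl (j : WithBot ι) [] (WithBot.bot_lt_coe j) b

theorem entrySplit_cons (q : WithBot ι) (j : ι) (b : S.B ⊥ j) (p : S.entry j q) :
    entrySplit q (S.cons q ⊥ j (WithBot.bot_lt_coe j) (BiMod.tmul b p)) =
      tensSingle j (BiMod.tmul b (offCorner (j : WithBot ι) q p)) := by
  induction p using S.entry_induction with
  | h0 => simp only [BiMod.tmul_zero, map_zero]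
  | h1 c h t =>
    rw [cons_incl]
    exact entrySplit_incl q ((j : WithBot ι) :: c) _ _
  | h2 x y hx hy => simp only [BiMod.tmul_add, map_add, hx, hy]

/-- The inverse of the multiplication `⨁_j B_{1j} ⊗ e_j Λ → e_1 Λ` on its image. -/
def split (x : S.Alg) : ∀ j : ι, (S.B ⊥ j).Tens (S.RegCorner j) :=
  ∑ q, entrySplit q (x.off ⊥ q)

theorem split_add (x y : S.Alg) : split (x + y) = split x + split y := by
  simp only [split, Alg.add_off, map_add, Finset.sum_add_distrib]

theorem splitMul_split {x : S.Alg} (h : S.e ⊥ * x = x) (h0 : x.diag ⊥ = 0) :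
    (splitMul S (split x) : S.Alg) = x := by
  rw [split, map_sum, AddSubgroup.val_finsetSum]
  simp only [splitMul_entrySplit]
  conv_rhs => rw [← h, e_mul, h0, Alg.diagUnit_zero, zero_add]

theorem split_splitMul (t : ∀ j : ι, (S.B ⊥ j).Tens (S.RegCorner j)) :
    split (splitMul S t : S.Alg) = t := by
  let D : S.RegCorner ⊥ →+ ∀ j : ι, (S.B ⊥ j).Tens (S.RegCorner j) :=
    { toFun := fun x => split (x : S.Alg)
      map_zero' := by simp [split]
      map_add' := fun x y => split_add _ _ }
  have key (j : ι) (t : (S.B ⊥ j).Tens (S.RegCorner j)) :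
      D (splitMul S (tensSingle j t)) = tensSingle j t := by
    induction t using BiMod.tens_induction with
    | h0 => simp
    | h1 b x =>
      change split _ = _
      rw [coe_splitMul_tensSingle]
      have e (q : WithBot ι) : entrySplit q ((genElt j b * (x : S.Alg)).off ⊥ q) =
          entrySplit q (op ((x : S.Alg).diag q) • (genElt j b).off ⊥ q) +
          tensSingle j (BiMod.tmul b (offCorner (j : WithBot ι) q ((x : S.Alg).off j q))) := by
        rw [← entrySplit_cons, ← map_add, ← mu_inclB, Alg.mul_off]
        congr 1
        rw [genElt, Alg.offUnit_diag, zero_smul, zero_add, Finset.sum_eq_single (j : WithBot ι),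
          Alg.offUnit_off_same]
        · intro l _ hl
          rw [Alg.offUnit_off_of_ne _ (fun hh => hl hh.2), map_zero, AddMonoidHom.zero_apply]
        · simp
      rw [split, Finset.sum_congr rfl fun q _ => e q, Finset.sum_add_distrib,
        Finset.sum_eq_single (j : WithBot ι)]
      · rw [genElt, Alg.offUnit_off_same, ← inclB_right, entrySplit_inclB, BiMod.tmul_bal,
          ← map_smul, smul_eq_mul, mul_one]
        simp only [← BiMod.curry_apply]
        conv_rhs => rw [regCorner_eq x]
        simp only [map_add, map_sum]
      · intro q _ hq
        rw [genElt, Alg.offUnit_off_of_ne _ (fun hh => hq hh.2), smul_zero, map_zero]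
      · simp
    | h2 x y hx hy => simp only [map_add, hx, hy]
  have e : t = ∑ j, tensSingle j (t j) :=
    (Finset.univ_sum_single (M := fun j : ι => (S.B ⊥ j).Tens (S.RegCorner j)) t).symm
  change D (splitMul S t) = t
  conv_lhs => rw [e, map_sum, map_sum]
  simp only [key]
  exact e.symm

end Species

/-! ### Projectivity of `⨁_j A_{1j}` -/

/-- A module with a finite dual basis is projective. -/
theorem Module.Projective.of_dualBasis {R P : Type u} [Ring R] [AddCommGroup P] [Module Rᵐᵒᵖ P]
    {I : Type*} [Fintype I] (q : I → P) (c : I → P →ₗ[Rᵐᵒᵖ] R)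
    (h : ∀ x, ∑ i, op (c i x) • q i = x) : Module.Projective Rᵐᵒᵖ P := by
  refine Module.Projective.of_lifting_property'' fun f hf => ?_
  choose y hy using fun i => hf (q i)
  refine ⟨
    { toFun := fun x => ∑ i, op (c i x) • y i
      map_add' := fun x x' => by
        simp only [map_add, MulOpposite.op_add, add_smul, Finset.sum_add_distrib]
      map_smul' := fun r x => by
        have e (i : I) : op (c i (r • x)) = r * op (c i x) := by rw [map_smul]; rfl
        simp only [e, mul_smul, Finset.smul_sum, RingHom.id_apply] }, LinearMap.ext fun x => ?_⟩
  change f (∑ i, op (c i x) • y i) = x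
  simp only [map_sum, map_smul, hy, h]

namespace Species

variable {k : Type u} [Field k] {ι : Type} [LinearOrder ι] [Fintype ι]
variable {S : Species k (WithBot ι)}

theorem splitMul_eq_sum (t : ∀ j : ι, (S.B ⊥ j).Tens (S.RegCorner j)) :
    splitMul S t = ∑ j, splitMul S (tensSingle j (t j)) := by
  rw [← map_sum]
  exact congrArg _
    (Finset.univ_sum_single (M := fun j : ι => (S.B ⊥ j).Tens (S.RegCorner j)) t).symm

theorem splitMul_tmap (y : S.Alg) (t : ∀ j : ι, (S.B ⊥ j).Tens (S.RegCorner j)) :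
    splitMul S (fun j => (S.B ⊥ j).tmap (mulRightCorner (j : WithBot ι) y) (t j)) =
      mulRightCorner ⊥ y (splitMul S t) := by
  rw [splitMul_eq_sum, splitMul_eq_sum t, map_sum]
  refine Finset.sum_congr rfl fun j _ => ?_
  induction t j using BiMod.tens_induction with
  | h0 => simp
  | h1 b x =>
    refine Subtype.ext ?_
    rw [BiMod.tmap_tmul, coe_splitMul_tensSingle]
    change _ = (splitMul S (tensSingle j (BiMod.tmul b x)) : S.Alg) * y
    rw [coe_splitMul_tensSingle, mul_assoc]
    rfl
  | h2 x x' hx hx' => simp only [map_add, hx, hx']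

variable (S) in
/-- The right ideal `e_1 Λ`. -/
def rowIdeal : Submodule S.Algᵐᵒᵖ S.Alg where
  carrier := {x | S.e ⊥ * x = x}
  zero_mem' := mul_zero _
  add_mem' {x y} (hx : _ = _) (hy : _ = _) := by
    change S.e ⊥ * (x + y) = x + y
    rw [mul_add, hx, hy]
  smul_mem' r {x} (hx : _ = _) := by
    change S.e ⊥ * (x * r.unop) = x * r.unop
    rw [← mul_assoc, hx]

variable (S) in
/-- The right ideal `⨁_j A_{1j}` of the matrices in `e_1 Λ` with diagonal entry zero. -/
def radIdeal : Submodule S.Algᵐᵒᵖ S.Alg where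
  carrier := {x | S.e ⊥ * x = x ∧ x.diag ⊥ = 0}
  zero_mem' := ⟨mul_zero _, rfl⟩
  add_mem' {x y} hx hy := by
    refine ⟨?_, ?_⟩
    · rw [mul_add, hx.1, hy.1]
    · rw [Alg.add_diag, hx.2, hy.2, add_zero]
  smul_mem' r {x} hx := by
    refine ⟨?_, ?_⟩
    · change S.e ⊥ * (x * r.unop) = x * r.unop
      rw [← mul_assoc, hx.1]
    · change (x * r.unop).diag ⊥ = 0
      rw [Alg.mul_diag, hx.2, zero_mul]

theorem split_mul {x : S.Alg} (hx : x ∈ radIdeal S) (y : S.Alg) :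
    split (x * y) = fun j : ι => (S.B ⊥ j).tmap (mulRightCorner (j : WithBot ι) y) (split x j) := by
  rw [← split_splitMul (S := S) (fun j : ι => _), splitMul_tmap]
  conv_lhs => rw [← splitMul_split hx.1 hx.2]
  rfl

/-- The map `⨁_q A_{1q} → e_j Λ` that evaluates an element `f` of `Hom_{A_j}(B_{1j}, A_j)` at the
first factors from `B_{1j}`. -/
def contract (j : ι) (f : (S.B ⊥ j).rightDual) : radIdeal S →ₗ[S.Algᵐᵒᵖ] S.Alg where
  toFun x := ((S.B ⊥ j).eval (S.RegCorner j) f (split (x : S.Alg) j) : S.RegCorner j)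
  map_add' x y := by
    rw [Submodule.coe_add, split_add, Pi.add_apply, map_add, AddSubgroup.coe_add]
  map_smul' r x := by
    change ((S.B ⊥ j).eval (S.RegCorner j) f (split ((x : S.Alg) * r.unop) j) : S.Alg) = _
    rw [split_mul x.2, BiMod.eval_tmap]
    rfl

theorem contract_apply (j : ι) (f : (S.B ⊥ j).rightDual) (x : radIdeal S) :
    contract j f x = ((S.B ⊥ j).eval (S.RegCorner j) f (split (x : S.Alg) j) : S.RegCorner j) :=
  rfl

/-- The inclusion of `B_{1j}` in `⨁_q A_{1q}`. -/
def gen (j : ι) (b : S.B ⊥ j) : radIdeal S :=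
  ⟨genElt j b, by
    change Alg.diagUnit ⊥ 1 * Alg.offUnit ⊥ (j : WithBot ι) _ = _
    rw [Alg.diagUnit_mul_offUnit, one_smul]; rfl, rfl⟩

theorem genElt_mul_diagUnit (j : ι) (b : S.B ⊥ j) (a : S.A j) :
    genElt j b * Alg.diagUnit (j : WithBot ι) a = genElt j (op a • b) := by
  rw [genElt, Alg.offUnit_mul_diagUnit, ← inclB_right, genElt]

theorem split_genElt (j : ι) (b : S.B ⊥ j) :
    split (genElt j b) = tensSingle j (BiMod.tmul b (diagCorner (j : WithBot ι) 1)) := by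
  have e : genElt j b = genElt j b * Alg.diagUnit (j : WithBot ι) 1 := by
    rw [genElt_mul_diagUnit, MulOpposite.op_one, one_smul]
  rw [← split_splitMul (S := S) (tensSingle j _), coe_splitMul_tensSingle]
  exact congrArg split e

theorem contract_gen (j : ι) (f : (S.B ⊥ j).rightDual) (b : S.B ⊥ j) :
    contract j f (gen j b) = Alg.diagUnit (j : WithBot ι) (BiMod.rightDual.toLin f b) := by
  have e : split (gen j b : S.Alg) j = BiMod.tmul b (diagCorner (j : WithBot ι) 1) :=
    (congrFun (split_genElt j b) j).trans
      (Pi.single_eq_same (M := fun j : ι => (S.B ⊥ j).Tens (S.RegCorner j)) j _)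
  rw [contract_apply, e, BiMod.eval_tmul, ← map_smul, smul_eq_mul, mul_one]
  rfl

theorem contract_gen_of_ne {i j : ι} (h : i ≠ j) (f : (S.B ⊥ j).rightDual) (b : S.B ⊥ i) :
    contract j f (gen i b) = 0 := by
  have e : split (gen i b : S.Alg) j = 0 :=
    (congrFun (split_genElt i b) j).trans
      (Pi.single_eq_of_ne (M := fun j : ι => (S.B ⊥ j).Tens (S.RegCorner j)) h.symm _)
  rw [contract_apply, e, map_zero]
  rfl

theorem contract_add (j : ι) (f g : (S.B ⊥ j).rightDual) :
    contract j (f + g) = contract j f + contract j g := by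
  ext1 x
  rw [LinearMap.add_apply, contract_apply, map_add, AddMonoidHom.add_apply, AddSubgroup.coe_add]
  rfl

theorem contract_smul (j : ι) (a : S.A j) (f : (S.B ⊥ j).rightDual) :
    contract j (a • f) = Alg.diagUnit (j : WithBot ι) a • contract j f := by
  ext1 x
  rw [LinearMap.smul_apply, contract_apply, map_smul, AddMonoidHom.smul_apply]
  rfl

theorem e_smul_contract (j : ι) (f : (S.B ⊥ j).rightDual) : S.e j • contract j f = contract j f := by
  rw [e, ← Alg.diagUnit.eq_def, ← contract_smul, one_smul]

namespace FrobeniusType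

variable (hS : S.FrobeniusType)

theorem sum_gen_contract (x : radIdeal S) :
    ∑ j : ι, ∑ i, op (contract j ((hS.dualBasis j).d i) x) • gen j ((hS.dualBasis j).b i) = x := by
  refine Subtype.ext ?_
  conv_rhs => rw [← splitMul_split x.2.1 x.2.2, splitMul_eq_sum, AddSubgroup.val_finsetSum]
  rw [AddSubmonoidClass.coe_finsetSum]
  refine Finset.sum_congr rfl fun j _ => ?_
  rw [AddSubmonoidClass.coe_finsetSum]
  conv_rhs => rw [← (hS.dualBasis j).sum_tmul_eval (split (x : S.Alg) j), map_sum, map_sum,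
    AddSubgroup.val_finsetSum]
  refine Finset.sum_congr rfl fun i _ => ?_
  rw [coe_splitMul_tensSingle]
  rfl

theorem projective_radIdeal (hS : S.FrobeniusType) : Module.Projective S.Algᵐᵒᵖ (radIdeal S) :=
  Module.Projective.of_dualBasis (I := Σ j : ι, Fin (hS.dualBasis j).n)
    (fun i => gen i.1 ((hS.dualBasis i.1).b i.2)) (fun i => contract i.1 ((hS.dualBasis i.1).d i.2))
    (fun x => by
      rw [Fintype.sum_sigma]
      exact hS.sum_gen_contract x)

end FrobeniusType

end Species

namespace Species

variable {k : Type u} [Field k] {ι : Type} [LinearOrder ι] [Fintype ι]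
variable {S : Species k (WithBot ι)}

/-! ### The minimal projective presentation of `D P_1` -/

theorem mul_e_bot (x : S.Alg) : x * S.e ⊥ = Alg.diagUnit ⊥ (x.diag ⊥) := by
  change x * Alg.diagUnit ⊥ 1 = _
  refine Alg.ext' (fun i => ?_) (fun i j => ?_)
  · rw [Alg.mul_diag, Alg.diagUnit_diag, Alg.diagUnit_diag]
    by_cases h : i = ⊥
    · subst h; rw [Pi.single_eq_same, Pi.single_eq_same, mul_one]
    · rw [Pi.single_eq_of_ne h, Pi.single_eq_of_ne h, mul_zero]
  · rw [Alg.mul_off]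
    simp only [Alg.diagUnit_off, smul_zero, map_zero, Finset.sum_const_zero, zero_add, add_zero]
    by_cases h : j = ⊥
    · subst h; exact S.entry_eq_zero not_lt_bot _
    · rw [Alg.diagUnit_diag, Pi.single_eq_of_ne h, MulOpposite.op_zero, zero_smul]

theorem diagUnit_mem_proj (a : S.A ⊥) : Alg.diagUnit ⊥ a ∈ S.proj ⊥ := by
  refine Ideal.mem_span_singleton'.2 ⟨Alg.diagUnit ⊥ a, ?_⟩
  rw [mul_e_bot, Alg.diagUnit_diag, Pi.single_eq_same]

theorem eq_diagUnit_of_mem_proj {x : S.Alg} (h : x ∈ S.proj ⊥) :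
    x = Alg.diagUnit ⊥ (x.diag ⊥) := by
  obtain ⟨y, rfl⟩ := Ideal.mem_span_singleton'.1 h
  rw [mul_e_bot, Alg.diagUnit_diag, Pi.single_eq_same]

variable (S) in
/-- The map `e_1 Λ → D P_1`, `x ↦ (m ↦ t (x m))`, that belongs to a linear form `t` on `A_1`. -/
def toKDual (t : S.A ⊥ →ₗ[k] k) : rowIdeal S →ₗ[S.Algᵐᵒᵖ] KDual k (S.proj ⊥) where
  toFun x := (
    { toFun := fun m => t (((x : S.Alg) * (m : S.Alg)).diag ⊥)
      map_add' := fun m m' => by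
        rw [Submodule.coe_add, mul_add, Alg.add_diag, map_add]
      map_smul' := fun r m => by
        have e : ((r • m : S.proj ⊥) : S.Alg) = r • (m : S.Alg) := rfl
        rw [e, mul_smul_comm, Alg.smul_diag, map_smul, RingHom.id_apply] } : S.proj ⊥ →ₗ[k] k)
  map_add' x y := LinearMap.ext fun m => by
    change t (((x + y : S.Alg) * (m : S.Alg)).diag ⊥) =
      t (((x : S.Alg) * (m : S.Alg)).diag ⊥) + t (((y : S.Alg) * (m : S.Alg)).diag ⊥)
    rw [add_mul, Alg.add_diag, map_add]
  map_smul' r x := LinearMap.ext fun m => by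
    change t (((x : S.Alg) * r.unop * (m : S.Alg)).diag ⊥) =
      t (((x : S.Alg) * (r.unop * (m : S.Alg))).diag ⊥)
    rw [mul_assoc]

theorem toKDual_apply (t : S.A ⊥ →ₗ[k] k) (x : rowIdeal S) (m : S.proj ⊥) :
    (show S.proj ⊥ →ₗ[k] k from toKDual S t x) m =
      t ((x : S.Alg).diag ⊥ * (m : S.Alg).diag ⊥) := rfl

theorem mem_ker_toKDual {t : S.A ⊥ →ₗ[k] k} (ht : ∀ a, (∀ b, t (a * b) = 0) → a = 0)
    (x : rowIdeal S) : x ∈ LinearMap.ker (toKDual S t) ↔ (x : S.Alg).diag ⊥ = 0 := by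
  constructor
  · intro h
    refine ht _ fun b => ?_
    have e := DFunLike.congr_fun (F := S.proj ⊥ →ₗ[k] k) h ⟨_, diagUnit_mem_proj b⟩
    have e' : t ((x : S.Alg).diag ⊥ * (Alg.diagUnit ⊥ b).diag ⊥) = 0 :=
      (toKDual_apply t x ⟨_, diagUnit_mem_proj b⟩).symm.trans e
    simpa [Alg.diagUnit_diag] using e'
  · intro h
    refine LinearMap.ext (f := (show S.proj ⊥ →ₗ[k] k from toKDual S t x)) (g := 0) fun m => ?_
    rw [toKDual_apply, h, zero_mul, map_zero]
    rfl

/-- As `A_1` is a Frobenius algebra, `D P_1` is a quotient of `e_1 Λ`. -/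
theorem toKDual_surjective [Module.Finite k (S.A ⊥)] {t : S.A ⊥ →ₗ[k] k}
    (ht : ∀ a, (∀ b, t (a * b) = 0) → a = 0) : Function.Surjective (toKDual S t) := by
  let F : S.A ⊥ →ₗ[k] Module.Dual k (S.A ⊥) := (LinearMap.mul k (S.A ⊥)).compr₂ t
  have hF : Function.Injective F := (injective_iff_map_eq_zero F).2 fun a h =>
    ht a fun b => DFunLike.congr_fun h b
  have hF' : Function.Surjective F :=
    (LinearMap.injective_iff_surjective_of_finrank_eq_finrank
      (Subspace.dual_finrank_eq (K := k) (V := S.A ⊥)).symm).1 hF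
  intro f
  let f' : S.proj ⊥ →ₗ[k] k := f
  let unit : S.A ⊥ →ₗ[k] S.proj ⊥ :=
    { toFun := fun a => ⟨_, diagUnit_mem_proj a⟩
      map_add' := fun a b => Subtype.ext (Alg.diagUnit_add ⊥ a b)
      map_smul' := fun r a => Subtype.ext (Alg.ext'
        (fun i => by
          change (Pi.single ⊥ (r • a) : ∀ i, S.A i) i = r • (Pi.single ⊥ a : ∀ i, S.A i) i
          rw [Pi.single_smul]; rfl)
        (fun i j => (smul_zero _).symm)) }
  obtain ⟨a, ha⟩ := hF' (f'.comp unit)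
  refine ⟨⟨Alg.diagUnit ⊥ a, ?_⟩, ?_⟩
  · change Alg.diagUnit ⊥ 1 * Alg.diagUnit ⊥ a = _
    rw [Alg.diagUnit_mul_diagUnit, one_mul]
  · refine LinearMap.ext (f := (show S.proj ⊥ →ₗ[k] k from toKDual S t _)) (g := f') fun m => ?_
    rw [toKDual_apply]
    have e := DFunLike.congr_fun ha ((m : S.Alg).diag ⊥)
    have e1 : t (a * (m : S.Alg).diag ⊥) = f' (unit ((m : S.Alg).diag ⊥)) := e
    have e2 : unit ((m : S.Alg).diag ⊥) = m := Subtype.ext (eq_diagUnit_of_mem_proj m.2).symm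
    rw [e2] at e1
    simpa [Alg.diagUnit_diag] using e1

theorem projective_rowIdeal : Module.Projective S.Algᵐᵒᵖ (rowIdeal S) :=
  Module.Projective.of_dualBasis (I := Unit)
    (fun _ => ⟨S.e ⊥, by
      change Alg.diagUnit ⊥ 1 * Alg.diagUnit ⊥ 1 = Alg.diagUnit ⊥ 1
      rw [Alg.diagUnit_mul_diagUnit, one_mul]⟩) (fun _ => (rowIdeal S).subtype)
    (fun x => by
      rw [Fintype.sum_unique]
      exact Subtype.ext x.2)

variable (S) in
/-- The inclusion of `⨁_j A_{1j}` in `e_1 Λ`. -/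
def radIncl : radIdeal S →ₗ[S.Algᵐᵒᵖ] rowIdeal S :=
  Submodule.inclusion fun _ h => h.1

variable (S) in
/-- The inverse Auslander-Reiten translate of `P_1`: the cokernel of the map
`Hom(e_1 Λ, Λ) → Hom(rad, Λ)`, where `rad = ⨁_j A_{1j}` is the kernel of `e_1 Λ → D P_1`. -/
abbrev TauInvProj : Type u :=
  (radIdeal S →ₗ[S.Algᵐᵒᵖ] S.Alg) ⧸ LinearMap.range
    (homDual S.Alg (Q₁ := ModuleCat.of S.Algᵐᵒᵖ (radIdeal S))
      (Q₀ := ModuleCat.of S.Algᵐᵒᵖ (rowIdeal S)) (radIncl S))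

theorem FrobeniusType.isTauInv (hS : S.FrobeniusType) :
    IsTauInv k S.Alg (S.proj ⊥) (ModuleCat.of S.Alg (TauInvProj S)) := by
  obtain ⟨-, hfin, t, ht, -⟩ := hS.frobenius ⊥
  refine ⟨ModuleCat.of S.Algᵐᵒᵖ (radIdeal S), ModuleCat.of S.Algᵐᵒᵖ (rowIdeal S), radIncl S,
    toKDual S t, hS.projective_radIdeal, projective_rowIdeal, toKDual_surjective ht, ?_, ?_, ?_,
    ⟨LinearEquiv.refl _ _⟩⟩
  · ext x
    constructor
    · rintro ⟨y, rfl⟩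
      exact (mem_ker_toKDual ht _).2 y.2.2
    · intro h
      exact ⟨⟨x.1, x.2, (mem_ker_toKDual ht x).1 h⟩, rfl⟩
  · -- If `e_1 = u + x` with `u` in `U` and `x` in the radical, then `e_1 = u e_1`.
    intro U hU
    have he : S.e ⊥ * S.e ⊥ = S.e ⊥ := by
      change Alg.diagUnit ⊥ 1 * Alg.diagUnit ⊥ 1 = Alg.diagUnit ⊥ 1
      rw [Alg.diagUnit_mul_diagUnit, one_mul]
    let e : rowIdeal S := ⟨S.e ⊥, he⟩
    obtain ⟨u, hu, x, hx, hux⟩ := Submodule.mem_sup.1 (hU ▸ Submodule.mem_top : e ∈ U ⊔ _)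
    have heU : e ∈ U := by
      have e1 : op (S.e ⊥) • u = e := by
        refine Subtype.ext ?_
        have e2 : (u : S.Alg) + x = S.e ⊥ := congrArg Subtype.val hux
        have e3 : (x : S.Alg) * S.e ⊥ = 0 := by
          rw [mul_e_bot, (mem_ker_toKDual ht x).1 hx, Alg.diagUnit_zero]
        change (u : S.Alg) * S.e ⊥ = S.e ⊥
        conv_rhs => rw [← he, ← e2, add_mul, e2, e3, add_zero]
      exact e1 ▸ U.smul_mem _ hu
    refine eq_top_iff.2 fun y _ => ?_
    have e4 : op (y : S.Alg) • e = y := Subtype.ext y.2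
    exact e4 ▸ U.smul_mem _ heU
  · intro U hU
    have e : LinearMap.ker (radIncl S) = ⊥ := LinearMap.ker_eq_bot.2 (Submodule.inclusion_injective _)
    rwa [e, sup_bot_eq] at hU

end Species

namespace Species

variable {k : Type u} [Field k] {ι : Type} [LinearOrder ι] [Fintype ι]
variable {S : Species k (WithBot ι)}

/-! ### Homomorphisms from `τ⁻(P_1)` -/

variable (S) in
/-- The left `Λ`-module `Hom(rad, Λ)` for the right ideal `rad = ⨁_j A_{1j}`. -/
abbrev RadDual : Type u := radIdeal S →ₗ[S.Algᵐᵒᵖ] S.Alg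

variable (X : S.Rep)

theorem gen_add (j : ι) (b b' : S.B ⊥ j) : gen j (b + b') = gen j b + gen j b' :=
  Subtype.ext ((congrArg _ (map_add _ b b')).trans (Alg.offUnit_add _ _ _ _))

/-- The pairing `(b, x) ↦ h(b) x` for a linear map `h` from `⨁_j A_{1j}` to `Λ`. -/
def evalPairing (h : RadDual S) (j : ι) : (S.B ⊥ j).Tens (X.X j) →+ X.Total :=
  BiMod.liftAdd
    (AddMonoidHom.mk' (fun b =>
      AddMonoidHom.mk' (fun x => h (gen j b) • X.single j x) (fun x y => by
        rw [Rep.single_add, smul_add])) (fun b b' => by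
        ext x : 1
        simp only [AddMonoidHom.mk'_apply, AddMonoidHom.add_apply, gen_add, map_add, add_smul]))
    (fun b s x => by
      have e : gen j (op s • b) = op (Alg.diagUnit (j : WithBot ι) s) • gen j b :=
        Subtype.ext (genElt_mul_diagUnit j b s).symm
      change h (gen j (op s • b)) • X.single j x = h (gen j b) • X.single j (s • x)
      have e2 : X.single (j : WithBot ι) (s • x) = Alg.diagUnit (j : WithBot ι) s • X.single j x := by
        rw [Rep.diagUnit_smul, Rep.single_same]
      rw [e, map_smul, e2, ← mul_smul]
      rfl)

theorem evalPairing_tmul (h : RadDual S) (j : ι) (b : S.B ⊥ j) (x : X.X j) :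
    evalPairing X h j (BiMod.tmul b x) = h (gen j b) • X.single j x := rfl

/-- The linear map `Hom(rad, Λ) → X` that belongs to an element of `⨁_j B_{1j} ⊗ X_j`. -/
def radDualHom (t : ∀ j : ι, (S.B ⊥ j).Tens (X.X j)) : RadDual S →ₗ[S.Alg] X.Total where
  toFun h := ∑ j, evalPairing X h j (t j)
  map_add' h h' := by
    rw [← Finset.sum_add_distrib]
    refine Finset.sum_congr rfl fun j _ => ?_
    induction t j using BiMod.tens_induction with
    | h0 => simp
    | h1 b x => simp only [evalPairing_tmul, LinearMap.add_apply, add_smul]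
    | h2 x y hx hy => simp only [map_add, hx, hy]; abel
  map_smul' a h := by
    rw [Finset.smul_sum]
    refine Finset.sum_congr rfl fun j _ => ?_
    induction t j using BiMod.tens_induction with
    | h0 => simp
    | h1 b x => simp only [evalPairing_tmul, LinearMap.smul_apply, smul_assoc, RingHom.id_apply]
    | h2 x y hx hy => simp only [map_add, smul_add, hx, hy]

theorem radDualHom_apply (t : ∀ j : ι, (S.B ⊥ j).Tens (X.X j)) (h : RadDual S) :
    radDualHom X t h = ∑ j, evalPairing X h j (t j) := rfl

/-- For the left multiplication `h` with a matrix, `radDualHom` is given by the structure maps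
of `X`. -/
theorem radDualHom_mulLeft (t : ∀ j : ι, (S.B ⊥ j).Tens (X.X j)) (h : RadDual S) (a : S.Alg)
    (ha : ∀ x : radIdeal S, h x = a * x) : radDualHom X t h = a • X.single ⊥ (X.inMap t) := by
  have e (j : ι) (t : (S.B ⊥ j).Tens (X.X j)) :
      evalPairing X h j t = a • X.single ⊥ (X.φB (WithBot.bot_lt_coe j) t) := by
    induction t using BiMod.tens_induction with
    | h0 => simp
    | h1 b x =>
      have e1 : (gen j b : S.Alg) • X.single (j : WithBot ι) x =
          X.single ⊥ (X.φB (WithBot.bot_lt_coe j) (BiMod.tmul b x)) := by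
        change Alg.offUnit _ _ _ • _ = _
        rw [Rep.offUnit_smul, Rep.single_same, Rep.φB_tmul]
      rw [evalPairing_tmul, ha, mul_smul, e1]
    | h2 x y hx hy => rw [map_add, hx, hy, map_add, Rep.single_add, smul_add]
  let sg : X.X ⊥ →+ X.Total := ⟨⟨X.single ⊥, X.single_zero ⊥⟩, X.single_add ⊥⟩
  have e2 : X.single ⊥ (X.inMap t) = ∑ j, X.single ⊥ (X.φB (WithBot.bot_lt_coe j) (t j)) := by
    rw [Rep.inMap_apply]
    exact map_sum sg _ _
  rw [radDualHom_apply, e2, Finset.smul_sum]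
  exact Finset.sum_congr rfl fun j _ => e j (t j)

namespace FrobeniusType

variable (hS : S.FrobeniusType)

/-- The element of `⨁_j B_{1j} ⊗ X_j` that belongs to a linear map `Hom(rad, Λ) → X`. -/
def radElt (G : RadDual S →ₗ[S.Alg] X.Total) : ∀ j : ι, (S.B ⊥ j).Tens (X.X j) := fun j =>
  ∑ i, BiMod.tmul ((hS.dualBasis j).b i) (G (contract j ((hS.dualBasis j).d i)) j)

/-- The map `f ↦ G(contract f)_j`, which is `A_j`-linear by linearity of `G`. -/
def contractEval (G : RadDual S →ₗ[S.Alg] X.Total) (j : ι) :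
    (S.B ⊥ j).rightDual →ₗ[S.A j] X.X j where
  toFun f := G (contract j f) j
  map_add' f g := by rw [contract_add, map_add, Rep.total_add_apply]
  map_smul' a f := by
    rw [contract_smul, map_smul, Rep.diagUnit_smul, Rep.single_same, RingHom.id_apply]

theorem eval_radElt (G : RadDual S →ₗ[S.Alg] X.Total) (j : ι) (f : (S.B ⊥ j).rightDual) :
    (S.B ⊥ j).eval (X.X j) f (hS.radElt X G j) = G (contract j f) j := by
  change _ = contractEval X G j f
  conv_rhs => rw [← (hS.dualBasis j).sum_smul f, map_sum]
  rw [radElt, map_sum]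
  exact Finset.sum_congr rfl fun i _ => (map_smul (contractEval X G j) _ _).symm

theorem radElt_radDualHom (t : ∀ j : ι, (S.B ⊥ j).Tens (X.X j)) :
    hS.radElt X (radDualHom X t) = t := by
  refine funext fun j => (hS.dualBasis j).ext_eval fun f => ?_
  rw [eval_radElt, radDualHom_apply]
  have e (l : ι) (s : (S.B ⊥ l).Tens (X.X l)) (hl : l ≠ j) :
      evalPairing X (contract j f) l s = 0 := by
    induction s using BiMod.tens_induction with
    | h0 => simp
    | h1 b x => rw [evalPairing_tmul, contract_gen_of_ne hl, zero_smul]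
    | h2 x y hx hy => rw [map_add, hx, hy, add_zero]
  rw [Finset.sum_eq_single j (fun l _ hl => e l (t l) hl) (by simp)]
  induction t j using BiMod.tens_induction with
  | h0 => simp [Rep.total_zero_apply]
  | h1 b x =>
    rw [evalPairing_tmul, contract_gen, Rep.diagUnit_smul, Rep.single_same, Rep.single_same,
      BiMod.eval_tmul]
  | h2 x y hx hy => rw [map_add, Rep.total_add_apply, hx, hy, map_add]

theorem radDualHom_radElt (G : RadDual S →ₗ[S.Alg] X.Total) :
    radDualHom X (hS.radElt X G) = G := by
  refine LinearMap.ext fun h => ?_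
  rw [radDualHom_apply]
  have e (j : ι) : evalPairing X h j (hS.radElt X G j) =
      G (∑ i, h (gen j ((hS.dualBasis j).b i)) • contract j ((hS.dualBasis j).d i)) := by
    rw [radElt, map_sum, map_sum]
    refine Finset.sum_congr rfl fun i _ => ?_
    rw [evalPairing_tmul, ← Rep.e_smul, ← map_smul, e_smul_contract, map_smul]
  rw [Finset.sum_congr rfl fun j _ => e j, ← map_sum]
  congr 1
  refine LinearMap.ext fun x => ?_
  conv_rhs => rw [← hS.sum_gen_contract x, map_sum]
  rw [LinearMap.sum_apply]
  refine Finset.sum_congr rfl fun j _ => ?_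
  rw [LinearMap.sum_apply, map_sum]
  refine Finset.sum_congr rfl fun i _ => ?_
  rw [map_smul]
  rfl

/-- A linear map `Hom(rad, Λ) → X` vanishes on the image of `Hom(e_1 Λ, Λ)` if and only if the
corresponding element of `⨁_j B_{1j} ⊗ X_j` is mapped to zero in `X_1`. -/
theorem range_homDual_le_ker_iff (G : RadDual S →ₗ[S.Alg] X.Total) :
    LinearMap.range (homDual S.Alg (Q₁ := ModuleCat.of S.Algᵐᵒᵖ (radIdeal S))
      (Q₀ := ModuleCat.of S.Algᵐᵒᵖ (rowIdeal S)) (radIncl S)) ≤ LinearMap.ker G ↔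
    X.inMap (hS.radElt X G) = 0 := by
  have key (h : RadDual S) (a : S.Alg) (ha : ∀ x : radIdeal S, h x = a * x) :
      G h = a • X.single ⊥ (X.inMap (hS.radElt X G)) := by
    rw [← radDualHom_mulLeft X _ h a ha, hS.radDualHom_radElt]
  constructor
  · intro hG
    have h0 := hG ⟨(rowIdeal S).subtype, rfl⟩
    rw [LinearMap.mem_ker, key _ (S.e ⊥) (fun x => x.2.1.symm), Rep.e_smul, Rep.single_same] at h0
    rw [← X.single_same ⊥ (X.inMap _), h0, Rep.total_zero_apply]
  · rintro h0 _ ⟨φ, rfl⟩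
    have he : S.e ⊥ ∈ rowIdeal S := by
      change Alg.diagUnit ⊥ 1 * Alg.diagUnit ⊥ 1 = Alg.diagUnit ⊥ 1
      rw [Alg.diagUnit_mul_diagUnit, one_mul]
    let φ' : rowIdeal S →ₗ[S.Algᵐᵒᵖ] S.Alg := φ
    rw [LinearMap.mem_ker, key _ (φ' ⟨S.e ⊥, he⟩), h0, Rep.single_zero, smul_zero]
    intro x
    have e : radIncl S x = op (x : S.Alg) • (⟨S.e ⊥, he⟩ : rowIdeal S) :=
      Subtype.ext x.2.1.symm
    change φ' (radIncl S x) = _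
    rw [e, map_smul]
    rfl

theorem radElt_add (G G' : RadDual S →ₗ[S.Alg] X.Total) :
    hS.radElt X (G + G') = hS.radElt X G + hS.radElt X G' := by
  funext j
  simp only [radElt, LinearMap.add_apply, Rep.total_add_apply, BiMod.tmul_add,
    Finset.sum_add_distrib, Pi.add_apply]

end FrobeniusType

/-! ### The functor represented by the tilting module -/

namespace FrobeniusType

variable (hS : S.FrobeniusType) {N : ModuleCat.{u} S.Alg} (eN : N ≃ₗ[S.Alg] TauInvProj S)

/-- The restriction of a homomorphism `T_1 → X` to `τ⁻(P_1)`, as a homomorphism from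
`Hom(rad, Λ)`. -/
def toRadHom (f : S.aprTilting N →ₗ[S.Alg] X.Total) : RadDual S →ₗ[S.Alg] X.Total :=
  ((f.comp (LinearMap.inr S.Alg (S.Alg ⧸ S.proj ⊥) N)).comp eN.symm.toLinearMap).comp
    (Submodule.mkQ _)

variable (N) in
/-- The map `Λ → Λ/P_1 ⊆ T_1`. -/
def tiltIncl : S.Alg →ₗ[S.Alg] S.aprTilting N :=
  (LinearMap.inl S.Alg (S.Alg ⧸ S.proj ⊥) N).comp (Submodule.mkQ _)

/-- The vertices `j ≥ 2` of the element of `F_1^+(X)` that belongs to a homomorphism `T_1 → X`: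
the images of the `e_j` in `Λ/P_1`. -/
def tiltVec (f : S.aprTilting N →ₗ[S.Alg] X.Total) (i : WithBot ι) : X.X i :=
  f (tiltIncl N (S.e i)) i

/-- The element of `F_1^+(X)` that belongs to a homomorphism `T_1 → X`. -/
def tiltElt (f : S.aprTilting N →ₗ[S.Alg] X.Total) : ∀ i : WithTop ι, reflectX X i
  | (i : ι) => tiltVec X f i
  | ⊤ => (⟨hS.radElt X (toRadHom X eN f), by
      refine (hS.range_homDual_le_ker_iff X _).1 ?_
      rintro _ ⟨φ, rfl⟩
      have e : (Submodule.Quotient.mk (homDual S.Alg (Q₁ := ModuleCat.of S.Algᵐᵒᵖ (radIdeal S))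
        (Q₀ := ModuleCat.of S.Algᵐᵒᵖ (rowIdeal S)) (radIncl S) φ) : TauInvProj S) = 0 :=
          (Submodule.Quotient.mk_eq_zero _).2 ⟨φ, rfl⟩
      rw [LinearMap.mem_ker]
      change f ((0, eN.symm (Submodule.Quotient.mk _)) : (S.Alg ⧸ S.proj ⊥) × N) = 0
      rw [e, map_zero]
      exact map_zero f⟩ : LinearMap.ker X.inMap)

theorem tiltElt_add (f g : S.aprTilting N →ₗ[S.Alg] X.Total) :
    ∀ i : WithTop ι, hS.tiltElt X eN (f + g) i = hS.tiltElt X eN f i + hS.tiltElt X eN g i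
  | (i : ι) => rfl
  | ⊤ => Subtype.ext (hS.radElt_add X (toRadHom X eN f) (toRadHom X eN g))

theorem apply_inr_eq_of_toRadHom_eq {f g : S.aprTilting N →ₗ[S.Alg] X.Total}
    (h : toRadHom X eN f = toRadHom X eN g) (n : N) :
    f ((0, n) : (S.Alg ⧸ S.proj ⊥) × N) = g ((0, n) : (S.Alg ⧸ S.proj ⊥) × N) := by
  obtain ⟨x, hx⟩ := Submodule.Quotient.mk_surjective _ (eN n)
  have e := DFunLike.congr_fun h x
  change f ((0, eN.symm (Submodule.Quotient.mk x)) : (S.Alg ⧸ S.proj ⊥) × N) =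
    g ((0, eN.symm (Submodule.Quotient.mk x)) : (S.Alg ⧸ S.proj ⊥) × N) at e
  rwa [hx, eN.symm_apply_apply] at e

theorem tiltElt_injective : Function.Injective (hS.tiltElt X eN) := by
  intro f g h
  have hN : toRadHom X eN f = toRadHom X eN g := by
    have e : hS.radElt X (toRadHom X eN f) = hS.radElt X (toRadHom X eN g) :=
      congrArg Subtype.val (congrFun h ⊤)
    rw [← hS.radDualHom_radElt X (toRadHom X eN f), e, hS.radDualHom_radElt]
  have hq : ∀ i : WithBot ι, f (tiltIncl N (S.e i)) = g (tiltIncl N (S.e i))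
    | ⊥ => by
      have e : tiltIncl N (S.e ⊥) = 0 :=
        Prod.ext ((Submodule.Quotient.mk_eq_zero _).2 (Ideal.mem_span_singleton_self _)) rfl
      rw [e, map_zero, map_zero]
    | (i : ι) => by
      have e (f : S.aprTilting N →ₗ[S.Alg] X.Total) :
          f (tiltIncl N (S.e i)) = X.single i (tiltVec X f i) := by
        have e1 : S.e i = S.e i • S.e i := (by
          change Alg.diagUnit _ 1 = Alg.diagUnit _ 1 * Alg.diagUnit _ 1
          rw [Alg.diagUnit_mul_diagUnit, one_mul] : S.e i = S.e i * S.e i)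
        rw [tiltVec, ← Rep.e_smul, ← map_smul, ← map_smul, ← e1]
      rw [e, e]
      exact congrArg (X.single i) (congrFun h i)
  have hq' (a : S.Alg) : f (tiltIncl N a) = g (tiltIncl N a) := by
    have e : a = ∑ i, a • S.e i := by
      rw [← Finset.smul_sum, Alg.sum_e, smul_eq_mul, mul_one]
    rw [e]
    simp only [map_sum, map_smul, hq]
  refine LinearMap.ext fun (x : (S.Alg ⧸ S.proj ⊥) × N) => ?_
  obtain ⟨x, n⟩ := x
  obtain ⟨a, rfl⟩ := Submodule.Quotient.mk_surjective _ x
  have e : ((Submodule.Quotient.mk a, n) : (S.Alg ⧸ S.proj ⊥) × N) =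
      (Submodule.Quotient.mk a, 0) + (0, n) :=
    Prod.ext (add_zero _).symm (zero_add _).symm
  have e' (f : S.aprTilting N →ₗ[S.Alg] X.Total) :
      f ((Submodule.Quotient.mk a, n) : (S.Alg ⧸ S.proj ⊥) × N) =
        f (tiltIncl N a) + f ((0, n) : (S.Alg ⧸ S.proj ⊥) × N) :=
    (congrArg f e).trans (map_add f _ _)
  rw [e' f, e' g, hq', apply_inr_eq_of_toRadHom_eq X eN hN]

theorem tiltElt_surjective (z : ∀ i : WithTop ι, reflectX X i) :
    ∃ f, hS.tiltElt X eN f = z := by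
  let w : X.Total := fun i => match i with
    | ⊥ => 0
    | (i : ι) => z i
  let t : LinearMap.ker X.inMap := z ⊤
  have h1 : S.proj ⊥ ≤ LinearMap.ker (LinearMap.toSpanSingleton S.Alg X.Total w) := by
    refine (Ideal.span_singleton_le_iff_mem _).2 ?_
    change S.e ⊥ • w = 0
    rw [Rep.e_smul]
    exact X.single_zero ⊥
  have h2 := (hS.range_homDual_le_ker_iff X (radDualHom X t.1)).2 (by
    rw [radElt_radDualHom]; exact t.2)
  let f : (S.Alg ⧸ S.proj ⊥) × N →ₗ[S.Alg] X.Total :=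
    LinearMap.coprod ((S.proj ⊥).liftQ _ h1)
      ((Submodule.liftQ _ (radDualHom X t.1) h2).comp eN.toLinearMap)
  refine ⟨f, funext fun i => ?_⟩
  match i with
  | (i : ι) =>
    have e : f (tiltIncl N (S.e i)) = X.single i (w i) := by
      rw [← Rep.e_smul]
      change S.e i • w + (Submodule.liftQ _ (radDualHom X t.1) h2) (eN 0) = _
      rw [map_zero, map_zero, add_zero]
    exact (congrFun e (i : WithBot ι)).trans (X.single_same _ _)
  | ⊤ =>
    have e : toRadHom X eN f = radDualHom X t.1 := by
      refine LinearMap.ext fun h => ?_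
      change (S.proj ⊥).liftQ _ h1 0 + Submodule.liftQ _ (radDualHom X t.1) h2
        (eN (eN.symm (Submodule.Quotient.mk h))) = _
      rw [map_zero, zero_add, eN.apply_symm_apply]
      rfl
    refine Subtype.ext ?_
    change hS.radElt X (toRadHom X eN f) = t.1
    rw [e, hS.radElt_radDualHom]

/-- `F_1^+(X)` is naturally the group of homomorphisms `T_1 → X`. -/
def tiltEquiv : (S.aprTilting N ⟶ S.toModule.obj X) ≃+
    (hS.reflectionFunctor ⋙ S.reflect.toModule).obj X :=
  AddEquiv.ofBijective
    (AddMonoidHom.mk' (fun f : S.aprTilting N ⟶ S.toModule.obj X =>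
        (hS.tiltElt X eN f.hom : (hS.reflectionFunctor.obj X).Total))
      (fun f g => funext fun i => hS.tiltElt_add X eN f.hom g.hom i))
    ⟨fun f g h => ModuleCat.hom_ext (hS.tiltElt_injective X eN h), fun z => by
      obtain ⟨f, hf⟩ := hS.tiltElt_surjective X eN z
      exact ⟨ModuleCat.ofHom f, hf⟩⟩

theorem tiltEquiv_naturality {X Y : S.Rep} (f : S.aprTilting N ⟶ S.toModule.obj X) (g : X ⟶ Y) :
    hS.tiltEquiv Y eN (f ≫ S.toModule.map g) =
      (hS.reflectionFunctor ⋙ S.reflect.toModule).map g (hS.tiltEquiv X eN f) := by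
  refine funext fun i => ?_
  match i with
  | (i : ι) => rfl
  | ⊤ =>
    refine Subtype.ext (funext fun j => ?_)
    change hS.radElt Y (toRadHom Y eN (f ≫ S.toModule.map g).hom) j =
      (S.B ⊥ j).tmap (Rep.Hom.f g j) (hS.radElt X (toRadHom X eN f.hom) j)
    rw [radElt, radElt, map_sum]
    rfl

open scoped ModuleCat in
theorem tiltEquiv_smul (r : k) (f : S.aprTilting N ⟶ S.toModule.obj X) :
    hS.tiltEquiv X eN (r • f) = algebraMap k S.reflect.Alg r • hS.tiltEquiv X eN f := by
  have hs {ι : Type} [LinearOrder ι] [Fintype ι] (S : Species k ι) (X : S.Rep) (x : X.Total)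
      (i : ι) : (algebraMap k S.Alg r • x) i = algebraMap k (S.A i) r • x i := by
    rw [Rep.smul_apply]
    change _ + ∑ j, BiMod.curry (X.φ i j) 0 (x j) = _
    simp only [map_zero, AddMonoidHom.zero_apply, Finset.sum_const_zero, add_zero]
    rfl
  refine funext fun i => ?_
  refine Eq.trans ?_ (hs S.reflect _ _ i).symm
  match i with
  | (i : ι) => exact hs S X (f.hom (tiltIncl N (S.e i))) i
  | ⊤ =>
    refine Subtype.ext (funext fun j => ?_)
    change hS.radElt X (toRadHom X eN (r • f).hom) j =
      algebraMap k (S.A ⊥) r • hS.radElt X (toRadHom X eN f.hom) j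
    rw [radElt, radElt, Finset.smul_sum]
    refine Finset.sum_congr rfl fun l _ => ?_
    rw [← BiMod.smul_tmul, S.central, BiMod.tmul_bal]
    exact congrArg _ (hs S X _ j)

end FrobeniusType

end Species

/-! ### Finiteness -/

theorem BiMod.finite_tens {R S : Type u} [Ring R] [Ring S] (M : BiMod R S)
    (N : Type u) [AddCommGroup N] [Module S N] [Module.Finite R M] [Module.Finite S N] :
    Module.Finite R (M.Tens N) := by
  obtain ⟨n, x, hx⟩ := Module.Finite.exists_fin (R := S) (M := N)
  let f : (Fin n → M) →ₗ[R] M.Tens N :=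
    { toFun := fun b => ∑ i, BiMod.tmul (b i) (x i)
      map_add' := fun b b' => by simp only [Pi.add_apply, BiMod.add_tmul, Finset.sum_add_distrib]
      map_smul' := fun r b => by
        simp only [Pi.smul_apply, BiMod.smul_tmul, Finset.smul_sum, RingHom.id_apply] }
  refine Module.Finite.of_surjective f fun t => ?_
  induction t using BiMod.tens_induction with
  | h0 => exact ⟨0, map_zero f⟩
  | h1 m y =>
    obtain ⟨c, rfl⟩ := (Submodule.mem_span_range_iff_exists_fun S).1 (hx ▸ Submodule.mem_top : y ∈ _)
    refine ⟨fun i => op (c i) • m, ?_⟩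
    change ∑ i, BiMod.tmul (op (c i) • m) (x i) = _
    simp only [BiMod.tmul_bal]
    exact (map_sum (BiMod.curry (LinearMap.id : M.Tens N →ₗ[R] M.Tens N) m) _ _).symm
  | h2 s t hs ht =>
    obtain ⟨a, rfl⟩ := hs
    obtain ⟨b, rfl⟩ := ht
    exact ⟨a + b, map_add f a b⟩

theorem Species.FrobeniusType.finite_reflectX {k : Type u} [Field k] {ι : Type} [LinearOrder ι]
    [Fintype ι] {S : Species k (WithBot ι)} (hS : S.FrobeniusType) (X : S.Rep)
    (hX : ∀ i, Module.Finite (S.A i) (X.X i)) :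
    ∀ i : WithTop ι, Module.Finite (S.reflect.A i) (reflectX X i)
  | (i : ι) => hX i
  | ⊤ => by
    have := (hS.frobenius ⊥).2.1
    have : IsNoetherianRing (S.A ⊥) := isNoetherian_of_tower k inferInstance
    have (j : ι) : Module.Finite (S.A ⊥) ((S.B ⊥ j).Tens (X.X j)) := by
      have := hS.finite_left ⊥ j (WithBot.bot_lt_coe j)
      have := hX j
      exact BiMod.finite_tens _ _
    exact (inferInstance : Module.Finite (S.A ⊥) (LinearMap.ker X.inMap))

end

theorem mainTheorem3 {k : Type u} [Field k] {ι : Type} [LinearOrder ι] [Fintype ι] [Nonempty ι]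
    (S : Species k (WithBot ι)) (hS : S.FrobeniusType) (hconn : S.IsConnected) :
    (∀ X : S.Rep, (∀ i, Module.Finite (S.A i) (X.X i)) →
      ∀ i, Module.Finite (S.reflect.A i) ((hS.reflectionFunctor.obj X).X i)) ∧
    (∃ N : ModuleCat.{u} S.Alg, IsTauInv k S.Alg (S.proj ⊥) N) ∧
    ∀ N : ModuleCat.{u} S.Alg, IsTauInv k S.Alg (S.proj ⊥) N →
      ∃ σ : S.reflect.Alg ≃ₐ[k] (End (S.aprTilting N))ᵐᵒᵖ,
        Nonempty (hS.reflectionFunctor ⋙ S.reflect.toModule ≅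
          S.toModule ⋙ preadditiveCoyonedaObj (S.aprTilting N) ⋙
            ModuleCat.restrictScalars (σ : S.reflect.Alg →+* (End (S.aprTilting N))ᵐᵒᵖ)) := by
  refine ⟨fun X hX i => hS.finite_reflectX X hX i, ⟨_, hS.isTauInv⟩, fun N hN => ?_⟩
  obtain ⟨eN⟩ := hN.nonempty_equiv hS.isTauInv
  have hne := hconn.exists_nontrivial
  exact exists_algEquiv_end_of_representable S.toModule
    (hS.reflectionFunctor ⋙ S.reflect.toModule) (S.aprTilting N)
    (fun X => hS.tiltEquiv X eN) (fun f g => hS.tiltEquiv_naturality eN f g)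
    (fun X r f => hS.tiltEquiv_smul X eN r f) hS.reprObj hS.reprElt
    (hS.smul_reprElt_bijective hne) hS.exists_map_reprElt (hS.hom_reprObj_ext hne)
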